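/- Notation. For a topological space $X$, $\dim X$ (respectively $\dim_0 X$) is the least integer $n\ge -1$ such that every finite open (respectively cozero) cover of $X$ has a finite open (respectively cozero) refinement of order at most $n$, meaning that no point lies in more than $n+1$ members; it is $\infty$ if there is no such $n$. $F(X)$ and $A(X)$ are the free and the free Abelian topological group of a completely regular Hausdorff space $X$, and $\oplus$ is the topological sum. For $A\subset C^n$, $n\ge 1$, the $n$-cardinality $|A|_n$ is the least cardinality of a set $Y\subset C$ such that every point of $A$ has a coordinate in $Y$; $A$ is $n$-uncountable if $|A|_n>\omega$. A set $B\subset C$ is weakly $n$-Bernstein with respect to a topology $\sigma$ on $C^n$ if $|A\cap B^n|_n=2^\omega$ for every $n$-uncountable $\sigma$-closed set $A\subset C^n$. Theorem. Let $C$ be the Cantor set in $[0,1]$ with its usual topology $\tau$, and let $\tau^n$ be the product topology on $C^n$. There exist a topology $\mu\supset\tau^2$ on $C^2$ that has at most $2^\omega$ $2$-uncountable closed sets, all of them of $2$-cardinality at least $2^\omega$; disjoint sets $S_1,S_2\subset C$ such that $S_1$, $S_2$ and $C\setminus(S_1\cup S_2)$ are weakly $2$-Bernstein with respect to $\mu$,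 and $S_1$, $S_2$ are weakly $n$-Bernstein with respect to $\tau^n$ for all $n\ge 1$; and topologies $\tau_1,\tau_2$ on $C$ such that, with $C_i=(C,\tau_i)$, for $i=1,2$: (1) $\tau_i\supset\tau$; (2) every $\tau_i$-neighborhood of any point of $S_i$ is a $\tau$-neighborhood of that point; (3) $\tau_i$ has a base consisting of $\tau$-closed sets; (4) $\dim C_i=\dim_0 C_i=0$; (5) $C_1\times C_2$ is normal (and Hausdorff) and $\dim(C_1\times C_2)=\dim_0(C_1\times C_2)=1$; and such that the space $X=C_1\oplus C_2$ is completely regular, Hausdorff and Lindelöf and has the following properties: (i) $\dim X=\dim_0 X=0$; (ii) $\dim A(X)>0$ and $\dim_0 A(X)>0$; (iii) $\dim F(X)>0$ and $\dim_0 F(X)>0$. In particular, the free and the free Abelian topological group of a strongly zero-dimensional space (one with $\dim_0=0$) need not be strongly zero-dimensional. -/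

import Mathlib

open scoped Cardinal Topology
open Set TopologicalSpace

/-- The set `α` regarded as a space with the topology `τ`. -/
def Retop {α : Type*} (_τ : TopologicalSpace α) : Type _ := α

instance {α : Type*} (τ : TopologicalSpace α) : TopologicalSpace (Retop τ) := τ

/-- Cozero sets: the sets `{x | f x ≠ 0}` with `f` a continuous real-valued function. -/
def IsCozeroSet {X : Type*} [TopologicalSpace X] (U : Set X) : Prop :=
  ∃ f : X → ℝ, Continuous f ∧ U = {x | f x ≠ 0}

/-- Every finite cover of `X` by sets with property `P` has a finite refinement that again is a
cover by sets with property `P` and has order at most `n`, that is, no point of `X` lies in more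
than `n + 1` of its members. -/
def CoverDimLE {X : Type*} (P : Set X → Prop) (n : ℤ) : Prop :=
  ∀ 𝒰 : Set (Set X), 𝒰.Finite → (∀ U ∈ 𝒰, P U) → ⋃₀ 𝒰 = univ →
    ∃ 𝒱 : Set (Set X), 𝒱.Finite ∧ (∀ V ∈ 𝒱, P V) ∧ ⋃₀ 𝒱 = univ ∧
      (∀ V ∈ 𝒱, ∃ U ∈ 𝒰, V ⊆ U) ∧ ∀ x : X, ({V ∈ 𝒱 | x ∈ V}.ncard : ℤ) ≤ n + 1

/-- The least integer `n ≥ -1` with `CoverDimLE P n`, and `⊤` (infinity) if there is none. -/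
noncomputable def coverDim {X : Type*} (P : Set X → Prop) : WithTop ℤ :=
  sInf ((fun n : ℤ => (n : WithTop ℤ)) '' {n : ℤ | -1 ≤ n ∧ CoverDimLE P n})

/-- The covering dimension `dim X` in the sense of Čech (finite open covers). -/
noncomputable def cechDim (X : Type*) [TopologicalSpace X] : WithTop ℤ :=
  coverDim (fun U : Set X => IsOpen U)

/-- The covering dimension `dim₀ X` in the sense of Katětov (finite cozero covers). -/
noncomputable def katetovDim (X : Type*) [TopologicalSpace X] : WithTop ℤ :=
  coverDim (fun U : Set X => IsCozeroSet U)

/-- The free topological group `F(X)`: the free group on the set `X` with the finest group topology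
for which the canonical map `X → F(X)` is continuous. -/
def FreeTopGroup (X : Type*) [TopologicalSpace X] : Type _ := FreeGroup X

namespace FreeTopGroup

variable (X : Type*) [TopologicalSpace X]

instance : Group (FreeTopGroup X) := inferInstanceAs (Group (FreeGroup X))

instance : TopologicalSpace (FreeTopGroup X) :=
  (GroupTopology.coinduced (FreeGroup.of : X → FreeGroup X)).toTopologicalSpace

instance : IsTopologicalGroup (FreeTopGroup X) :=
  (GroupTopology.coinduced (FreeGroup.of : X → FreeGroup X)).toIsTopologicalGroup

end FreeTopGroup

/-- The free Abelian topological group `A(X)`: the free Abelian group on the set `X` with the finest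
group topology for which the canonical map `X → A(X)` is continuous. -/
def FreeAbelianTopGroup (X : Type*) [TopologicalSpace X] : Type _ := FreeAbelianGroup X

namespace FreeAbelianTopGroup

variable (X : Type*) [TopologicalSpace X]

instance : AddCommGroup (FreeAbelianTopGroup X) :=
  inferInstanceAs (AddCommGroup (FreeAbelianGroup X))

instance : TopologicalSpace (FreeAbelianTopGroup X) :=
  (AddGroupTopology.coinduced (FreeAbelianGroup.of : X → FreeAbelianGroup X)).toTopologicalSpace

instance : IsTopologicalAddGroup (FreeAbelianTopGroup X) :=
  (AddGroupTopology.coinduced (FreeAbelianGroup.of : X → FreeAbelianGroup X)).toIsTopologicalAddGroup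

end FreeAbelianTopGroup

/-- The `n`-cardinality `|A|ₙ` of `A ⊆ Xⁿ` (for `n ≥ 1`): the least cardinality of a set `Y ⊆ X`
such that every point of `A` has at least one coordinate in `Y`. -/
noncomputable def nCard {X : Type*} {n : ℕ} (A : Set (Fin n → X)) : Cardinal :=
  sInf {κ | ∃ Y : Set X, #Y = κ ∧ ∀ x ∈ A, ∃ i, x i ∈ Y}

/-- `A ⊆ Xⁿ` is `n`-uncountable. -/
def NUncountable {X : Type*} {n : ℕ} (A : Set (Fin n → X)) : Prop := ℵ₀ < nCard A

/-- `B ⊆ X` is weakly `n`-Bernstein with respect to the topology `σ` on `Xⁿ`: `|A ∩ Bⁿ|ₙ = 2^ω` for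
every `n`-uncountable `σ`-closed set `A`. -/
def WeaklyBernstein {X : Type*} {n : ℕ} (σ : TopologicalSpace (Fin n → X)) (B : Set X) : Prop :=
  ∀ A : Set (Fin n → X), IsClosed[σ] A → NUncountable A →
    nCard (A ∩ {x | ∀ i, x i ∈ B}) = 𝔠

/-- The product topology `τⁿ` on `Xⁿ`. -/
abbrev powTopology {X : Type*} (τ : TopologicalSpace X) (n : ℕ) : TopologicalSpace (Fin n → X) :=
  @Pi.topologicalSpace (Fin n) (fun _ => X) (fun _ => τ)

/-- The conditions on an auxiliary topology `μ` on the square of the space `(X, τ)`: it is finer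
than the product topology, has at most `2^ω` closed sets that are `2`-uncountable, and each of these
has `2`-cardinality at least `2^ω`. -/
structure IsAdmissibleSquareTopology {X : Type*} (τ : TopologicalSpace X)
    (μ : TopologicalSpace (Fin 2 → X)) : Prop where
  le_product : μ ≤ powTopology τ 2
  card_closed_le : #{A : Set (Fin 2 → X) | IsClosed[μ] A ∧ NUncountable A} ≤ 𝔠
  le_nCard : ∀ A : Set (Fin 2 → X), IsClosed[μ] A → NUncountable A → 𝔠 ≤ nCard A

/-- The conditions on a topology `σ` on the space `(X, τ)` relative to a set `S ⊆ X`: `S` is weakly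
`n`-Bernstein with respect to `τⁿ` for every `n ≥ 1`; `σ` refines `τ`; every `σ`-neighbourhood of a
point of `S` is a `τ`-neighbourhood of it; `σ` has a base of `τ`-closed sets; and both covering
dimensions of `(X, σ)` are zero. -/
structure IsBernsteinRefinement {X : Type*} (τ : TopologicalSpace X) (S : Set X)
    (σ : TopologicalSpace X) : Prop where
  weaklyBernstein : ∀ n : ℕ, 1 ≤ n → WeaklyBernstein (powTopology τ n) S
  refines : σ ≤ τ
  mem_nhds : ∀ s ∈ S, ∀ U : Set X, U ∈ @nhds X σ s → U ∈ @nhds X τ s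
  exists_closed_base :
    ∃ 𝓑 : Set (Set X), @IsTopologicalBasis X σ 𝓑 ∧ ∀ B ∈ 𝓑, IsClosed[τ] B
  cechDim_eq : cechDim (Retop σ) = 0
  katetovDim_eq : katetovDim (Retop σ) = 0

/-- The usual topology on the Cantor set in `[0, 1] ⊆ ℝ`. -/
abbrev cantorTopology : TopologicalSpace cantorSet := instTopologicalSpaceSubtype

/-! ### Covering dimension: retracts, shrinkings and criteria for dimensions 0 and 1 -/

section CoveringDimension

/-! Identify the Cantor set C with the binary sequences. Let `ff` add 1/(k+1) over the even digits k
that are 1, capped at 1; let `gg` be `ff` on the diagonal and, off it, the partial sum over the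
common initial digits. Then `gg` is locally constant off the diagonal, and μ is the topology that
`graphMap` pulls back from (C × C) × ℝ. By `exists_common_limit`, a set of diagonal points that
contains the zeros of `ff` and on which `ff` stays below 2/3 has a limit point in the graph shared
with its complement, even with the odd digits of that point prescribed. Hence there are uncountably
many such points.

A transfinite selection (`exists_bernstein_sets`, `exists_bernsteinData`) gives disjoint
Bernstein-type sets S 0, S 1, S 2. For any D and E in the square whose graph closures share
uncountably many diagonal points, it also gives a point x in S 0 and a sequence z x of pairs that
meets both D and E infinitely often and tends to (x, x) in the graph. In C_i, for i = 1, 2, such an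
x becomes the limit of the i-th coordinates of z x, points of S i keep their usual neighbourhoods,
and all other points are isolated. These sequences run through points of smaller rank, which permits
induction. Since their terms leave the branch of x at distinct levels, `gg` is continuous on C₁ × C₂
(`isSmallAt_diag`).

Let H and K be disjoint closed sets of C₁ × C₂. Their graph closures share only countably many
diagonal points, since otherwise some (x, x) would lie in both sets. Off the diagonal the common
part misses S 1 × S 2, so the whole of it lies on countably many lines and is contained in a
Lindelöf set (`lindelofOverlap`). Up to Lindelöf remainders the product therefore behaves like a
subspace of a zero-dimensional space times ℝ: it is normal and has dimension at most 1. Dimension 0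
would give a clopen set between the levels 1/3 and 2/3 of `gg`, contradicting `exists_common_limit`.

Finally, each C_i is a retract of A(C_i): a word with odd coefficient sum singles out the one branch
of the binary tree along which every cylinder contains an odd number of letters. Continuity
(`continuous_oddBranch`) uses the base of τ-closed sets. Hence C₁ × C₂ is a retract of both A(X) and
F(X), and covering dimension 0 passes to retracts. -/

theorem CoverDimLE.mono {X : Type*} {P : Set X → Prop} {m n : ℤ} (h : CoverDimLE P m)
    (hmn : m ≤ n) : CoverDimLE P n := by
  intro 𝒰 hf hP hc
  obtain ⟨𝒱, h1, h2, h3, h4, h5⟩ := h 𝒰 hf hP hc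
  exact ⟨𝒱, h1, h2, h3, h4, fun x => (h5 x).trans (by lia)⟩

theorem isLeast_coverDim {X : Type*} {P : Set X → Prop} {n : ℤ} (hn : -1 ≤ n)
    (h : CoverDimLE P n) (h' : ¬ CoverDimLE P (n - 1)) : coverDim P = n := by
  have hl : IsLeast ((fun n : ℤ => (n : WithTop ℤ)) '' {n : ℤ | -1 ≤ n ∧ CoverDimLE P n}) n := by
    refine ⟨⟨n, ⟨hn, h⟩, rfl⟩, ?_⟩
    rintro _ ⟨m, ⟨_, hm⟩, rfl⟩
    refine WithTop.coe_le_coe.2 ?_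
    by_contra! hlt
    exact h' (hm.mono (by lia))
  exact hl.csInf_eq

theorem coverDim_pos {X : Type*} {P : Set X → Prop} (h : ¬ CoverDimLE P 0) : 0 < coverDim P := by
  rcases Set.eq_empty_or_nonempty
    ((fun n : ℤ => (n : WithTop ℤ)) '' {n : ℤ | -1 ≤ n ∧ CoverDimLE P n}) with h0 | h0
  · unfold coverDim
    rw [h0, WithTop.sInf_empty]
    exact WithTop.coe_lt_top 0
  · refine lt_of_lt_of_le (WithTop.coe_lt_coe.2 (zero_lt_one : (0 : ℤ) < 1)) (le_csInf h0 ?_)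
    rintro _ ⟨m, ⟨_, hm⟩, rfl⟩
    refine WithTop.coe_le_coe.2 ?_
    by_contra! hlt
    exact h (hm.mono (by lia))

theorem not_coverDimLE_neg_one {X : Type*} [Nonempty X] {P : Set X → Prop} (hP : P univ) :
    ¬ CoverDimLE P (-1) := by
  intro h
  obtain ⟨𝒱, h1, -, h3, -, h5⟩ := h {univ} (finite_singleton _) (by simpa using hP) (by simp)
  obtain ⟨x⟩ := ‹Nonempty X›
  have hx : x ∈ ⋃₀ 𝒱 := h3 ▸ mem_univ x
  obtain ⟨V, hV, hxV⟩ := hx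
  have h6 := h5 x
  have h7 : 0 < {V ∈ 𝒱 | x ∈ V}.ncard :=
    (ncard_pos (h1.subset (sep_subset _ _))).2 ⟨V, hV, hxV⟩
  lia

theorem coverDim_eq_zero {X : Type*} [Nonempty X] {P : Set X → Prop} (hP : P univ)
    (h : CoverDimLE P 0) : coverDim P = 0 :=
  isLeast_coverDim (by lia) h (not_coverDimLE_neg_one hP)

theorem coverDim_eq_one {X : Type*} {P : Set X → Prop}
    (h : CoverDimLE P 1) (h' : ¬ CoverDimLE P 0) : coverDim P = 1 :=
  isLeast_coverDim (by lia) h h'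

/-- Pull the cover back along `r`, refine it there, and pull the refinement back along `s`. The
order at `z` is at most the order at `s z`. -/
theorem CoverDimLE.of_retract {Y Z : Type*} {P : Set Y → Prop} {Q : Set Z → Prop} {n : ℤ}
    {s : Z → Y} {r : Y → Z} (hrs : ∀ z, r (s z) = z) (hr : ∀ U, Q U → P (r ⁻¹' U))
    (hs : ∀ V, P V → Q (s ⁻¹' V)) (h : CoverDimLE P n) : CoverDimLE Q n := by
  intro 𝒰 hf hP hc
  obtain ⟨𝒱, h1, h2, h3, h4, h5⟩ := h (preimage r '' 𝒰) (hf.image _)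
    (by rintro _ ⟨U, hU, rfl⟩; exact hr U (hP U hU))
    (by
      refine eq_univ_of_forall fun y => ?_
      obtain ⟨U, hU, hy⟩ : r y ∈ ⋃₀ 𝒰 := hc ▸ mem_univ _
      exact ⟨_, ⟨U, hU, rfl⟩, hy⟩)
  refine ⟨preimage s '' 𝒱, h1.image _, ?_, ?_, ?_, ?_⟩
  · rintro _ ⟨V, hV, rfl⟩
    exact hs V (h2 V hV)
  · refine eq_univ_of_forall fun z => ?_
    obtain ⟨V, hV, hz⟩ : s z ∈ ⋃₀ 𝒱 := h3 ▸ mem_univ _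
    exact ⟨_, ⟨V, hV, rfl⟩, hz⟩
  · rintro _ ⟨V, hV, rfl⟩
    obtain ⟨_, ⟨U, hU, rfl⟩, hVU⟩ := h4 V hV
    exact ⟨U, hU, fun z hz => by simpa [hrs] using hVU hz⟩
  · intro z
    refine le_trans ?_ (h5 (s z))
    have hsub : {V ∈ preimage s '' 𝒱 | z ∈ V} ⊆ preimage s '' {V ∈ 𝒱 | s z ∈ V} := by
      rintro _ ⟨⟨V, hV, rfl⟩, hz⟩
      exact ⟨V, ⟨hV, hz⟩, rfl⟩
    have hfin : {V ∈ 𝒱 | s z ∈ V}.Finite := h1.subset (sep_subset _ _)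
    exact_mod_cast (ncard_le_ncard hsub (hfin.image _)).trans (ncard_image_le hfin)

theorem IsCozeroSet.preimage {X Y : Type*} [TopologicalSpace X] [TopologicalSpace Y] {f : X → Y}
    (hf : Continuous f) {U : Set Y} (hU : IsCozeroSet U) : IsCozeroSet (f ⁻¹' U) := by
  obtain ⟨g, hg, rfl⟩ := hU
  exact ⟨g ∘ f, hg.comp hf, rfl⟩

theorem IsCozeroSet.isOpen {X : Type*} [TopologicalSpace X] {U : Set X} (hU : IsCozeroSet U) :
    IsOpen U := by
  obtain ⟨g, hg, rfl⟩ := hU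
  exact isOpen_ne_fun hg continuous_const

theorem IsClopen.isCozeroSet {X : Type*} [TopologicalSpace X] {U : Set X} (hU : IsClopen U) :
    IsCozeroSet U := by
  classical
  refine ⟨U.indicator 1, (continuous_const (y := (1 : ℝ))).indicator (by simp [hU.frontier_eq]), ?_⟩
  ext x; by_cases h : x ∈ U <;> simp [h]

theorem cechDim_retract {Y Z : Type*} [TopologicalSpace Y] [TopologicalSpace Z]
    {s : Z → Y} {r : Y → Z} (hs : Continuous s) (hr : Continuous r) (hrs : ∀ z, r (s z) = z)
    (hZ : ¬ CoverDimLE (fun U : Set Z => IsOpen U) 0) : 0 < cechDim Y :=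
  coverDim_pos fun h => hZ (h.of_retract hrs (fun _ hU => hU.preimage hr)
    (fun _ hU => hU.preimage hs))

theorem katetovDim_retract {Y Z : Type*} [TopologicalSpace Y] [TopologicalSpace Z]
    {s : Z → Y} {r : Y → Z} (hs : Continuous s) (hr : Continuous r) (hrs : ∀ z, r (s z) = z)
    (hZ : ¬ CoverDimLE (fun U : Set Z => IsCozeroSet U) 0) : 0 < katetovDim Y :=
  coverDim_pos fun h => hZ (h.of_retract hrs (fun _ hU => hU.preimage hr)
    (fun _ hU => hU.preimage hs))

theorem subsingleton_members {X ι : Type*} {A : ι → Set X} (hA : Pairwise (Function.onFun Disjoint A))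
    (x : X) : {V ∈ range A | x ∈ V}.Subsingleton := by
  rintro _ ⟨⟨i, rfl⟩, hi⟩ _ ⟨⟨j, rfl⟩, hj⟩
  by_contra h
  have hij : i ≠ j := fun h' => h (h' ▸ rfl)
  exact disjoint_left.1 (hA hij) hi hj

/-- Covers that have a pairwise disjoint indexed refinement. -/
theorem coverDimLE_zero_of_disjoint {X : Type*} {P : Set X → Prop}
    (h : ∀ 𝒰 : Set (Set X), 𝒰.Finite → (∀ U ∈ 𝒰, P U) → ⋃₀ 𝒰 = univ →
      ∃ A : 𝒰 → Set X, (∀ i, P (A i)) ∧ (∀ i, A i ⊆ i) ∧ Pairwise (Function.onFun Disjoint A) ∧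
        ⋃ i, A i = univ) : CoverDimLE P 0 := by
  intro 𝒰 hf hP hc
  obtain ⟨A, h1, h2, h3, h4⟩ := h 𝒰 hf hP hc
  have := hf.to_subtype
  refine ⟨range A, finite_range A, ?_, by simpa using h4, ?_, fun x => ?_⟩
  · rintro _ ⟨i, rfl⟩; exact h1 i
  · rintro _ ⟨i, rfl⟩; exact ⟨i, i.2, h2 i⟩
  · have := (ncard_le_one ((finite_range A).subset (sep_subset _ _))).2
      fun a ha b hb => subsingleton_members h3 x ha hb
    lia

/-- Covers that have a refinement composed of two pairwise disjoint families. -/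
theorem coverDimLE_one_of_disjoint {X : Type*} {P : Set X → Prop}
    (h : ∀ 𝒰 : Set (Set X), 𝒰.Finite → (∀ U ∈ 𝒰, P U) → ⋃₀ 𝒰 = univ →
      ∃ A B : 𝒰 → Set X, (∀ i, P (A i)) ∧ (∀ i, P (B i)) ∧ (∀ i, A i ⊆ i) ∧ (∀ i, B i ⊆ i) ∧
        Pairwise (Function.onFun Disjoint A) ∧ Pairwise (Function.onFun Disjoint B) ∧
        (⋃ i, A i) ∪ (⋃ i, B i) = univ) : CoverDimLE P 1 := by
  intro 𝒰 hf hP hc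
  obtain ⟨A, B, h1, h1', h2, h2', h3, h3', h4⟩ := h 𝒰 hf hP hc
  have := hf.to_subtype
  refine ⟨range A ∪ range B, (finite_range A).union (finite_range B), ?_,
    by simpa [sUnion_union] using h4, ?_, fun x => ?_⟩
  · rintro _ (⟨i, rfl⟩ | ⟨i, rfl⟩)
    exacts [h1 i, h1' i]
  · rintro _ (⟨i, rfl⟩ | ⟨i, rfl⟩)
    exacts [⟨i, i.2, h2 i⟩, ⟨i, i.2, h2' i⟩]
  · have e1 := (ncard_le_one ((finite_range A).subset (sep_subset _ _))).2
      fun a ha b hb => subsingleton_members h3 x ha hb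
    have e2 := (ncard_le_one ((finite_range B).subset (sep_subset _ _))).2
      fun a ha b hb => subsingleton_members h3' x ha hb
    have e3 : {V ∈ range A ∪ range B | x ∈ V} = {V ∈ range A | x ∈ V} ∪ {V ∈ range B | x ∈ V} := by
      ext V; simp [or_and_right]
    have e4 := ncard_union_le {V ∈ range A | x ∈ V} {V ∈ range B | x ∈ V}
    rw [← e3] at e4
    lia

/-- In a normal space every finite open cover shrinks to a cozero cover. -/
theorem exists_cozero_shrinking {X ι : Type*} [TopologicalSpace X] [NormalSpace X] [Finite ι]
    {U : ι → Set X} (hU : ∀ i, IsOpen (U i)) (hc : ⋃ i, U i = univ) :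
    ∃ V : ι → Set X, (∀ i, IsCozeroSet (V i)) ∧ (∀ i, V i ⊆ U i) ∧ ⋃ i, V i = univ := by
  obtain ⟨F, hF, hFc, hFU⟩ := exists_subset_iUnion_closed_subset isClosed_univ hU
    (fun x _ => toFinite _) hc.ge
  choose f hf0 hf1 _ using fun i => exists_continuous_zero_one_of_isClosed
    (hU i).isClosed_compl (hFc i) (disjoint_compl_left_iff_subset.2 (hFU i))
  refine ⟨fun i => {x | f i x ≠ 0}, fun i => ⟨f i, (f i).continuous, rfl⟩, fun i x hx => ?_, ?_⟩
  · by_contra h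
    exact hx (hf0 i h)
  · refine eq_univ_of_forall fun x => ?_
    obtain ⟨i, hi⟩ := mem_iUnion.1 (hF (mem_univ x))
    exact mem_iUnion.2 ⟨i, by simp [hf1 i hi]⟩

/-- Shrinking an open refinement member by member to cozero sets does not raise its order. -/
theorem coverDimLE_cozero_of_open {X : Type*} [TopologicalSpace X] [NormalSpace X] {n : ℤ}
    (h : CoverDimLE (fun U : Set X => IsOpen U) n) :
    CoverDimLE (fun U : Set X => IsCozeroSet U) n := by
  intro 𝒰 hf hP hc
  obtain ⟨𝒱, h1, h2, h3, h4, h5⟩ := h 𝒰 hf (fun U hU => (hP U hU).isOpen) hc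
  have := h1.to_subtype
  obtain ⟨V, hV, hVU, hVc⟩ := exists_cozero_shrinking (U := fun i : 𝒱 => (i : Set X))
    (fun i => h2 i i.2) (by rwa [← sUnion_eq_iUnion])
  refine ⟨range V, finite_range V, ?_, by simpa using hVc, ?_, fun x => ?_⟩
  · rintro _ ⟨i, rfl⟩; exact hV i
  · rintro _ ⟨i, rfl⟩
    obtain ⟨U, hU, hiU⟩ := h4 i i.2
    exact ⟨U, hU, (hVU i).trans hiU⟩
  · refine le_trans ?_ (h5 x)
    have hfin : {V ∈ 𝒱 | x ∈ V}.Finite := h1.subset (sep_subset _ _)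
    classical
    let e : Set X → Set X := fun W => if hW : W ∈ 𝒱 then V ⟨W, hW⟩ else ∅
    have hsub : {W ∈ range V | x ∈ W} ⊆ e '' {V ∈ 𝒱 | x ∈ V} := by
      rintro _ ⟨⟨i, rfl⟩, hx⟩
      exact ⟨i, ⟨i.2, hVU i hx⟩, by simp [e]⟩
    exact_mod_cast (ncard_le_ncard hsub (hfin.image _)).trans (ncard_image_le hfin)

/-- A space of covering dimension `0` in which the disjoint closed sets `A`, `B` have disjoint
complements covering the space: they are separated by a clopen set. -/
theorem CoverDimLE.exists_clopen {X : Type*} [TopologicalSpace X] {P : Set X → Prop}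
    (hP : ∀ U, P U → IsOpen U) (h : CoverDimLE P 0) {U V : Set X} (hU : P U) (hV : P V)
    (hUV : U ∪ V = univ) : ∃ W, IsClopen W ∧ W ⊆ U ∧ Wᶜ ⊆ V := by
  obtain ⟨𝒱, h1, h2, h3, h4, h5⟩ := h {U, V} (toFinite _) (by simp [hU, hV]) (by simpa using hUV)
  have hcov : ∀ x, ∃ W ∈ 𝒱, x ∈ W := fun x => by
    have : x ∈ ⋃₀ 𝒱 := h3 ▸ mem_univ x
    simpa using this
  have huniq : ∀ x, ∀ W ∈ 𝒱, ∀ W' ∈ 𝒱, x ∈ W → x ∈ W' → W = W' := by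
    intro x W hW W' hW' hx hx'
    have h6 := h5 x
    exact (ncard_le_one (s := {V ∈ 𝒱 | x ∈ V}) (h1.subset (sep_subset _ _))).1 (by lia)
      _ ⟨hW, hx⟩ _ ⟨hW', hx'⟩
  have hcompl : (⋃₀ {W ∈ 𝒱 | W ⊆ U})ᶜ = ⋃₀ {W ∈ 𝒱 | ¬ W ⊆ U} := by
    ext x
    obtain ⟨W, hW, hx⟩ := hcov x
    constructor
    · exact fun hn => ⟨W, ⟨hW, fun hWU => hn ⟨W, ⟨hW, hWU⟩, hx⟩⟩, hx⟩
    · rintro ⟨W', ⟨hW', hn⟩, hx'⟩ ⟨W'', ⟨hW'', hs⟩, hx''⟩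
      exact hn (huniq x _ hW' _ hW'' hx' hx'' ▸ hs)
  refine ⟨⋃₀ {W ∈ 𝒱 | W ⊆ U}, ⟨⟨?_⟩, ?_⟩, sUnion_subset fun W hW => hW.2, ?_⟩
  · rw [hcompl]
    exact isOpen_sUnion fun W hW => hP _ (h2 W hW.1)
  · exact isOpen_sUnion fun W hW => hP _ (h2 W hW.1)
  · rw [hcompl]
    refine sUnion_subset fun W hW => ?_
    obtain ⟨U', hU', hs⟩ := h4 W hW.1
    rcases hU' with rfl | rfl
    exacts [absurd hs hW.2, hs]

end CoveringDimension

/-! ### Lindelöf spaces with a clopen base -/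

section LindelofZeroDimensional

/-- The clopen sets form a base. -/
def HasClopenBase (X : Type*) [TopologicalSpace X] : Prop :=
  ∀ (x : X) (U : Set X), IsOpen U → x ∈ U → ∃ W, IsClopen W ∧ x ∈ W ∧ W ⊆ U

theorem HasClopenBase.regularSpace {X : Type*} [TopologicalSpace X] (hb : HasClopenBase X) :
    RegularSpace X :=
  .of_exists_mem_nhds_isClosed_subset fun x s hs => by
    obtain ⟨U, hU, hUo, hx⟩ := mem_nhds_iff.1 hs
    obtain ⟨W, hW, hxW, hWU⟩ := hb x U hUo hx
    exact ⟨W, hW.isOpen.mem_nhds hxW, hW.isClosed, hWU.trans hU⟩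

theorem HasClopenBase.prod {X Y : Type*} [TopologicalSpace X] [TopologicalSpace Y]
    (hX : HasClopenBase X) (hY : HasClopenBase Y) : HasClopenBase (X × Y) := by
  rintro ⟨x, y⟩ U hU hx
  obtain ⟨V, W, hV, hW, hxV, hyW, hVW⟩ := isOpen_prod_iff.1 hU x y hx
  obtain ⟨V', h1, h2, h3⟩ := hX x V hV hxV
  obtain ⟨W', h1', h2', h3'⟩ := hY y W hW hyW
  exact ⟨V' ×ˢ W', h1.prod h1', ⟨h2, h2'⟩, (prod_mono h3 h3').trans hVW⟩

theorem HasClopenBase.sum {X Y : Type*} [TopologicalSpace X] [TopologicalSpace Y]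
    (hX : HasClopenBase X) (hY : HasClopenBase Y) : HasClopenBase (X ⊕ Y) := by
  rintro (x | y) U hU hx
  · obtain ⟨W, h1, h2, h3⟩ := hX x _ (hU.preimage continuous_inl) hx
    refine ⟨Sum.inl '' W, ⟨Topology.IsClosedEmbedding.inl.isClosedMap _ h1.1,
      Topology.IsOpenEmbedding.inl.isOpenMap _ h1.2⟩, ⟨x, h2, rfl⟩, image_subset_iff.2 h3⟩
  · obtain ⟨W, h1, h2, h3⟩ := hY y _ (hU.preimage continuous_inr) hx
    refine ⟨Sum.inr '' W, ⟨Topology.IsClosedEmbedding.inr.isClosedMap _ h1.1,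
      Topology.IsOpenEmbedding.inr.isOpenMap _ h1.2⟩, ⟨y, h2, rfl⟩, image_subset_iff.2 h3⟩

/-- Disjointification: a countable cover by clopen sets, each labelled by an index. -/
theorem exists_clopen_partition {X ι : Type*} [TopologicalSpace X] {E : Set X} (hE : IsClosed E)
    {W : ℕ → Set X} (hW : ∀ n, IsClopen (W n)) (hWE : ⋃ n, W n = E) (i : ℕ → ι) :
    ∃ A : ι → Set X, (∀ j, IsClopen (A j)) ∧ (∀ j, A j ⊆ ⋃ n ∈ {n | i n = j}, W n) ∧
      Pairwise (Function.onFun Disjoint A) ∧ ⋃ j, A j = E := by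
  have hD : ∀ n, IsClopen (disjointed W n) := fun n =>
    disjointedRec (p := IsClopen) (fun _ _ h => h.diff (hW _)) (hW n)
  have hdisj := disjoint_disjointed W
  set A : ι → Set X := fun j => ⋃ n ∈ {n | i n = j}, disjointed W n with hA
  have hAo : ∀ j, IsOpen (A j) := fun j => isOpen_biUnion fun n _ => (hD n).isOpen
  have hAu : ⋃ j, A j = E := by
    rw [← hWE, ← iUnion_disjointed (f := W)]
    ext x; simp [hA]
  have hAd : Pairwise (Function.onFun Disjoint A) := by
    intro j k hjk
    refine disjoint_left.2 fun x hx hx' => ?_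
    simp only [hA, mem_iUnion₂] at hx hx'
    obtain ⟨n, hn, hxn⟩ := hx
    obtain ⟨m, hm, hxm⟩ := hx'
    have hnm : n ≠ m := by rintro rfl; exact hjk (hn.symm.trans hm)
    exact disjoint_left.1 (hdisj hnm) hxn hxm
  refine ⟨A, fun j => ⟨⟨?_⟩, hAo j⟩, fun j => iUnion₂_mono fun n _ => disjointed_subset W n, hAd,
    hAu⟩
  have : (A j)ᶜ = Eᶜ ∪ ⋃ k ∈ {k | k ≠ j}, A k := by
    ext x
    constructor
    · intro hx
      by_cases hxE : x ∈ E
      · obtain ⟨k, hk⟩ := mem_iUnion.1 (hAu ▸ hxE : x ∈ ⋃ j, A j)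
        exact .inr (mem_biUnion (fun h => hx (h ▸ hk)) hk)
      · exact .inl hxE
    · rintro (hx | hx) hxj
      · exact hx (hAu ▸ mem_iUnion.2 ⟨j, hxj⟩)
      · obtain ⟨k, hk, hxk⟩ := mem_iUnion₂.1 hx
        exact disjoint_left.1 (hAd hk) hxk hxj
  rw [this]
  exact hE.isOpen_compl.union (isOpen_biUnion fun k _ => hAo k)

/-- Open covers of a clopen Lindelöf set have disjoint clopen refinements. -/
theorem IsLindelof.exists_clopen_refinement {X ι : Type*} [TopologicalSpace X]
    (hb : HasClopenBase X) {E : Set X} (hE : IsLindelof E) (hEc : IsClopen E) {U : ι → Set X}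
    (hU : ∀ i, IsOpen (U i)) (hc : E ⊆ ⋃ i, U i) :
    ∃ A : ι → Set X, (∀ i, IsClopen (A i)) ∧ (∀ i, A i ⊆ U i) ∧
      Pairwise (Function.onFun Disjoint A) ∧ ⋃ i, A i = E := by
  rcases E.eq_empty_or_nonempty with rfl | hne
  · exact ⟨fun _ => ∅, fun _ => isClopen_empty, fun _ => empty_subset _,
      fun _ _ _ => disjoint_empty _, by simp⟩
  have h1 : ∀ x : E, ∃ i W, IsClopen W ∧ x.1 ∈ W ∧ W ⊆ U i ∩ E := by
    intro x
    obtain ⟨i, hi⟩ := mem_iUnion.1 (hc x.2)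
    exact ⟨i, hb x _ ((hU i).inter hEc.isOpen) ⟨hi, x.2⟩⟩
  choose i W hW hxW hWs using h1
  have := hne.to_subtype
  obtain ⟨f, hf⟩ := hE.indexed_countable_subcover W (fun x => (hW x).isOpen)
    (fun x hx => mem_iUnion.2 ⟨⟨x, hx⟩, hxW ⟨x, hx⟩⟩)
  obtain ⟨A, hA1, hA2, hA3, hA4⟩ := exists_clopen_partition hEc.isClosed (fun n => hW (f n))
    (subset_antisymm (iUnion_subset fun n => (hWs (f n)).trans inter_subset_right) hf)
    (fun n => i (f n))
  refine ⟨A, hA1, fun j => (hA2 j).trans (iUnion₂_subset ?_), hA3, hA4⟩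
  rintro n rfl
  exact (hWs (f n)).trans inter_subset_left

theorem coverDimLE_zero_of_lindelof {X : Type*} [TopologicalSpace X] [LindelofSpace X]
    (hb : HasClopenBase X) {P : Set X → Prop} (hP : ∀ U, P U → IsOpen U)
    (hP' : ∀ U, IsClopen U → P U) : CoverDimLE P 0 := by
  refine coverDimLE_zero_of_disjoint fun 𝒰 _ hU hc => ?_
  obtain ⟨A, h1, h2, h3, h4⟩ := isLindelof_univ.exists_clopen_refinement hb isClopen_univ
    (U := fun i : 𝒰 => (i : Set X)) (fun i => hP _ (hU i i.2)) (by rw [← sUnion_eq_iUnion, hc])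
  exact ⟨A, fun i => hP' _ (h1 i), h2, h3, h4⟩

theorem cechDim_eq_zero {X : Type*} [TopologicalSpace X] [LindelofSpace X] [Nonempty X]
    (hb : HasClopenBase X) : cechDim X = 0 :=
  coverDim_eq_zero isOpen_univ
    (coverDimLE_zero_of_lindelof hb (fun _ h => h) fun _ h => h.isOpen)

theorem katetovDim_eq_zero {X : Type*} [TopologicalSpace X] [LindelofSpace X] [Nonempty X]
    (hb : HasClopenBase X) : katetovDim X = 0 :=
  coverDim_eq_zero isClopen_univ.isCozeroSet
    (coverDimLE_zero_of_lindelof hb (fun _ h => h.isOpen) fun _ h => h.isCozeroSet)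

/-- In a normal space a closed Lindelöf set with clopen Lindelöf neighbourhoods at its points has
a clopen Lindelöf neighbourhood. -/
theorem IsLindelof.exists_clopen_lindelof_superset {X : Type*} [TopologicalSpace X] [NormalSpace X]
    (hb : HasClopenBase X) {L : Set X} (hL : IsLindelof L) (hLc : IsClosed L)
    (hloc : ∀ x ∈ L, ∃ W, IsClopen W ∧ IsLindelof W ∧ x ∈ W) :
    ∃ E, IsClopen E ∧ IsLindelof E ∧ L ⊆ E := by
  rcases L.eq_empty_or_nonempty with rfl | hne
  · exact ⟨∅, isClopen_empty, isLindelof_empty, subset_rfl⟩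
  choose W₀ hW₀ hWL₀ hxW₀ using fun x : L => hloc x x.2
  have := hne.to_subtype
  obtain ⟨f, hf⟩ := hL.indexed_countable_subcover W₀ (fun x => (hW₀ x).isOpen)
    (fun x hx => mem_iUnion.2 ⟨⟨x, hx⟩, hxW₀ ⟨x, hx⟩⟩)
  set W : ℕ → Set X := disjointed (fun n => W₀ (f n)) with hWdef
  have hW : ∀ n, IsClopen (W n) := fun n =>
    disjointedRec (p := IsClopen) (fun _ _ h => h.diff (hW₀ _)) (hW₀ (f n))
  have hWL : ∀ n, IsLindelof (W n) := fun n =>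
    (hWL₀ (f n)).of_isClosed_subset (hW n).isClosed (disjointed_subset (fun n => W₀ (f n)) n)
  have hWd : Pairwise (Function.onFun Disjoint W) := disjoint_disjointed _
  have hLW : L ⊆ ⋃ n, W n := by rwa [hWdef, iUnion_disjointed]
  -- The disjoint union of the `W n` is open but need not be closed. Normality supplies an open `N`
  -- around its complement whose closure misses `L`; each `W n` is then split into a part off `L`
  -- and a part off `closure N`.
  obtain ⟨N, hN, hHN, hNL⟩ := normal_exists_closure_subset
    (isOpen_iUnion fun n => (hW n).isOpen).isClosed_compl hLc.isOpen_compl (compl_subset_compl.2 hLW)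
  have h1 : ∀ n, ∃ A B : Set X, IsClopen A ∧ IsClopen B ∧ A ⊆ Lᶜ ∧ B ⊆ (closure N)ᶜ ∧
      Disjoint A B ∧ A ∪ B = W n := by
    intro n
    obtain ⟨A, hA1, hA2, hA3, hA4⟩ := (hWL n).exists_clopen_refinement hb (hW n)
      (U := fun b : Bool => if b then Lᶜ else (closure N)ᶜ)
      (by rintro (_ | _) <;> simp [hLc.isOpen_compl])
      (fun x _ => by
        by_cases hx : x ∈ closure N
        · exact mem_iUnion.2 ⟨true, by simpa using hNL hx⟩
        · exact mem_iUnion.2 ⟨false, by simpa using hx⟩)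
    refine ⟨A true, A false, hA1 _, hA1 _, by simpa using hA2 true, by simpa using hA2 false,
      hA3 (by simp), ?_⟩
    rw [← hA4]; ext x; simp [or_comm]
  choose A B hA hB hAL hBN hAB hABW using h1
  have hBW : ∀ n, B n ⊆ W n := fun n => hABW n ▸ subset_union_right
  have hAW : ∀ n, A n ⊆ W n := fun n => hABW n ▸ subset_union_left
  -- This identity makes the union of the `B n` closed: `N` takes care of the points outside all `W
  -- n`.
  have hcompl : (⋃ n, B n)ᶜ = N ∪ ⋃ n, A n := by
    ext x
    constructor
    · intro hx
      by_cases hxW : x ∈ ⋃ n, W n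
      · obtain ⟨n, hn⟩ := mem_iUnion.1 hxW
        rw [← hABW n] at hn
        rcases hn with hn | hn
        · exact .inr (mem_iUnion.2 ⟨n, hn⟩)
        · exact absurd (mem_iUnion.2 ⟨n, hn⟩) hx
      · exact .inl (hHN hxW)
    · rintro (hx | hx) hxB <;> obtain ⟨n, hn⟩ := mem_iUnion.1 hxB
      · exact hBN n hn (subset_closure hx)
      · obtain ⟨m, hm⟩ := mem_iUnion.1 hx
        by_cases hmn : m = n
        · subst hmn
          exact disjoint_left.1 (hAB m) hm hn
        · exact disjoint_left.1 (hWd hmn) (hAW m hm) (hBW n hn)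
  refine ⟨⋃ n, B n, ⟨⟨?_⟩, isOpen_iUnion fun n => (hB n).isOpen⟩,
    isLindelof_iUnion fun n => (hWL n).of_isClosed_subset (hB n).isClosed (hBW n), fun x hx => ?_⟩
  · rw [hcompl]
    exact hN.union (isOpen_iUnion fun n => (hA n).isOpen)
  · obtain ⟨n, hn⟩ := mem_iUnion.1 (hLW hx)
    rw [← hABW n] at hn
    exact mem_iUnion.2 ⟨n, hn.resolve_left fun h => hAL n h hx⟩

end LindelofZeroDimensional

/-! ### Normality and dimension from a coarser second countable topology -/

section CoarserMetrizable

theorem hasSeparatingCover_of_countable {X : Type*} [TopologicalSpace X] {H K : Set X}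
    {𝒮 : Set (Set X)} (hc : 𝒮.Countable) (ho : ∀ U ∈ 𝒮, IsOpen U ∧ Disjoint (closure U) K)
    (hH : H ⊆ ⋃₀ 𝒮) : HasSeparatingCover H K := by
  obtain ⟨u, hu⟩ := (hc.insert ∅).exists_eq_range (insert_nonempty _ _)
  refine ⟨u, fun x hx => ?_, fun n => ?_⟩
  · obtain ⟨U, hU, hxU⟩ := hH hx
    obtain ⟨n, rfl⟩ : U ∈ range u := hu ▸ mem_insert_of_mem _ hU
    exact mem_iUnion.2 ⟨n, hxU⟩
  · rcases (hu ▸ mem_range_self n : u n ∈ insert ∅ 𝒮) with h | h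
    · simp [h]
    · exact ho _ h

variable {Z M : Type*} [TopologicalSpace Z] [TopologicalSpace M]

/-- Disjoint closed sets of `Z` have closures in the coarser topology induced by `Φ` that meet in a
set contained in a Lindelöf set. -/
def LindelofOverlap (Φ : Z → M) : Prop :=
  ∀ H K : Set Z, IsClosed H → IsClosed K → Disjoint H K →
    ∃ T : Set Z, IsLindelof T ∧ Φ ⁻¹' (closure (Φ '' H) ∩ closure (Φ '' K)) ⊆ T

/-- Points of `H` mapped outside the closure of `Φ '' K` are handled by countably many open sets of
`M`, which is hereditarily Lindelöf. The other points lie in a Lindelöf set, where countably many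
clopen sets suffice. -/
theorem LindelofOverlap.hasSeparatingCover [SecondCountableTopology M] [RegularSpace M]
    (hb : HasClopenBase Z) {Φ : Z → M} (hΦ : Continuous Φ) (hT : LindelofOverlap Φ) {H K : Set Z}
    (hH : IsClosed H) (hK : IsClosed K) (hd : Disjoint H K) : HasSeparatingCover H K := by
  obtain ⟨T, hTL, hTs⟩ := hT H K hH hK hd
  have h1 : ∀ y ∈ (closure (Φ '' K))ᶜ, ∃ O, IsOpen O ∧ y ∈ O ∧ closure O ⊆ (closure (Φ '' K))ᶜ := by
    intro y hy
    obtain ⟨s, hs, hsc, hss⟩ := exists_mem_nhds_isClosed_subset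
      (isClosed_closure.isOpen_compl.mem_nhds hy)
    exact ⟨interior s, isOpen_interior, mem_interior_iff_mem_nhds.2 hs,
      (closure_minimal interior_subset hsc).trans hss⟩
  choose! O hO hyO hOK using h1
  obtain ⟨t, htc, htK, ht⟩ := (HereditarilyLindelofSpace.isLindelof
    (closure (Φ '' K))ᶜ).elim_nhds_subcover O (fun y hy => (hO y hy).mem_nhds (hyO y hy))
  have h2 : ∀ x ∈ T ∩ H, ∃ W, IsClopen W ∧ x ∈ W ∧ W ⊆ Kᶜ := fun x hx =>
    hb x _ hK.isOpen_compl (disjoint_left.1 hd hx.2)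
  choose! W hW hxW hWK using h2
  obtain ⟨r, hrc, hrT, hr⟩ := (hTL.inter_right hH).elim_nhds_subcover W
    (fun x hx => (hW x hx).isOpen.mem_nhds (hxW x hx))
  refine hasSeparatingCover_of_countable (𝒮 := ((fun y => Φ ⁻¹' O y) '' t) ∪ (W '' r))
    ((htc.image _).union (hrc.image _)) ?_ ?_
  · rintro _ (⟨y, hy, rfl⟩ | ⟨x, hx, rfl⟩)
    · refine ⟨(hO y (htK y hy)).preimage hΦ, disjoint_left.2 fun z hz hzK => ?_⟩
      exact hOK y (htK y hy) (hΦ.closure_preimage_subset _ hz)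
        (subset_closure (mem_image_of_mem Φ hzK))
    · refine ⟨(hW x (hrT x hx)).isOpen, ?_⟩
      rw [(hW x (hrT x hx)).isClosed.closure_eq]
      exact disjoint_left.2 fun z hz => hWK x (hrT x hx) hz
  · intro x hx
    by_cases hxK : Φ x ∈ closure (Φ '' K)
    · have : x ∈ T ∩ H := ⟨hTs ⟨subset_closure (mem_image_of_mem Φ hx), hxK⟩, hx⟩
      obtain ⟨w, hw, hxw⟩ := mem_iUnion₂.1 (hr this)
      exact ⟨_, .inr ⟨w, hw, rfl⟩, hxw⟩
    · obtain ⟨w, hw, hxw⟩ := mem_iUnion₂.1 (ht hxK)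
      exact ⟨_, .inl ⟨w, hw, rfl⟩, hxw⟩

theorem LindelofOverlap.normalSpace [SecondCountableTopology M] [RegularSpace M]
    (hb : HasClopenBase Z) {Φ : Z → M} (hΦ : Continuous Φ) (hT : LindelofOverlap Φ) :
    NormalSpace Z where
  normal _ _ hH hK hd := hasSeparatingCovers_iff_separatedNhds.1
    ⟨hT.hasSeparatingCover hb hΦ hH hK hd, hT.hasSeparatingCover hb hΦ hK hH hd.symm⟩

/-- Off the levels in a dense set `Q`, open families in the product of a zero-dimensional space
with the line have disjoint open refinements. -/
theorem exists_disjoint_open_off_levels {K ι : Type*} [TopologicalSpace K]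
    [SecondCountableTopology K] (hK : HasClopenBase K) {Q : Set ℝ} (hQ : Dense Q)
    {V : ι → Set (K × ℝ)} (hV : ∀ i, IsOpen (V i)) :
    ∃ A : ι → Set (K × ℝ), (∀ i, IsOpen (A i)) ∧ (∀ i, A i ⊆ V i) ∧
      Pairwise (Function.onFun Disjoint A) ∧ (⋃ i, V i) ∩ {p | p.2 ∉ Q} ⊆ ⋃ i, A i := by
  rcases (⋃ i, V i).eq_empty_or_nonempty with hemp | hne
  · exact ⟨fun _ => ∅, fun _ => isOpen_empty, fun _ => empty_subset _,
      fun _ _ _ => disjoint_empty _, by simp [hemp]⟩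
  have h1 : ∀ p : ↥(⋃ i, V i), ∃ (i : ι) (D : Set K) (s t : ℝ), IsClopen D ∧ s ∈ Q ∧ t ∈ Q ∧
      p.1 ∈ D ×ˢ Ioo s t ∧ D ×ˢ Ioo s t ⊆ V i := by
    rintro ⟨⟨k, x⟩, hp⟩
    obtain ⟨i, hi⟩ := mem_iUnion.1 hp
    obtain ⟨D₀, I, hD₀, hI, hk, hx, hs⟩ := isOpen_prod_iff.1 (hV i) k x hi
    obtain ⟨D, hD, hkD, hDD⟩ := hK k D₀ hD₀ hk
    obtain ⟨l, u, hlu, hIs⟩ := mem_nhds_iff_exists_Ioo_subset.1 (hI.mem_nhds hx)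
    obtain ⟨s, hsQ, hs1⟩ := hQ.exists_between hlu.1
    obtain ⟨t, htQ, ht1⟩ := hQ.exists_between hlu.2
    exact ⟨i, D, s, t, hD, hsQ, htQ, ⟨hkD, hs1.2, ht1.1⟩,
      (prod_mono hDD ((Ioo_subset_Ioo hs1.1.le ht1.2.le).trans hIs)).trans hs⟩
  choose i D s t hD hs ht hp hDV using h1
  have := hne.to_subtype
  obtain ⟨f, hf⟩ := (HereditarilyLindelofSpace.isLindelof (⋃ i, V i)).indexed_countable_subcover
    (fun p => D p ×ˢ Ioo (s p) (t p)) (fun p => (hD p).isOpen.prod isOpen_Ioo)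
    (fun p h => mem_iUnion.2 ⟨⟨p, h⟩, hp ⟨p, h⟩⟩)
  -- Removing the closed earlier boxes keeps the sets open and makes them disjoint. Since the sides
  -- `D` are clopen, only points at end levels of the intervals are lost, and these levels belong to
  -- `Q`.
  set B : ℕ → Set (K × ℝ) := fun n => (D (f n) ×ˢ Ioo (s (f n)) (t (f n))) \
    ⋃ m ∈ {m | m < n}, D (f m) ×ˢ Icc (s (f m)) (t (f m)) with hB
  have hBo : ∀ n, IsOpen (B n) := fun n =>
    ((hD _).isOpen.prod isOpen_Ioo).sdiff
      ((finite_lt_nat n).isClosed_biUnion fun m _ => (hD _).isClosed.prod isClosed_Icc)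
  have hBlt : ∀ m n, m < n → Disjoint (B m) (B n) := by
    intro m n hmn
    refine disjoint_left.2 fun p hpm hpn => hpn.2 (mem_biUnion hmn ?_)
    exact ⟨hpm.1.1, Ioo_subset_Icc_self hpm.1.2⟩
  refine ⟨fun j => ⋃ n ∈ {n | i (f n) = j}, B n, fun j => isOpen_biUnion fun n _ => hBo n,
    fun j => iUnion₂_subset ?_, ?_, ?_⟩
  · rintro n rfl
    exact sdiff_subset.trans (hDV _)
  · intro j k hjk
    refine disjoint_left.2 fun p hpj hpk => ?_
    obtain ⟨n, hn, hpn⟩ := mem_iUnion₂.1 hpj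
    obtain ⟨m, hm, hpm⟩ := mem_iUnion₂.1 hpk
    rcases lt_trichotomy m n with h | h | h
    · exact disjoint_left.1 (hBlt m n h) hpm hpn
    · subst h; exact hjk (hn.symm.trans hm)
    · exact disjoint_left.1 (hBlt n m h) hpn hpm
  · rintro p ⟨hpV, hpQ⟩
    classical
    have hex : ∃ n, p ∈ D (f n) ×ˢ Ioo (s (f n)) (t (f n)) := by simpa using hf hpV
    refine mem_iUnion.2 ⟨i (f (Nat.find hex)), mem_biUnion rfl ⟨Nat.find_spec hex, ?_⟩⟩
    intro hmem
    obtain ⟨m, hm, hpm⟩ := mem_iUnion₂.1 hmem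
    refine Nat.find_min hex hm ⟨hpm.1, ?_, ?_⟩
    · exact lt_of_le_of_ne hpm.2.1 fun h => hpQ (h ▸ hs _)
    · exact lt_of_le_of_ne hpm.2.2 fun h => hpQ (h ▸ ht _)

/-- Outside a clopen Lindelöf set `E`, the cover is refined by preimages of open sets of `K × ℝ`.
Two disjoint families, each leaving gaps only at the levels of a dense set, cover everything when
the two dense sets are disjoint. On `E` one disjoint clopen family is enough, and it is merged with
the first. -/
theorem LindelofOverlap.coverDimLE_one {K : Type*} [TopologicalSpace K]
    [SecondCountableTopology K] (hK : HasClopenBase K) [NormalSpace Z] (hb : HasClopenBase Z)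
    {Φ : Z → K × ℝ} (hΦ : Continuous Φ) (hT : LindelofOverlap Φ)
    (hloc : ∀ z : Z, ∃ W, IsClopen W ∧ IsLindelof W ∧ z ∈ W) :
    CoverDimLE (fun U : Set Z => IsOpen U) 1 := by
  refine coverDimLE_one_of_disjoint fun 𝒰 hfin hU hc => ?_
  have := hfin.to_subtype
  have hUo : ∀ i : 𝒰, IsOpen (i : Set Z) := fun i => hU i i.2
  obtain ⟨F, hF, hFc, hFU⟩ := exists_subset_iUnion_closed_subset isClosed_univ hUo
    (fun x _ => toFinite _) (by rw [← sUnion_eq_iUnion, hc])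
  choose T hTL hTs using fun i : 𝒰 => hT (F i) (i : Set Z)ᶜ (hFc i) (hUo i).isClosed_compl
    (disjoint_compl_right_iff_subset.2 (hFU i))
  -- The largest open set of `K × ℝ` whose preimage lies in the given member of the cover. The
  -- points missed by all these preimages lie in the Lindelöf overlaps.
  set V : 𝒰 → Set (K × ℝ) := fun i => (closure (Φ '' (i : Set Z)ᶜ))ᶜ with hV
  have hVo : ∀ i, IsOpen (V i) := fun i => isClosed_closure.isOpen_compl
  have hVU : ∀ i, Φ ⁻¹' V i ⊆ i := fun i z hz => by
    by_contra h
    exact hz (subset_closure (mem_image_of_mem Φ h))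
  have hLc : IsClosed (Φ ⁻¹' ⋃ i, V i)ᶜ := ((isOpen_iUnion hVo).preimage hΦ).isClosed_compl
  have hLT : (Φ ⁻¹' ⋃ i, V i)ᶜ ⊆ ⋃ i, T i := by
    intro z hz
    obtain ⟨i, hi⟩ := mem_iUnion.1 (hF (mem_univ z))
    refine mem_iUnion.2 ⟨i, hTs i ⟨subset_closure (mem_image_of_mem Φ hi), ?_⟩⟩
    by_contra h
    exact hz (mem_iUnion.2 ⟨i, h⟩)
  obtain ⟨E, hEc, hEL, hLE⟩ := ((isLindelof_iUnion hTL).of_isClosed_subset hLc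
    hLT).exists_clopen_lindelof_superset hb hLc (fun z _ => hloc z)
  obtain ⟨G, hG1, hG2, hG3, hG4⟩ := hEL.exists_clopen_refinement hb hEc hUo
    (by rw [← sUnion_eq_iUnion, hc]; exact subset_univ _)
  have hQ : Dense (range ((↑) : ℚ → ℝ)) := Rat.denseRange_cast
  -- The translate of ℚ by √2 is dense and disjoint from ℚ, so no level is exceptional for both
  -- families.
  have hQ' : Dense ((fun x => √2 + x) '' range ((↑) : ℚ → ℝ)) :=
    (Homeomorph.addLeft √2).surjective.denseRange.dense_image
      (Homeomorph.addLeft √2).continuous hQ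
  obtain ⟨A, hA1, hA2, hA3, hA4⟩ := exists_disjoint_open_off_levels hK hQ hVo
  obtain ⟨B, hB1, hB2, hB3, hB4⟩ := exists_disjoint_open_off_levels hK hQ' hVo
  have hGE : ∀ i, G i ⊆ E := fun i => hG4 ▸ subset_iUnion G i
  refine ⟨fun i => (Φ ⁻¹' A i \ E) ∪ G i, fun i => Φ ⁻¹' B i \ E, fun i => ?_, fun i => ?_,
    fun i => ?_, fun i => ?_, ?_, ?_, ?_⟩
  · exact (((hA1 i).preimage hΦ).sdiff hEc.isClosed).union (hG1 i).isOpen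
  · exact ((hB1 i).preimage hΦ).sdiff hEc.isClosed
  · exact union_subset (sdiff_subset.trans ((preimage_mono (hA2 i)).trans (hVU i))) (hG2 i)
  · exact sdiff_subset.trans ((preimage_mono (hB2 i)).trans (hVU i))
  · intro i j hij
    refine disjoint_left.2 ?_
    rintro z (hz | hz) (hz' | hz')
    · exact disjoint_left.1 (hA3 hij) hz.1 hz'.1
    · exact hz.2 (hGE j hz')
    · exact hz'.2 (hGE i hz)
    · exact disjoint_left.1 (hG3 hij) hz hz'
  · intro i j hij
    exact disjoint_left.2 fun z hz hz' => disjoint_left.1 (hB3 hij) hz.1 hz'.1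
  · refine eq_univ_of_forall fun z => ?_
    by_cases hzE : z ∈ E
    · obtain ⟨i, hi⟩ := mem_iUnion.1 (hG4 ▸ hzE : z ∈ ⋃ i, G i)
      exact .inl (mem_iUnion.2 ⟨i, .inr hi⟩)
    · have hzV : Φ z ∈ ⋃ i, V i := by
        by_contra h
        exact hzE (hLE h)
      by_cases hzQ : (Φ z).2 ∈ range ((↑) : ℚ → ℝ)
      · have : (Φ z).2 ∉ (fun x => √2 + x) '' range ((↑) : ℚ → ℝ) := by
          rintro ⟨_, ⟨r, rfl⟩, hr⟩
          obtain ⟨q, hq⟩ := hzQ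
          refine irrational_sqrt_two ⟨q - r, ?_⟩
          push_cast
          rw [hq, ← hr]; ring
        obtain ⟨i, hi⟩ := mem_iUnion.1 (hB4 ⟨hzV, this⟩)
        exact .inr (mem_iUnion.2 ⟨i, hi, hzE⟩)
      · obtain ⟨i, hi⟩ := mem_iUnion.1 (hA4 ⟨hzV, hzQ⟩)
        exact .inl (mem_iUnion.2 ⟨i, .inl ⟨hi, hzE⟩⟩)

end CoarserMetrizable

/-! ### The binary tree and the functions on the line and the square -/

section Tree

open Filter

variable {C : Type*} [TopologicalSpace C] (e : C ≃ₜ (ℕ → Bool))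

/-- The basic clopen set of points agreeing with `x` in the first `n` digits. -/
def cyl (x : C) (n : ℕ) : Set C := {y | ∀ k < n, e y k = e x k}

/-- The first digit where two points differ. -/
noncomputable def fd (x y : C) : ℕ := PiNat.firstDiff (e x) (e y)

variable {e}

theorem mem_cyl_self (x : C) (n : ℕ) : x ∈ cyl e x n := fun _ _ => rfl

theorem isClopen_cyl (x : C) (n : ℕ) : IsClopen (cyl e x n) := by
  have : cyl e x n = ⋂ k ∈ {k | k < n}, (fun y => e y k) ⁻¹' {e x k} := by
    ext y; simp [cyl]
  rw [this]
  refine (finite_lt_nat n).isClopen_biInter fun k _ => (isClopen_discrete _).preimage ?_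
  exact (continuous_apply k).comp e.continuous

theorem cyl_mem_nhds (x : C) (n : ℕ) : cyl e x n ∈ 𝓝 x :=
  (isClopen_cyl x n).isOpen.mem_nhds (mem_cyl_self x n)

theorem cyl_anti (x : C) {m n : ℕ} (h : m ≤ n) : cyl e x n ⊆ cyl e x m :=
  fun _ hy k hk => hy k (hk.trans_le h)

theorem cyl_eq {x y : C} {n : ℕ} (h : y ∈ cyl e x n) : cyl e y n = cyl e x n := by
  ext z
  exact ⟨fun hz k hk => (hz k hk).trans (h k hk), fun hz k hk => (hz k hk).trans (h k hk).symm⟩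

theorem exists_cyl_subset {x : C} {U : Set C} (hU : U ∈ 𝓝 x) : ∃ n, cyl e x n ⊆ U := by
  have h1 : e.symm ⁻¹' U ∈ 𝓝 (e x) := e.symm.continuous.continuousAt.preimage_mem_nhds (by simpa)
  obtain ⟨V, hV, hVo, hxV⟩ := mem_nhds_iff.1 h1
  obtain ⟨_, ⟨y, n, rfl⟩, hx, hs⟩ :=
    (PiNat.isTopologicalBasis_cylinders (fun _ => Bool)).exists_subset_of_mem_open hxV hVo
  rw [← PiNat.mem_cylinder_iff_eq.1 hx] at hs
  refine ⟨n, fun z hz => ?_⟩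
  have : e z ∈ PiNat.cylinder (e x) n := hz
  simpa using hV (hs this)

theorem hasBasis_cyl (x : C) : (𝓝 x).HasBasis (fun _ : ℕ => True) (cyl e x) :=
  ⟨fun _ => ⟨fun h => (exists_cyl_subset h).imp fun _ h => ⟨trivial, h⟩,
    fun ⟨n, _, h⟩ => mem_of_superset (cyl_mem_nhds x n) h⟩⟩

theorem hasClopenBase_of_homeomorph (e : C ≃ₜ (ℕ → Bool)) : HasClopenBase C := fun x _ hU hx =>
  let ⟨n, hn⟩ := exists_cyl_subset (e := e) (hU.mem_nhds hx)
  ⟨_, isClopen_cyl x n, mem_cyl_self x n, hn⟩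

theorem fd_comm (x y : C) : fd e x y = fd e y x := PiNat.firstDiff_comm _ _

theorem apply_fd_ne {x y : C} (h : x ≠ y) : e x (fd e x y) ≠ e y (fd e x y) :=
  PiNat.apply_firstDiff_ne (e.injective.ne h)

theorem apply_eq_of_lt_fd {x y : C} {n : ℕ} (h : n < fd e x y) : e x n = e y n :=
  PiNat.apply_eq_of_lt_firstDiff h

theorem fd_eq {x y : C} {n : ℕ} (h : ∀ k < n, e x k = e y k) (hn : e x n ≠ e y n) :
    fd e x y = n := by
  have hne : x ≠ y := by rintro rfl; exact hn rfl
  rcases lt_trichotomy (fd e x y) n with h' | h' | h'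
  · exact absurd (h _ h') (apply_fd_ne hne)
  · exact h'
  · exact absurd (apply_eq_of_lt_fd h') hn

theorem mem_cyl_iff {x y : C} (h : x ≠ y) {n : ℕ} : y ∈ cyl e x n ↔ n ≤ fd e x y := by
  constructor
  · intro hy
    by_contra! hlt
    exact apply_fd_ne h (hy _ hlt).symm
  · exact fun hn k hk => (apply_eq_of_lt_fd (hk.trans_le hn)).symm

theorem mem_cyl_fd (x y : C) : y ∈ cyl e x (fd e x y) :=
  fun _ hk => (apply_eq_of_lt_fd hk).symm

theorem exists_notMem_cyl {x y : C} (h : x ≠ y) : ∃ n, y ∉ cyl e x n :=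
  ⟨fd e x y + 1, fun hy => by have := (mem_cyl_iff h).1 hy; lia⟩

theorem fd_congr {x x' y y' : C} {n : ℕ} (h : x ≠ x') (hn : fd e x x' < n) (hy : y ∈ cyl e x n)
    (hy' : y' ∈ cyl e x' n) : y ≠ y' ∧ fd e y y' = fd e x x' := by
  have h1 : e y (fd e x x') ≠ e y' (fd e x x') := by
    rw [hy _ hn, hy' _ hn]; exact apply_fd_ne h
  refine ⟨by rintro rfl; exact h1 rfl, fd_eq (fun k hk => ?_) h1⟩
  rw [hy _ (hk.trans hn), hy' _ (hk.trans hn), apply_eq_of_lt_fd hk]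

theorem fd_of_fd_ne {u v x : C} (h : fd e u x ≠ fd e v x) (hu : u ≠ x) (hv : v ≠ x) :
    u ≠ v ∧ fd e u v ≤ fd e u x := by
  have huv : u ≠ v := by rintro rfl; exact h rfl
  refine ⟨huv, ?_⟩
  rcases lt_or_gt_of_ne h with h' | h'
  · refine (fd_eq (fun k hk => ?_) ?_).le
    · rw [apply_eq_of_lt_fd hk, apply_eq_of_lt_fd (hk.trans h')]
    · rw [apply_eq_of_lt_fd h']; exact apply_fd_ne hu
  · refine (fd_eq (n := fd e v x) (fun k hk => ?_) ?_).le.trans h'.le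
    · rw [apply_eq_of_lt_fd hk, apply_eq_of_lt_fd (hk.trans h')]
    · rw [apply_eq_of_lt_fd h']; exact (apply_fd_ne hv).symm

variable (e)

/-- The partial sums of `∑ 1 / (k + 1)` over the even digits `k` of `x` that are `1`, cut off
at `1`. -/
noncomputable def gam (n : ℕ) (x : C) : ℝ :=
  min 1 (∑ k ∈ Finset.range n, if Even k ∧ e x k = true then (1 / (k + 1) : ℝ) else 0)

/-- The limit of the functions `gam`, a lower semicontinuous function. -/
noncomputable def ff (x : C) : ℝ := ⨆ n, gam e n x

/-- The function on the square that equals `ff` on the diagonal, and off the diagonal is the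
partial sum of `ff` over the common digits. -/
noncomputable def gg (p : C × C) : ℝ :=
  open Classical in if p.1 = p.2 then ff e p.1 else gam e (fd e p.1 p.2) p.1

variable {e}

theorem gam_mono (x : C) : Monotone fun n => gam e n x := by
  intro m n h
  refine min_le_min le_rfl (Finset.sum_le_sum_of_subset_of_nonneg ?_ fun k _ _ => ?_)
  · exact Finset.range_mono h
  · split_ifs <;> positivity

theorem gam_nonneg (n : ℕ) (x : C) : 0 ≤ gam e n x :=
  le_min zero_le_one (Finset.sum_nonneg fun k _ => by split_ifs <;> positivity)

theorem gam_le_one (n : ℕ) (x : C) : gam e n x ≤ 1 := min_le_left _ _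

theorem gam_congr {x y : C} {n : ℕ} (h : y ∈ cyl e x n) : gam e n y = gam e n x := by
  unfold gam
  congr 1
  refine Finset.sum_congr rfl fun k hk => ?_
  rw [h k (Finset.mem_range.1 hk)]

theorem bddAbove_gam (x : C) : BddAbove (range fun n => gam e n x) :=
  ⟨1, by rintro _ ⟨n, rfl⟩; exact gam_le_one n x⟩

theorem gam_le_ff (n : ℕ) (x : C) : gam e n x ≤ ff e x := le_ciSup (bddAbove_gam x) n

theorem tendsto_gam (x : C) : Tendsto (fun n => gam e n x) atTop (𝓝 (ff e x)) :=
  tendsto_atTop_ciSup (gam_mono x) (bddAbove_gam x)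

theorem gg_diag (x : C) : gg e (x, x) = ff e x := by simp [gg]

theorem gg_of_ne {x y : C} (h : x ≠ y) : gg e (x, y) = gam e (fd e x y) x := by simp [gg, h]

theorem gg_le_left (x y : C) : gg e (x, y) ≤ ff e x := by
  by_cases h : x = y
  · subst h; rw [gg_diag]
  · rw [gg_of_ne h]; exact gam_le_ff _ _

theorem gg_le_right (x y : C) : gg e (x, y) ≤ ff e y := by
  by_cases h : x = y
  · subst h; rw [gg_diag]
  · rw [gg_of_ne h, ← gam_congr (mem_cyl_fd x y)]; exact gam_le_ff _ _

theorem gam_le_gg {x y y' : C} {n : ℕ} (hy : y ∈ cyl e x n) (hy' : y' ∈ cyl e x n) :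
    gam e n x ≤ gg e (y, y') := by
  rw [← gam_congr hy]
  by_cases h : y = y'
  · subst h; rw [gg_diag]; exact gam_le_ff _ _
  · rw [gg_of_ne h]
    exact gam_mono _ ((mem_cyl_iff h).1 (by rwa [cyl_eq hy]))

theorem gg_congr {x x' y y' : C} {n : ℕ} (h : x ≠ x') (hn : fd e x x' < n) (hy : y ∈ cyl e x n)
    (hy' : y' ∈ cyl e x' n) : gg e (y, y') = gg e (x, x') := by
  obtain ⟨h1, h2⟩ := fd_congr h hn hy hy'
  rw [gg_of_ne h, gg_of_ne h1, h2, gam_congr (cyl_anti x hn.le hy)]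

/-- If `u` and `v` leave the branch of `x` at different levels, they split from each other no later
than `u` splits from `x`. So `gg` at `(u, v)` is a partial sum of `ff` at `x`. This controls the
mixed pairs in `isSmallAt_diag`. -/
theorem gg_le_of_fd_ne {u v x : C} (h : fd e u x ≠ fd e v x) (hu : u ≠ x) (hv : v ≠ x) :
    gg e (u, v) ≤ ff e x := by
  obtain ⟨h1, h2⟩ := fd_of_fd_ne h hu hv
  rw [gg_of_ne h1, ← gam_congr (cyl_anti u h2 (mem_cyl_fd u x))]
  exact gam_le_ff _ _

theorem continuousAt_gg {p : C × C} (hp : p.1 ≠ p.2) : ContinuousAt (gg e) p := by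
  have : gg e =ᶠ[𝓝 p] fun _ => gg e p := by
    have hn : fd e p.1 p.2 < fd e p.1 p.2 + 1 := Nat.lt_succ_self _
    filter_upwards [prod_mem_nhds (cyl_mem_nhds (e := e) p.1 _) (cyl_mem_nhds (e := e) p.2 _)]
      with q hq
    exact gg_congr hp hn hq.1 hq.2
  exact continuousAt_const.congr this.symm

end Tree

/-! ### Refining a topology by convergent sequences -/

section SequenceTopology

open Filter

variable {C : Type*} [TopologicalSpace C]

/-- The topology in which points of `S` have the given neighbourhoods and each point `x ∉ S` is the
limit of the sequence `a x`; the sets `U` are open that contain, with each of their points `x ∉ S`,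
almost all points of `a x`. -/
@[reducible]
def seqTopology (S : Set C) (a : C → ℕ → C) : TopologicalSpace C where
  IsOpen U := ∀ x ∈ U, (x ∈ S → U ∈ 𝓝 x) ∧ ∀ᶠ n in atTop, a x n ∈ U
  isOpen_univ := by simp
  isOpen_inter U V hU hV x hx := ⟨fun hS => inter_mem ((hU x hx.1).1 hS) ((hV x hx.2).1 hS),
    (hU x hx.1).2.and (hV x hx.2).2⟩
  isOpen_sUnion 𝒰 h x hx := by
    obtain ⟨U, hU, hxU⟩ := hx
    exact ⟨fun hS => mem_of_superset ((h U hU x hxU).1 hS) (subset_sUnion_of_mem hU),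
      (h U hU x hxU).2.mono fun n hn => ⟨U, hU, hn⟩⟩

variable {S : Set C} {a : C → ℕ → C}

theorem mem_nhds_of_mem_seqTopology {s : C} (hs : s ∈ S) {U : Set C}
    (hU : U ∈ @nhds C (seqTopology S a) s) : U ∈ 𝓝 s := by
  obtain ⟨V, hVU, hV, hsV⟩ := (@mem_nhds_iff C (seqTopology S a) s U).1 hU
  exact mem_of_superset ((hV s hsV).1 hs) hVU

theorem seqTopology_le (ha : ∀ x, Tendsto (a x) atTop (𝓝 x)) :
    seqTopology S a ≤ ‹TopologicalSpace C› := fun _ hU x hx =>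
  ⟨fun _ => hU.mem_nhds hx, ha x (hU.mem_nhds hx)⟩

theorem isOpen_singleton_seqTopology {x : C} (hx : x ∉ S) (hax : ∀ n, a x n = x) :
    IsOpen[seqTopology S a] {x} := by
  rintro _ rfl
  exact ⟨fun h => absurd h hx, by simp [hax]⟩

theorem isOpen_insert_seqTopology {x : C} (hx : x ∉ S) {P : ℕ → Set C} {m : ℕ}
    (hP : ∀ n ≥ m, IsOpen[seqTopology S a] (P n)) (ha : ∀ n ≥ m, a x n ∈ P n) :
    IsOpen[seqTopology S a] ({x} ∪ ⋃ n ∈ {n | m ≤ n}, P n) := by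
  rintro y (rfl | hy)
  · refine ⟨fun h => absurd h hx, ?_⟩
    filter_upwards [eventually_ge_atTop m] with n hn
    exact .inr (mem_biUnion (show n ∈ {n | m ≤ n} from hn) (ha n hn))
  · obtain ⟨n, hn, hyn⟩ := mem_iUnion₂.1 hy
    have hs : P n ⊆ {x} ∪ ⋃ n ∈ {n | m ≤ n}, P n :=
      (subset_biUnion_of_mem (u := P) hn).trans subset_union_right
    exact ⟨fun h => mem_of_superset ((hP n hn y hyn).1 h) hs,
      (hP n hn y hyn).2.mono fun k hk => hs hk⟩

/-- The sets `P n` shrink towards `x`, so near any other point only finitely many of them matter. -/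
theorem isClosed_insert_of_tendsto {e : C ≃ₜ (ℕ → Bool)} {x : C} {u : ℕ → C}
    (hu : Tendsto u atTop (𝓝 x)) {P : ℕ → Set C} {m : ℕ} (hP : ∀ n ≥ m, IsClosed (P n))
    (hPu : ∀ n ≥ m, P n ⊆ cyl e (u n) n) : IsClosed ({x} ∪ ⋃ n ∈ {n | m ≤ n}, P n) := by
  rw [← isOpen_compl_iff, isOpen_iff_mem_nhds]
  intro y hy
  have hyx : x ≠ y := fun h => hy (.inl h.symm)
  obtain ⟨k, hk⟩ := exists_notMem_cyl (e := e) hyx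
  obtain ⟨N, hN⟩ := eventually_atTop.1 ((hu (cyl_mem_nhds (e := e) x k)))
  have hcl : IsClosed (⋃ n ∈ {n | m ≤ n ∧ n < max N k}, P n) :=
    Set.Finite.isClosed_biUnion ((finite_lt_nat (max N k)).subset fun n hn => hn.2)
      fun n hn => hP n hn.1
  have hy' : y ∈ (⋃ n ∈ {n | m ≤ n ∧ n < max N k}, P n)ᶜ := fun h => by
    obtain ⟨n, hn, hyn⟩ := mem_iUnion₂.1 h
    exact hy (.inr (mem_biUnion hn.1 hyn))
  filter_upwards [hcl.isOpen_compl.mem_nhds hy', (isClopen_cyl x k).compl.isOpen.mem_nhds hk]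
    with z hz hzk
  rintro (rfl | hzP)
  · exact hzk (mem_cyl_self _ _)
  · obtain ⟨n, hn, hzn⟩ := mem_iUnion₂.1 hzP
    rcases lt_or_ge n (max N k) with h | h
    · exact hz (mem_biUnion (show n ∈ {n | m ≤ n ∧ n < max N k} from ⟨hn, h⟩) hzn)
    · refine hzk ?_
      have h1 := hN n ((le_max_left _ _).trans h)
      rw [← cyl_eq h1]
      exact cyl_anti _ ((le_max_right _ _).trans h) (hPu n hn hzn)

/-- The topology `seqTopology S a` has a base of sets closed in the original topology. -/
theorem exists_isClosed_isOpen_subset (e : C ≃ₜ (ℕ → Bool)) {rk : C → Ordinal}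
    (ha : ∀ x, Tendsto (a x) atTop (𝓝 x))
    (hd : ∀ x, (∀ n, a x n = x) ∨ (x ∉ S ∧ ∀ n, rk (a x n) < rk x)) (x : C) {U : Set C}
    (hU : IsOpen[seqTopology S a] U) (hx : x ∈ U) :
    ∃ W, IsOpen[seqTopology S a] W ∧ IsClosed W ∧ x ∈ W ∧ W ⊆ U := by
  induction h : rk x using WellFoundedLT.induction generalizing x U with
  | ind r ih =>
    by_cases hxS : x ∈ S
    · obtain ⟨n, hn⟩ := exists_cyl_subset (e := e) ((hU x hx).1 hxS)
      exact ⟨_, seqTopology_le ha _ (isClopen_cyl x n).isOpen, (isClopen_cyl x n).isClosed,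
        mem_cyl_self x n, hn⟩
    rcases hd x with hc | ⟨-, hr⟩
    · refine ⟨{x}, isOpen_singleton_seqTopology hxS hc, ?_, rfl, by simpa using hx⟩
      have : T1Space C := e.symm.t1Space
      exact isClosed_singleton
    · obtain ⟨m, hm⟩ := eventually_atTop.1 (hU x hx).2
      -- The terms `a x n` have smaller rank, so the induction provides neighbourhoods of them.
      -- Cutting these down to cylinders of length `n` makes their union with `x` closed.
      have h1 : ∀ n, ∃ P, n ≥ m → IsOpen[seqTopology S a] P ∧ IsClosed P ∧ a x n ∈ P ∧
          P ⊆ U ∩ cyl e (a x n) n := by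
        intro n
        by_cases hn : n ≥ m
        · obtain ⟨P, hP⟩ := ih _ (h ▸ hr n) (a x n) (@IsOpen.inter _ (seqTopology S a) _ _ hU
            (seqTopology_le ha _ (isClopen_cyl (e := e) (a x n) n).isOpen))
            ⟨hm n hn, mem_cyl_self _ _⟩ rfl
          exact ⟨P, fun _ => hP⟩
        · exact ⟨∅, fun h => absurd h hn⟩
      choose P hP using h1
      refine ⟨{x} ∪ ⋃ n ∈ {n | m ≤ n}, P n,
        isOpen_insert_seqTopology hxS (fun n hn => (hP n hn).1) fun n hn => (hP n hn).2.2.1,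
        isClosed_insert_of_tendsto (e := e) (ha x) (fun n hn => (hP n hn).2.1)
          fun n hn => (hP n hn).2.2.2.trans inter_subset_right, .inl rfl, ?_⟩
      refine union_subset (by simpa using hx) (iUnion₂_subset fun n hn => ?_)
      exact (hP n hn).2.2.2.trans inter_subset_left

/-- The interiors of the cover in the original topology already cover `S`, and countably many of
them have the same union. What remains is closed and misses `S`, hence is countable. -/
theorem lindelofSpace_of_countable_closed [SecondCountableTopology C]
    (hS : ∀ A : Set C, IsClosed A → Disjoint A S → A.Countable) :
    LindelofSpace (Retop (seqTopology S a)) := by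
  refine isLindelof_univ_iff.1 (isLindelof_of_countable_subcover fun {ι} U hU hc => ?_)
  have hU' : ∀ i, IsOpen[seqTopology S a] (U i : Set C) := hU
  let V : ι → Set C := fun i => @interior C ‹TopologicalSpace C› (U i)
  obtain ⟨t, ht, hteq⟩ := eq_open_union_countable V (fun i => isOpen_interior)
  have hdis : Disjoint (⋃ i, V i)ᶜ S := by
    refine disjoint_left.2 fun x hx hxS => hx ?_
    obtain ⟨i, hi⟩ := mem_iUnion.1 (hc (mem_univ x))
    exact mem_iUnion.2 ⟨i, mem_interior_iff_mem_nhds.2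
      ((hU' i x hi).1 hxS)⟩
  have hcount := hS _ (isOpen_iUnion fun i => isOpen_interior).isClosed_compl hdis
  choose i hi using fun x : C => mem_iUnion.1 (hc (mem_univ x))
  refine ⟨t ∪ i '' (⋃ i, V i)ᶜ, ht.union (hcount.image _), fun x _ => ?_⟩
  by_cases hx : x ∈ ⋃ i, V i
  · have hx' := hx
    rw [← hteq] at hx'
    obtain ⟨j, hj, hxj⟩ := mem_iUnion₂.1 hx'
    exact mem_biUnion (.inl hj) (@interior_subset C ‹TopologicalSpace C› (U j) x hxj)
  · exact mem_biUnion (.inr ⟨x, hx, rfl⟩) (hi x)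

end SequenceTopology

/-! ### A greedy branch on the diagonal -/

section Greedy

open Filter

variable {C : Type*} [TopologicalSpace C] {e : C ≃ₜ (ℕ → Bool)}

theorem gam_le_add {x y : C} {k : ℕ} (h : ∀ j, j ≠ k → e y j = e x j) (n : ℕ) :
    gam e n y ≤ gam e n x + 1 / (k + 1) := by
  have hk : (0 : ℝ) ≤ 1 / (k + 1) := by positivity
  have hs : (∑ j ∈ Finset.range n, if Even j ∧ e y j = true then (1 / (j + 1) : ℝ) else 0) ≤
      (∑ j ∈ Finset.range n, if Even j ∧ e x j = true then (1 / (j + 1) : ℝ) else 0) +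
        1 / (k + 1) := by
    have h1 : (∑ j ∈ Finset.range n, if j = k then (1 / (k + 1) : ℝ) else 0) ≤ 1 / (k + 1) := by
      rw [Finset.sum_ite_eq']
      split_ifs
      exacts [le_rfl, hk]
    refine le_trans ?_ (add_le_add_right h1 _)
    rw [← Finset.sum_add_distrib]
    refine Finset.sum_le_sum fun j _ => ?_
    by_cases hj : j = k
    · subst hj
      have : (0 : ℝ) ≤ if Even j ∧ e x j = true then (1 / (j + 1) : ℝ) else 0 := by
        split_ifs <;> positivity
      rw [if_pos (c := j = j) rfl]
      refine le_trans ?_ (le_add_of_nonneg_left this)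
      split_ifs
      exacts [le_rfl, hk]
    · rw [h j hj]; simp [hj]
  unfold gam
  rcases le_total 1 (∑ j ∈ Finset.range n, if Even j ∧ e x j = true then (1 / (j + 1) : ℝ) else 0)
    with h1 | h1
  · rw [min_eq_left h1]; linarith [min_le_left (1 : ℝ)
      (∑ j ∈ Finset.range n, if Even j ∧ e y j = true then (1 / (j + 1) : ℝ) else 0)]
  · rw [min_eq_right h1]; exact (min_le_right _ _).trans hs

theorem ff_le_gam {x y : C} {n : ℕ} (hy : y ∈ cyl e x n)
    (h0 : ∀ j ≥ n, Even j → e y j = false) : ff e y ≤ gam e n x := by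
  refine ciSup_le fun m => ?_
  rw [← gam_congr hy]
  rcases le_total m n with h | h
  · exact gam_mono y h
  · unfold gam
    rw [← Finset.sum_range_add_sum_Ico _ h]
    refine min_le_min le_rfl (le_of_eq ?_)
    rw [add_eq_left]
    refine Finset.sum_eq_zero fun j hj => ?_
    rw [if_neg]
    rintro ⟨h1, h2⟩
    rw [h0 j (Finset.mem_Ico.1 hj).1 h1] at h2
    exact absurd h2 (by simp)

/-- The harmonic series diverges, also along the even digits: 1/(m+1) ≤ 2/(2m+1). The cap 1 exceeds
2/3, so it does not hide the divergence. -/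
theorem not_bounded_gam {x : C} {N : ℕ} (h : ∀ n ≥ N, e x (2 * n) = true)
    (hb : ∀ n, gam e (2 * n) x < 2 / 3) : False := by
  have h1 : ∀ m, (∑ n ∈ Finset.range m, (1 / (n + 1) : ℝ)) ≤
      2 * ((∑ n ∈ Finset.range N, (1 / (n + 1) : ℝ)) +
      ∑ j ∈ Finset.range (2 * m), if Even j ∧ e x j = true then (1 / (j + 1) : ℝ) else 0) := by
    intro m
    induction m with
    | zero =>
      have : (0 : ℝ) ≤ ∑ n ∈ Finset.range N, (1 / (n + 1) : ℝ) :=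
        Finset.sum_nonneg fun _ _ => by positivity
      simpa using this
    | succ m ih =>
      rw [show 2 * (m + 1) = 2 * m + 1 + 1 by ring, Finset.sum_range_succ,
        Finset.sum_range_succ (n := 2 * m + 1), Finset.sum_range_succ (n := 2 * m)]
      have h2 : ¬ (Even (2 * m + 1) ∧ e x (2 * m + 1) = true) := fun h => by
        have := h.1; grind
      rw [if_neg h2]
      by_cases hm : N ≤ m
      · rw [if_pos ⟨even_two_mul m, h m hm⟩]
        have : (1 / (m + 1) : ℝ) ≤ 2 * (1 / ((2 * m : ℕ) + 1)) := by
          rw [mul_one_div, div_le_div_iff₀ (by positivity) (by positivity)]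
          push_cast; linarith
        linarith
      · have h3 : (∑ n ∈ Finset.range (m + 1), (1 / (n + 1) : ℝ)) ≤
            ∑ n ∈ Finset.range N, (1 / (n + 1) : ℝ) :=
          Finset.sum_le_sum_of_subset_of_nonneg (Finset.range_mono (by lia))
            fun _ _ _ => by positivity
        rw [Finset.sum_range_succ] at h3
        have h4 : (0 : ℝ) ≤ ∑ n ∈ Finset.range N, (1 / (n + 1) : ℝ) :=
          Finset.sum_nonneg fun _ _ => by positivity
        have h5 : (0 : ℝ) ≤ ∑ j ∈ Finset.range (2 * m),
            if Even j ∧ e x j = true then (1 / (j + 1) : ℝ) else 0 :=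
          Finset.sum_nonneg fun _ _ => by split_ifs <;> positivity
        have h6 : (0 : ℝ) ≤ if Even (2 * m) ∧ e x (2 * m) = true
            then (1 / ((2 * m : ℕ) + 1) : ℝ) else 0 := by split_ifs <;> positivity
        linarith
  have h2 : ∀ m, (∑ j ∈ Finset.range (2 * m),
      if Even j ∧ e x j = true then (1 / (j + 1) : ℝ) else 0) < 2 / 3 := fun m => by
    rcases min_lt_iff.1 (hb m) with h | h
    · norm_num at h
    · exact h
  obtain ⟨m, hm⟩ := (Real.tendsto_sum_range_one_div_nat_succ_atTop.eventually_gt_atTop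
    (2 * ((∑ n ∈ Finset.range N, (1 / (n + 1) : ℝ)) + 2 / 3))).exists
  linarith [h1 m, h2 m]

/-- A set of points containing the zeros of `ff` and bounded away from its maximum is not clopen in
the topology generated by `ff`, not even on a slice where the odd digits are prescribed. -/
theorem exists_common_limit (G : Set C) (w : ℕ → Bool) (h0 : ∀ x, ff e x = 0 → x ∈ G)
    (h1 : ∀ x ∈ G, ff e x < 2 / 3) :
    ∃ (x : C) (u v : ℕ → C), (∀ k, e x (2 * k + 1) = w k) ∧
      Tendsto u atTop (𝓝 x) ∧ Tendsto (fun n => ff e (u n)) atTop (𝓝 (ff e x)) ∧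
      Tendsto v atTop (𝓝 x) ∧ Tendsto (fun n => ff e (v n)) atTop (𝓝 (ff e x)) ∧
      (∀ n, u n ∈ G) ∧ ∃ᶠ n in atTop, v n ∉ G := by
  classical
  -- Start with even digits 0 and odd digits `w`; at stage `n`, switch digit `2 * n` on whenever the
  -- result stays in `G`. The stages form `u`, and the attempted switches form `v`. Along `u`, `ff`
  -- equals the partial sums of the limit `x`; each attempt adds at most 1/(2n+1), so both sequences
  -- converge in the graph.
  let b : ℕ → ℕ → Bool := fun n => Nat.rec (fun j => if Even j then false else w (j / 2))
    (fun n c => if e.symm (Function.update c (2 * n) true) ∈ G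
      then Function.update c (2 * n) true else c) n
  have hb0 : b 0 = fun j => if Even j then false else w (j / 2) := rfl
  have hbs : ∀ n, b (n + 1) = if e.symm (Function.update (b n) (2 * n) true) ∈ G
      then Function.update (b n) (2 * n) true else b n := fun n => rfl
  have hne : ∀ n j, j ≠ 2 * n → b (n + 1) j = b n j := by
    intro n j hj
    rw [hbs]; split_ifs
    · rw [Function.update_of_ne hj]
    · rfl
  have hodd : ∀ n k, b n (2 * k + 1) = w k := by
    intro n k
    induction n with
    | zero =>
      have : ¬ Even (2 * k + 1) := by grind
      rw [hb0]; simp only [this, if_false]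
      congr 1; lia
    | succ n ih => rw [hne n _ (by lia), ih]
  have hev : ∀ n k, n ≤ k → b n (2 * k) = false := by
    intro n k hk
    induction n with
    | zero => simp [hb0]
    | succ n ih => rw [hne n _ (by lia), ih (by lia)]
  have hst : ∀ m n j, n ≤ m → j < 2 * n → b m j = b n j := by
    intro m n j hnm hj
    induction m, hnm using Nat.le_induction with
    | base => rfl
    | succ m hm ih => rw [hne m j (by lia), ih]
  let x : C := e.symm fun j => b (j + 1) j
  have hx : ∀ j, e x j = b (j + 1) j := fun j => by simp [x]
  have hxn : ∀ n, ∀ j < 2 * n, b n j = e x j := by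
    intro n j hj
    rw [hx]
    rcases le_total n (j + 1) with h | h
    · exact (hst _ _ _ h hj).symm
    · exact hst _ _ _ h (by lia)
  have hG : ∀ n, e.symm (b n) ∈ G := by
    intro n
    induction n with
    | zero =>
      refine h0 _ (le_antisymm ?_ ((gam_nonneg 0 _).trans (gam_le_ff 0 _)))
      refine (ff_le_gam (n := 0) (mem_cyl_self _ _) fun j _ hj => ?_).trans (by simp [gam])
      simp [hb0, hj]
    | succ n ih => rw [hbs]; split_ifs with h <;> assumption
  let v : ℕ → C := fun n => e.symm (Function.update (b n) (2 * n) true)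
  have hucyl : ∀ n, e.symm (b n) ∈ cyl e x (2 * n) := fun n j hj => by simpa using hxn n j hj
  have hvcyl : ∀ n, v n ∈ cyl e x (2 * n) := fun n j hj => by
    simp only [v, Homeomorph.apply_symm_apply]
    rw [Function.update_of_ne hj.ne]
    exact hxn n j hj
  have hlim : ∀ u : ℕ → C, (∀ n, u n ∈ cyl e x (2 * n)) → Tendsto u atTop (𝓝 x) := by
    intro u hu
    refine (hasBasis_cyl (e := e) x).tendsto_right_iff.2 fun k _ => ?_
    filter_upwards [eventually_ge_atTop k] with n hn
    exact cyl_anti x (by lia) (hu n)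
  have hffu : ∀ n, ff e (e.symm (b n)) = gam e (2 * n) x := by
    intro n
    refine le_antisymm (ff_le_gam (hucyl n) fun j hj hje => ?_) ?_
    · obtain ⟨k, rfl⟩ := hje.two_dvd
      simpa using hev n k (by lia)
    · rw [← gam_congr (hucyl n)]; exact gam_le_ff _ _
  have hgt : Tendsto (fun n => gam e (2 * n) x) atTop (𝓝 (ff e x)) :=
    (tendsto_gam x).comp (tendsto_id.const_mul_atTop' two_pos)
  refine ⟨x, fun n => e.symm (b n), v, fun k => (hx _).trans (hodd (2 * k + 1 + 1) k), hlim _ hucyl, ?_,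
    hlim _ hvcyl,
    ?_, hG, ?_⟩
  · simpa only [hffu] using hgt
  · refine tendsto_of_tendsto_of_tendsto_of_le_of_le (h := fun n => gam e (2 * n) x +
      1 / ((2 * n : ℕ) + 1)) hgt ?_ (fun n => ?_) fun n => ?_
    · have h2 : Tendsto (fun n : ℕ => (1 / ((2 * n : ℕ) + 1) : ℝ)) atTop (𝓝 0) :=
        (tendsto_one_div_add_atTop_nhds_zero_nat (𝕜 := ℝ)).comp
          (tendsto_id.const_mul_atTop' two_pos)
      simpa using hgt.add h2
    · exact (gam_congr (hvcyl n)).symm.le.trans (gam_le_ff _ _)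
    · refine ciSup_le fun m => (gam_le_add (x := e.symm (b n)) (k := 2 * n) (fun j hj => ?_) m).trans
        (add_le_add_left (a := (1 / ((2 * n : ℕ) + 1) : ℝ)) ((gam_le_ff _ _).trans (hffu n).le))
      simp [v, Function.update_of_ne hj]
  -- If attempts succeeded from some stage on, all late even digits of `x` would be 1, yet all
  -- partial sums would stay below 2/3.
  · by_contra hcon
    rw [not_frequently] at hcon
    obtain ⟨N, hN⟩ := eventually_atTop.1 hcon
    refine not_bounded_gam (e := e) (x := x) (N := N) (fun n hn => ?_) fun n => ?_
    · have h3 : e.symm (Function.update (b n) (2 * n) true) ∈ G := not_not.1 (hN n hn)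
      rw [← hxn (n + 1) (2 * n) (by lia), hbs, if_pos h3]; simp
    · rw [← hffu]; exact h1 _ (hG n)

end Greedy

/-! ### The product of the two refinements -/

section ProductSpace

open Filter

variable {C : Type*} [TopologicalSpace C]

/-- The map of the square onto the graph of `gg`. -/
noncomputable def graphMap (e : C ≃ₜ (ℕ → Bool)) (p : C × C) : (C × C) × ℝ := (p, gg e p)

/-- Disjoint sets `S₁`, `S₂` and a family of sequences `z x` in the square, from which two
refinements of the topology of `C` are defined; `rk` makes the family well-founded. -/
structure BernsteinData (e : C ≃ₜ (ℕ → Bool)) (S₁ S₂ : Set C) (z : C → ℕ → C × C)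
    (rk : C → Ordinal) : Prop where
  disj : Disjoint S₁ S₂
  dich : ∀ x, (∀ n, z x n = (x, x)) ∨ (x ∉ S₁ ∧ x ∉ S₂ ∧
    (∀ n, rk (z x n).1 < rk x ∧ rk (z x n).2 < rk x) ∧
    ∀ n m, n ≠ m → fd e (z x n).1 x ≠ fd e (z x m).2 x)
  tend : ∀ x, Tendsto (z x) atTop (𝓝 (x, x))
  tend_gg : ∀ x, Tendsto (fun n => gg e (z x n)) atTop (𝓝 (ff e x))
  countable₁ : ∀ A : Set C, IsClosed A → Disjoint A S₁ → A.Countable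
  countable₂ : ∀ A : Set C, IsClosed A → Disjoint A S₂ → A.Countable
  rect : ∀ A : Set (C × C), IsClosed A → (∀ p ∈ A, p.1 ≠ p.2) → Disjoint A (S₁ ×ˢ S₂) →
    ∃ Y : Set C, Y.Countable ∧ ∀ p ∈ A, p.1 ∈ Y ∨ p.2 ∈ Y
  diag : ∀ D E : Set (C × C), ¬ {x | graphMap e (x, x) ∈ closure (graphMap e '' D) ∩
      closure (graphMap e '' E)}.Countable →
    ∃ x, (∃ᶠ n in atTop, z x n ∈ D) ∧ ∃ᶠ n in atTop, z x n ∈ E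

variable {e : C ≃ₜ (ℕ → Bool)} {S₁ S₂ : Set C} {z : C → ℕ → C × C} {rk : C → Ordinal}

/-- The first refinement. -/
abbrev topFst (S₁ : Set C) (z : C → ℕ → C × C) : TopologicalSpace C :=
  seqTopology S₁ fun x n => (z x n).1

/-- The second refinement. -/
abbrev topSnd (S₂ : Set C) (z : C → ℕ → C × C) : TopologicalSpace C :=
  seqTopology S₂ fun x n => (z x n).2

/-- The product of the two refinements. -/
abbrev ProdSpace (S₁ S₂ : Set C) (z : C → ℕ → C × C) : Type _ :=
  Retop (topFst S₁ z) × Retop (topSnd S₂ z)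

/-- The identity map from a set with a topology to the set. -/
def Retop.toBase {α : Type*} {τ : TopologicalSpace α} : Retop τ → α := fun x => x

theorem continuous_toBase {α : Type*} {τ σ : TopologicalSpace α} (h : σ ≤ τ) :
    @Continuous (Retop σ) α _ τ Retop.toBase := by
  refine @Continuous.mk (Retop σ) α _ τ _ fun U hU => ?_
  exact h U hU

/-- The identity map from the product of the two refinements to the square. -/
def baseMap (p : ProdSpace S₁ S₂ z) : C × C := (p.1.toBase, p.2.toBase)

namespace BernsteinData

theorem tend_fst (h : BernsteinData e S₁ S₂ z rk) (x : C) :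
    Tendsto (fun n => (z x n).1) atTop (𝓝 x) := (continuous_fst.tendsto _).comp (h.tend x)

theorem tend_snd (h : BernsteinData e S₁ S₂ z rk) (x : C) :
    Tendsto (fun n => (z x n).2) atTop (𝓝 x) := (continuous_snd.tendsto _).comp (h.tend x)

theorem dich_fst (h : BernsteinData e S₁ S₂ z rk) (x : C) :
    (∀ n, (z x n).1 = x) ∨ (x ∉ S₁ ∧ ∀ n, rk (z x n).1 < rk x) :=
  (h.dich x).imp (fun h n => by rw [h]) fun h => ⟨h.1, fun n => (h.2.2.1 n).1⟩

theorem dich_snd (h : BernsteinData e S₁ S₂ z rk) (x : C) :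
    (∀ n, (z x n).2 = x) ∨ (x ∉ S₂ ∧ ∀ n, rk (z x n).2 < rk x) :=
  (h.dich x).imp (fun h n => by rw [h]) fun h => ⟨h.2.1, fun n => (h.2.2.1 n).2⟩

theorem topFst_le (h : BernsteinData e S₁ S₂ z rk) : topFst S₁ z ≤ ‹TopologicalSpace C› :=
  seqTopology_le h.tend_fst

theorem topSnd_le (h : BernsteinData e S₁ S₂ z rk) : topSnd S₂ z ≤ ‹TopologicalSpace C› :=
  seqTopology_le h.tend_snd

/-- The point `(x, y)` has rectangular neighbourhoods `U × V` on which `gg` is not much larger than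
at the point, with `U ∩ V` countable. -/
def IsSmallAt (e : C ≃ₜ (ℕ → Bool)) (S₁ S₂ : Set C) (z : C → ℕ → C × C) (p : C × C) : Prop :=
  ∀ t > gg e p, ∃ U V : Set C, IsOpen[topFst S₁ z] U ∧ IsOpen[topSnd S₂ z] V ∧ p.1 ∈ U ∧ p.2 ∈ V ∧
    (∀ u ∈ U, ∀ v ∈ V, gg e (u, v) < t) ∧ (U ∩ V).Countable

theorem isSmallAt_of_ne (h : BernsteinData e S₁ S₂ z rk) {p : C × C} (hp : p.1 ≠ p.2) :
    IsSmallAt e S₁ S₂ z p := by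
  intro t ht
  have hn : fd e p.1 p.2 < fd e p.1 p.2 + 1 := Nat.lt_succ_self _
  refine ⟨cyl e p.1 (fd e p.1 p.2 + 1), cyl e p.2 (fd e p.1 p.2 + 1),
    h.topFst_le _ (isClopen_cyl _ _).isOpen, h.topSnd_le _ (isClopen_cyl _ _).isOpen,
    mem_cyl_self _ _, mem_cyl_self _ _, fun u hu v hv => ?_, ?_⟩
  · rw [gg_congr hp hn hu hv]; exact ht
  · convert countable_empty
    refine eq_empty_of_forall_notMem fun u hu => (fd_congr hp hn hu.1 hu.2).1 rfl

/-- Induction on rank. At a genuine limit point, take `x` together with small rectangles around the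
terms `z x n`. Matching pairs are controlled by induction, or by local constancy off the diagonal;
mixed pairs leave the branch of `x` at different levels, so they are bounded by `ff e x` and
contribute nothing to the intersection. -/
theorem isSmallAt_diag (h : BernsteinData e S₁ S₂ z rk) (x : C) : IsSmallAt e S₁ S₂ z (x, x) := by
  induction hr : rk x using WellFoundedLT.induction generalizing x with
  | ind r ih =>
    intro t ht
    rw [gg_diag] at ht
    have huniv₁ : IsOpen[topFst S₁ z] univ := @isOpen_univ C (topFst S₁ z)
    have huniv₂ : IsOpen[topSnd S₂ z] univ := @isOpen_univ C (topSnd S₂ z)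
    rcases h.dich x with hc | ⟨hx1, hx2, hrk, hfd⟩
    -- As `S₁` and `S₂` are disjoint, a point with a constant sequence is isolated in at least one
    -- factor.
    · by_cases hx : x ∈ S₁
      · refine ⟨univ, {x}, huniv₁, isOpen_singleton_seqTopology (disjoint_left.1 h.disj hx)
          (fun n => by rw [hc]), trivial, rfl, ?_, (countable_singleton x).mono inter_subset_right⟩
        rintro u - v rfl
        exact (gg_le_right _ _).trans_lt ht
      · refine ⟨{x}, univ, isOpen_singleton_seqTopology hx (fun n => by rw [hc]), huniv₂,
          rfl, trivial, ?_, (countable_singleton x).mono inter_subset_left⟩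
        rintro u rfl v -
        exact (gg_le_left _ _).trans_lt ht
    obtain ⟨m, hm⟩ := eventually_atTop.1 ((h.tend_gg x).eventually_lt_const ht)
    have hne1 : ∀ n, (z x n).1 ≠ x := fun n hn => by
      have := (hrk n).1; rw [hn] at this; exact lt_irrefl _ this
    have hne2 : ∀ n, (z x n).2 ≠ x := fun n hn => by
      have := (hrk n).2; rw [hn] at this; exact lt_irrefl _ this
    have h1 : ∀ n, ∃ P Q : Set C, n ≥ m → IsOpen[topFst S₁ z] P ∧ IsOpen[topSnd S₂ z] Q ∧
        (z x n).1 ∈ P ∧ (z x n).2 ∈ Q ∧ (∀ u ∈ P, ∀ v ∈ Q, gg e (u, v) < t) ∧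
        (P ∩ Q).Countable ∧ P ⊆ cyl e (z x n).1 (fd e (z x n).1 x + 1) ∧
        Q ⊆ cyl e (z x n).2 (fd e (z x n).2 x + 1) := by
      intro n
      by_cases hn : n ≥ m
      swap
      · exact ⟨∅, ∅, fun h => absurd h hn⟩
      have hs : IsSmallAt e S₁ S₂ z (z x n) := by
        by_cases heq : (z x n).1 = (z x n).2
        · have := ih _ (hr ▸ (hrk n).1) (z x n).1 rfl
          rwa [show ((z x n).1, (z x n).1) = z x n from Prod.ext rfl heq] at this
        · exact h.isSmallAt_of_ne heq
      obtain ⟨U, V, hU, hV, hxU, hxV, hlt, hct⟩ := hs t (hm n hn)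
      refine ⟨U ∩ cyl e (z x n).1 (fd e (z x n).1 x + 1), V ∩ cyl e (z x n).2 (fd e (z x n).2 x + 1),
        fun _ => ⟨@IsOpen.inter _ (topFst S₁ z) _ _ hU (h.topFst_le _ (isClopen_cyl _ _).isOpen),
          @IsOpen.inter _ (topSnd S₂ z) _ _ hV (h.topSnd_le _ (isClopen_cyl _ _).isOpen),
          ⟨hxU, mem_cyl_self _ _⟩, ⟨hxV, mem_cyl_self _ _⟩, fun u hu v hv => hlt u hu.1 v hv.1,
          hct.mono (inter_subset_inter inter_subset_left inter_subset_left),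
          inter_subset_right, inter_subset_right⟩⟩
    choose P Q hPQ using h1
    have hfdP : ∀ n ≥ m, ∀ u ∈ P n, u ≠ x ∧ fd e u x = fd e (z x n).1 x := fun n hn u hu =>
      fd_congr (hne1 n) (Nat.lt_succ_self _) ((hPQ n hn).2.2.2.2.2.2.1 hu) (mem_cyl_self _ _)
    have hfdQ : ∀ n ≥ m, ∀ u ∈ Q n, u ≠ x ∧ fd e u x = fd e (z x n).2 x := fun n hn u hu =>
      fd_congr (hne2 n) (Nat.lt_succ_self _) ((hPQ n hn).2.2.2.2.2.2.2 hu) (mem_cyl_self _ _)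
    have hcross : ∀ n ≥ m, ∀ k ≥ m, n ≠ k → ∀ u ∈ P n, ∀ v ∈ Q k, fd e u x ≠ fd e v x := by
      intro n hn k hk hnk u hu v hv
      rw [(hfdP n hn u hu).2, (hfdQ k hk v hv).2]
      exact hfd n k hnk
    refine ⟨{x} ∪ ⋃ n ∈ {n | m ≤ n}, P n, {x} ∪ ⋃ n ∈ {n | m ≤ n}, Q n,
      isOpen_insert_seqTopology hx1 (fun n hn => (hPQ n hn).1) fun n hn => (hPQ n hn).2.2.1,
      isOpen_insert_seqTopology hx2 (fun n hn => (hPQ n hn).2.1) fun n hn => (hPQ n hn).2.2.2.1,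
      .inl rfl, .inl rfl, ?_, ?_⟩
    · rintro u (rfl | hu) v hv
      · exact (gg_le_left _ _).trans_lt ht
      rcases hv with rfl | hv
      · exact (gg_le_right _ _).trans_lt ht
      obtain ⟨n, hn, hun⟩ := mem_iUnion₂.1 hu
      obtain ⟨k, hk, hvk⟩ := mem_iUnion₂.1 hv
      by_cases hnk : n = k
      · subst hnk
        exact (hPQ n hn).2.2.2.2.1 u hun v hvk
      · exact (gg_le_of_fd_ne (hcross n hn k hk hnk u hun v hvk) (hfdP n hn u hun).1
          (hfdQ k hk v hvk).1).trans_lt ht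
    · refine ((countable_singleton x).union (Set.Countable.biUnion
        (Set.to_countable {n | m ≤ n}) fun n hn => (hPQ n hn).2.2.2.2.2.1)).mono ?_
      rintro u ⟨rfl | hu, hu'⟩
      · exact .inl rfl
      rcases hu' with rfl | hu'
      · exact .inl rfl
      obtain ⟨n, hn, hun⟩ := mem_iUnion₂.1 hu
      obtain ⟨k, hk, huk⟩ := mem_iUnion₂.1 hu'
      by_cases hnk : n = k
      · subst hnk
        exact .inr (mem_biUnion hn ⟨hun, huk⟩)
      · exact absurd rfl (hcross n hn k hk hnk u hun u huk)

theorem isSmallAt (h : BernsteinData e S₁ S₂ z rk) (p : C × C) : IsSmallAt e S₁ S₂ z p := by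
  obtain ⟨x, y⟩ := p
  by_cases hxy : x = y
  · subst hxy; exact h.isSmallAt_diag x
  · exact h.isSmallAt_of_ne hxy

theorem continuous_baseMap (h : BernsteinData e S₁ S₂ z rk) :
    Continuous (baseMap : ProdSpace S₁ S₂ z → C × C) :=
  ((continuous_toBase h.topFst_le).comp continuous_fst).prodMk
    ((continuous_toBase h.topSnd_le).comp continuous_snd)

theorem isOpen_rect {U V : Set C} (hU : IsOpen[topFst S₁ z] U) (hV : IsOpen[topSnd S₂ z] V) :
    IsOpen (X := ProdSpace S₁ S₂ z) (U ×ˢ V : Set (C × C)) :=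
  IsOpen.prod (X := Retop (topFst S₁ z)) (Y := Retop (topSnd S₂ z)) hU hV

theorem continuous_gg (h : BernsteinData e S₁ S₂ z rk) :
    Continuous fun p : ProdSpace S₁ S₂ z => gg e (baseMap p) := by
  have key : ∀ x y : C, ContinuousAt (fun p : ProdSpace S₁ S₂ z => gg e (baseMap p)) (x, y) := by
    intro x y
    by_cases hxy : x = y
    · subst hxy
      refine tendsto_order.2 ⟨fun s hs => ?_, fun t ht => ?_⟩
      · have hs' : s < gg e (x, x) := hs
        rw [gg_diag] at hs'
        obtain ⟨n, hn⟩ := ((tendsto_gam x).eventually_const_lt hs').exists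
        have hU : IsOpen (X := ProdSpace S₁ S₂ z) (cyl e x n ×ˢ cyl e x n : Set (C × C)) :=
          isOpen_rect (h.topFst_le _ (isClopen_cyl _ _).isOpen)
            (h.topSnd_le _ (isClopen_cyl _ _).isOpen)
        have hx : (x, x) ∈ (cyl e x n ×ˢ cyl e x n : Set (C × C)) :=
          ⟨mem_cyl_self _ _, mem_cyl_self _ _⟩
        filter_upwards [hU.mem_nhds hx] with p hp
        exact hn.trans_le (gam_le_gg hp.1 hp.2)
      · obtain ⟨U, V, hU, hV, hxU, hxV, hlt, -⟩ := h.isSmallAt (x, x) t ht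
        have hx : (x, x) ∈ U ×ˢ V := ⟨hxU, hxV⟩
        filter_upwards [(isOpen_rect hU hV).mem_nhds hx] with p hp
        exact hlt _ hp.1 _ hp.2
    · exact ContinuousAt.comp (f := (baseMap : ProdSpace S₁ S₂ z → C × C)) (g := gg e)
        (x := (x, y)) (continuousAt_gg (p := (x, y)) hxy) h.continuous_baseMap.continuousAt
  exact continuous_iff_continuousAt.2 fun p => key p.1 p.2

/-- `graphMap` on the product of the two refinements. -/
noncomputable def prodGraphMap (e : C ≃ₜ (ℕ → Bool)) (S₁ S₂ : Set C) (z : C → ℕ → C × C) :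
    ProdSpace S₁ S₂ z → (C × C) × ℝ := fun p => graphMap e (baseMap p)

theorem continuous_prodGraphMap (h : BernsteinData e S₁ S₂ z rk) :
    Continuous (prodGraphMap e S₁ S₂ z) := h.continuous_baseMap.prodMk h.continuous_gg

theorem hasClopenBase_fst (h : BernsteinData e S₁ S₂ z rk) :
    HasClopenBase (Retop (topFst S₁ z)) := fun x U hU hx => by
  obtain ⟨W, h1, h2, h3, h4⟩ := exists_isClosed_isOpen_subset e h.tend_fst h.dich_fst x hU hx
  exact ⟨W, ⟨h2.mono h.topFst_le, h1⟩, h3, h4⟩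

theorem hasClopenBase_snd (h : BernsteinData e S₁ S₂ z rk) :
    HasClopenBase (Retop (topSnd S₂ z)) := fun x U hU hx => by
  obtain ⟨W, h1, h2, h3, h4⟩ := exists_isClosed_isOpen_subset e h.tend_snd h.dich_snd x hU hx
  exact ⟨W, ⟨h2.mono h.topSnd_le, h1⟩, h3, h4⟩

theorem hasClopenBase_prod (h : BernsteinData e S₁ S₂ z rk) :
    HasClopenBase (ProdSpace S₁ S₂ z) := h.hasClopenBase_fst.prod h.hasClopenBase_snd

theorem secondCountable (e : C ≃ₜ (ℕ → Bool)) : SecondCountableTopology C :=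
  e.secondCountableTopology

theorem lindelofSpace_fst (h : BernsteinData e S₁ S₂ z rk) : LindelofSpace (Retop (topFst S₁ z)) :=
  have := secondCountable e
  lindelofSpace_of_countable_closed h.countable₁

theorem lindelofSpace_snd (h : BernsteinData e S₁ S₂ z rk) : LindelofSpace (Retop (topSnd S₂ z)) :=
  have := secondCountable e
  lindelofSpace_of_countable_closed h.countable₂

theorem isLindelof_lines (h : BernsteinData e S₁ S₂ z rk) {Y : Set C} (hY : Y.Countable) :
    IsLindelof (X := ProdSpace S₁ S₂ z) {p | p.1 ∈ Y ∨ p.2 ∈ Y} := by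
  have := h.lindelofSpace_fst
  have := h.lindelofSpace_snd
  have h1 : ({p | p.1 ∈ Y ∨ p.2 ∈ Y} : Set (ProdSpace S₁ S₂ z)) =
      ⋃ y ∈ Y, (range (fun q : Retop (topSnd S₂ z) => ((y, q) : ProdSpace S₁ S₂ z)) ∪
        range (fun q : Retop (topFst S₁ z) => ((q, y) : ProdSpace S₁ S₂ z))) := by
    ext p
    constructor
    · rintro (hu | hv)
      · exact mem_biUnion hu (.inl ⟨p.2, rfl⟩)
      · exact mem_biUnion hv (.inr ⟨p.1, rfl⟩)
    · intro hp
      obtain ⟨y, hy, ⟨q, rfl⟩ | ⟨q, rfl⟩⟩ := mem_iUnion₂.1 hp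
      exacts [.inl hy, .inr hy]
  rw [h1]
  exact hY.isLindelof_biUnion fun y _ =>
    (isLindelof_range (by fun_prop)).union (isLindelof_range (by fun_prop))

/-- The set of pairs that differ in the first `n` digits. -/
theorem isClopen_differ (e : C ≃ₜ (ℕ → Bool)) (n : ℕ) :
    IsClopen {p : C × C | p.2 ∉ cyl e p.1 n} := by
  have : {p : C × C | p.2 ∉ cyl e p.1 n} = ⋃ k ∈ {k | k < n},
      (fun p : C × C => (e p.2 k, e p.1 k)) ⁻¹' {q | q.1 ≠ q.2} := by
    ext p; simp [cyl]
  rw [this]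
  refine (finite_lt_nat n).isClopen_biUnion fun k _ => (isClopen_discrete _).preimage ?_
  have := continuous_apply (A := fun _ : ℕ => Bool) k
  have := e.continuous
  fun_prop

/-- A closed set missing `S₁ × S₂` off the diagonal lies, up to the diagonal, on countably many
lines. -/
theorem exists_countable_lines (h : BernsteinData e S₁ S₂ z rk) {A : Set (C × C)}
    (hA : ∀ p, p.1 ≠ p.2 → p ∉ A → Aᶜ ∈ 𝓝 p)
    (hS : Disjoint A (S₁ ×ˢ S₂)) (hd : {x | (x, x) ∈ A}.Countable) :
    ∃ Y : Set C, Y.Countable ∧ ∀ p ∈ A, p.1 ∈ Y ∨ p.2 ∈ Y := by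
  -- The set is cut into slabs of pairs differing in the first `n` digits. Each slab is clopen and
  -- off the diagonal, so `h.rect` applies to it.
  have hn : ∀ n, ∃ Y : Set C, Y.Countable ∧ ∀ p ∈ A ∩ {p | p.2 ∉ cyl e p.1 n}, p.1 ∈ Y ∨ p.2 ∈ Y := by
    intro n
    have hR := isClopen_differ e n
    have hne : ∀ p ∈ {p : C × C | p.2 ∉ cyl e p.1 n}, p.1 ≠ p.2 := fun p hp heq =>
      hp (heq ▸ mem_cyl_self _ _)
    refine h.rect _ ?_ (fun p hp => hne p hp.2) (hS.mono_left inter_subset_left)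
    rw [← isOpen_compl_iff, isOpen_iff_mem_nhds]
    intro p hp
    by_cases hpR : p ∈ {p : C × C | p.2 ∉ cyl e p.1 n}
    · refine mem_of_superset (hA p (hne p hpR) fun hpA => hp ⟨hpA, hpR⟩) ?_
      exact compl_subset_compl.2 inter_subset_left
    · exact mem_of_superset (hR.compl.isOpen.mem_nhds hpR) (compl_subset_compl.2 inter_subset_right)
  choose Y hY hYA using hn
  refine ⟨{x | (x, x) ∈ A} ∪ ⋃ n, Y n, hd.union (countable_iUnion hY), ?_⟩
  rintro ⟨x, y⟩ hp
  by_cases hxy : x = y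
  · subst hxy; exact .inl (.inl hp)
  · obtain ⟨n, hn⟩ := exists_notMem_cyl (e := e) hxy
    rcases hYA n _ ⟨hp, hn⟩ with h1 | h1
    · exact .inl (.inr (mem_iUnion.2 ⟨n, h1⟩))
    · exact .inr (.inr (mem_iUnion.2 ⟨n, h1⟩))

theorem tendsto_prodSpace (x : C) :
    Tendsto (z x) atTop (@nhds (ProdSpace S₁ S₂ z) _ (x, x)) := by
  have h1 : Tendsto (fun n => (z x n).1) atTop (@nhds C (topFst S₁ z) x) := by
    intro U hU
    obtain ⟨V, hVU, hV, hxV⟩ := (@mem_nhds_iff C (topFst S₁ z) x U).1 hU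
    exact ((hV x hxV).2).mono fun n hn => hVU hn
  have h2 : Tendsto (fun n => (z x n).2) atTop (@nhds C (topSnd S₂ z) x) := by
    intro U hU
    obtain ⟨V, hVU, hV, hxV⟩ := (@mem_nhds_iff C (topSnd S₂ z) x U).1 hU
    exact ((hV x hxV).2).mono fun n hn => hVU hn
  exact Tendsto.prodMk_nhds (X := Retop (topFst S₁ z)) (Y := Retop (topSnd S₂ z)) h1 h2

theorem mem_of_frequently {H : Set (ProdSpace S₁ S₂ z)}
    (hH : IsClosed H) {x : C} (hx : ∃ᶠ n in atTop, z x n ∈ H) :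
    ((x, x) : ProdSpace S₁ S₂ z) ∈ H := by
  let z' : ℕ → ProdSpace S₁ S₂ z := z x
  have hz' : Tendsto z' atTop (𝓝 (x, x)) := tendsto_prodSpace x
  have hmem : ((x, x) : ProdSpace S₁ S₂ z) ∈ closure H :=
    mem_closure_of_frequently_of_tendsto (f := z') hx hz'
  rwa [hH.closure_eq] at hmem

/-- An uncountable overlap was anticipated by the choice of `z`: some sequence `z x` meets both sets
infinitely often and tends to `(x, x)` in the product, so this point would lie in both closed sets.
-/
theorem countable_diag_overlap (h : BernsteinData e S₁ S₂ z rk) {H K : Set (ProdSpace S₁ S₂ z)}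
    (hH : IsClosed H) (hK : IsClosed K) (hd : Disjoint H K) :
    {x : C | prodGraphMap e S₁ S₂ z (x, x) ∈ closure (prodGraphMap e S₁ S₂ z '' H) ∩
      closure (prodGraphMap e S₁ S₂ z '' K)}.Countable := by
  by_contra hcon
  obtain ⟨x, hx1, hx2⟩ := h.diag H K hcon
  exact disjoint_left.1 hd (mem_of_frequently hH hx1) (mem_of_frequently hK hx2)

/-- At points of `S₁ ×ˢ S₂` the neighbourhoods in the product are the usual ones, so adherence in
the graph already implies adherence in the product. -/
theorem mem_of_mem_closure_image {H : Set (ProdSpace S₁ S₂ z)}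
    (hH : IsClosed H) {x y : C} (hx : x ∈ S₁) (hy : y ∈ S₂)
    (hxy : graphMap e (x, y) ∈ closure (prodGraphMap e S₁ S₂ z '' H)) :
    ((x, y) : ProdSpace S₁ S₂ z) ∈ H := by
  rw [← hH.closure_eq, mem_closure_iff_nhds]
  intro N hN
  obtain ⟨U, hU, V, hV, hUV⟩ := mem_nhds_prod_iff.1 hN
  have hU' : U ∈ @nhds C _ x := mem_nhds_of_mem_seqTopology hx hU
  have hV' : V ∈ @nhds C _ y := mem_nhds_of_mem_seqTopology hy hV
  obtain ⟨_, ⟨hq1, -⟩, q, hq, rfl⟩ := mem_closure_iff_nhds.1 hxy _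
    (prod_mem_nhds (prod_mem_nhds hU' hV') univ_mem)
  exact ⟨q, hUV hq1, hq⟩

theorem lindelofOverlap (h : BernsteinData e S₁ S₂ z rk) :
    LindelofOverlap (prodGraphMap e S₁ S₂ z) := by
  intro H K hH hK hd
  let A : Set (C × C) := graphMap e ⁻¹' (closure (prodGraphMap e S₁ S₂ z '' H) ∩
      closure (prodGraphMap e S₁ S₂ z '' K))
  suffices hA : (∀ p, p.1 ≠ p.2 → p ∉ A → Aᶜ ∈ 𝓝 p) ∧ Disjoint A (S₁ ×ˢ S₂) by
    obtain ⟨Y, hY, hYA⟩ := h.exists_countable_lines hA.1 hA.2 (h.countable_diag_overlap hH hK hd)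
    exact ⟨_, h.isLindelof_lines hY, fun p hp => hYA _ hp⟩
  refine ⟨fun p hp hpA => ?_, ?_⟩
  · have hc : ContinuousAt (graphMap e) p := continuousAt_id.prodMk (continuousAt_gg hp)
    exact hc.preimage_mem_nhds ((isClosed_closure.inter isClosed_closure).isOpen_compl.mem_nhds hpA)
  · refine disjoint_left.2 ?_
    rintro ⟨x, y⟩ hp ⟨hx, hy⟩
    exact disjoint_left.1 hd (mem_of_mem_closure_image hH hx hy hp.1)
      (mem_of_mem_closure_image hK hx hy hp.2)

/-- Take a clopen rectangle with countable trace on the diagonal. The usual interiors of a cover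
catch its points in `S₁ ×ˢ S₂`, and countably many have the same union; the remaining closed set
lies on countably many lines. -/
theorem exists_lindelof_nhds (h : BernsteinData e S₁ S₂ z rk) (p : ProdSpace S₁ S₂ z) :
    ∃ W, IsClopen W ∧ IsLindelof W ∧ p ∈ W := by
  have := secondCountable e
  obtain ⟨x, y⟩ := p
  obtain ⟨U₀, V₀, hU₀, hV₀, hx₀, hy₀, -, hc₀⟩ := h.isSmallAt (x, y) (gg e (x, y) + 1) (by simp)
  obtain ⟨U, hU, hUc, hxU, hUU⟩ := exists_isClosed_isOpen_subset e h.tend_fst h.dich_fst x hU₀ hx₀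
  obtain ⟨V, hV, hVc, hyV, hVV⟩ := exists_isClosed_isOpen_subset e h.tend_snd h.dich_snd y hV₀ hy₀
  let W : Set (C × C) := U ×ˢ V
  have hWc : IsClosed W := hUc.prod hVc
  have hWcl : IsClosed (X := ProdSpace S₁ S₂ z) W := hWc.preimage h.continuous_baseMap
  refine ⟨W, ⟨hWcl, isOpen_rect hU hV⟩, ?_, ⟨hxU, hyV⟩⟩
  refine isLindelof_of_countable_subcover fun {ι} O hO hcov => ?_
  let O' : ι → Set (C × C) := fun i => @interior (C × C) _ (O i)
  obtain ⟨t, ht, hteq⟩ := eq_open_union_countable O' (fun i => isOpen_interior)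
  obtain ⟨Y, hY, hYA⟩ := h.exists_countable_lines (A := W \ ⋃ i, O' i) (fun p _ hp =>
    (hWc.sdiff (isOpen_iUnion fun i => isOpen_interior)).isOpen_compl.mem_nhds hp) (by
      refine disjoint_left.2 ?_
      rintro ⟨u, v⟩ ⟨huv, hn⟩ ⟨hu, hv⟩
      obtain ⟨i, hi⟩ := mem_iUnion.1 (hcov huv)
      obtain ⟨P, hP, Q, hQ, hPQ⟩ := mem_nhds_prod_iff.1 ((hO i).mem_nhds hi)
      have hP' : P ∈ @nhds C _ u := mem_nhds_of_mem_seqTopology hu hP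
      have hQ' : Q ∈ @nhds C _ v := mem_nhds_of_mem_seqTopology hv hQ
      exact hn (mem_iUnion.2 ⟨i, mem_interior_iff_mem_nhds.2
        (mem_of_superset (prod_mem_nhds hP' hQ') hPQ)⟩))
    (hc₀.mono fun u (hu : (u, u) ∈ W \ ⋃ i, O' i) =>
      (⟨hUU hu.1.1, hVV hu.1.2⟩ : u ∈ U₀ ∩ V₀))
  have hcl : IsClosed (X := ProdSpace S₁ S₂ z) (W \ ⋃ i, O' i) :=
    (hWc.sdiff (isOpen_iUnion fun i => isOpen_interior)).preimage h.continuous_baseMap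
  obtain ⟨r, hr, hrc⟩ := ((h.isLindelof_lines hY).of_isClosed_subset hcl
    (fun p hp => hYA p hp)).elim_countable_subcover O hO (sdiff_subset.trans hcov)
  refine ⟨t ∪ r, ht.union hr, fun p hp => ?_⟩
  by_cases hp' : p ∈ ⋃ i, O' i
  · rw [← hteq] at hp'
    obtain ⟨i, hi, hpi⟩ := mem_iUnion₂.1 hp'
    exact mem_biUnion (.inl hi) (@interior_subset (C × C) _ (O i) p hpi)
  · obtain ⟨i, hi, hpi⟩ := mem_iUnion₂.1 (hrc ⟨hp, hp'⟩)
    exact mem_biUnion (.inr hi) hpi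

theorem t2Space_fst (h : BernsteinData e S₁ S₂ z rk) : T2Space (Retop (topFst S₁ z)) :=
  have : T2Space C := e.symm.t2Space
  T2Space.of_injective_continuous (f := (Retop.toBase : Retop (topFst S₁ z) → C))
    (fun _ _ h => h) (continuous_toBase h.topFst_le)

theorem t2Space_snd (h : BernsteinData e S₁ S₂ z rk) : T2Space (Retop (topSnd S₂ z)) :=
  have : T2Space C := e.symm.t2Space
  T2Space.of_injective_continuous (f := (Retop.toBase : Retop (topSnd S₂ z) → C))
    (fun _ _ h => h) (continuous_toBase h.topSnd_le)

theorem normalSpace_prod (h : BernsteinData e S₁ S₂ z rk) : NormalSpace (ProdSpace S₁ S₂ z) := by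
  have := secondCountable e
  have : T2Space C := e.symm.t2Space
  have : CompactSpace C := e.symm.compactSpace
  exact h.lindelofOverlap.normalSpace h.hasClopenBase_prod h.continuous_prodGraphMap

theorem t4Space_prod (h : BernsteinData e S₁ S₂ z rk) : T4Space (ProdSpace S₁ S₂ z) := by
  have := h.t2Space_fst
  have := h.t2Space_snd
  have := h.normalSpace_prod
  exact {}

theorem coverDimLE_one (h : BernsteinData e S₁ S₂ z rk) :
    CoverDimLE (fun U : Set (ProdSpace S₁ S₂ z) => IsOpen U) 1 := by
  have := secondCountable e
  have := h.normalSpace_prod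
  have hb := hasClopenBase_of_homeomorph e
  exact h.lindelofOverlap.coverDimLE_one (hb.prod hb) h.hasClopenBase_prod
    h.continuous_prodGraphMap h.exists_lindelof_nhds

/-- A clopen `W` separating low from high values of `gg` has only countable diagonal overlap with
its complement, whereas `exists_common_limit` produces an overlap point for every choice of odd
digits. -/
theorem not_coverDimLE_zero (h : BernsteinData e S₁ S₂ z rk) {P : Set (ProdSpace S₁ S₂ z) → Prop}
    (hP : ∀ U, P U → IsOpen U) (hP' : ∀ U, IsCozeroSet U → P U) : ¬ CoverDimLE P 0 := by
  intro hdim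
  let g : ProdSpace S₁ S₂ z → ℝ := fun p => gg e (baseMap p)
  have hg : Continuous g := h.continuous_gg
  have hcoz1 : IsCozeroSet {p | g p < 2 / 3} := by
    refine ⟨fun p => min (g p - 2 / 3) 0, by fun_prop, ?_⟩
    ext p
    simp only [mem_ofPred_eq, ne_eq, min_eq_right_iff, not_le, sub_neg]
  have hcoz2 : IsCozeroSet {p | 1 / 3 < g p} := by
    refine ⟨fun p => max (g p - 1 / 3) 0, by fun_prop, ?_⟩
    ext p
    simp only [mem_ofPred_eq, ne_eq, max_eq_right_iff, not_le, sub_pos]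
  obtain ⟨W, hW, hW1, hW2⟩ := hdim.exists_clopen hP (hP' _ hcoz1) (hP' _ hcoz2) (by
    refine eq_univ_of_forall fun p => ?_
    rcases lt_or_ge (g p) (2 / 3) with h | h
    · exact .inl h
    · exact .inr (show 1 / 3 < g p by linarith))
  have hX := h.countable_diag_overlap hW.isClosed hW.compl.isClosed disjoint_compl_right
  set X := {x : C | prodGraphMap e S₁ S₂ z (x, x) ∈ closure (prodGraphMap e S₁ S₂ z '' W) ∩
      closure (prodGraphMap e S₁ S₂ z '' Wᶜ)} with hXdef
  -- There are uncountably many patterns of odd digits, so one of them is realised by no point of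
  -- the countable set `X`.
  obtain ⟨w, hw⟩ : ∃ w : ℕ → Bool, w ∉ (fun x k => e x (2 * k + 1)) '' X := by
    by_contra! hcon
    have h1 : (univ : Set (ℕ → Bool)).Countable := (hX.image _).mono fun w _ => hcon w
    have h2 : #(ℕ → Bool) ≤ ℵ₀ := Cardinal.mk_le_aleph0_iff.2 (countable_univ_iff.1 h1)
    rw [Cardinal.mk_pi] at h2
    simp only [Cardinal.mk_bool, Cardinal.prod_const, Cardinal.mk_nat, Cardinal.lift_id] at h2
    exact absurd (Cardinal.cantor ℵ₀) (not_lt.2 (by simpa using h2))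
  obtain ⟨x, u, v, hxw, hu, hfu, hv, hfv, huG, hvG⟩ := exists_common_limit (e := e)
    {x : C | ((x, x) : ProdSpace S₁ S₂ z) ∈ W} w (fun x hx => by
      by_contra hn
      have h1 : 1 / 3 < gg e (x, x) := hW2 hn
      rw [gg_diag, hx] at h1
      norm_num at h1) (fun x hx => by
      have h1 : gg e (x, x) < 2 / 3 := hW1 hx
      rwa [gg_diag] at h1)
  have hlim : ∀ u : ℕ → C, Tendsto u atTop (𝓝 x) → Tendsto (fun n => ff e (u n)) atTop (𝓝 (ff e x)) →
      Tendsto (fun n => prodGraphMap e S₁ S₂ z (u n, u n)) atTop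
        (𝓝 (prodGraphMap e S₁ S₂ z (x, x))) := by
    intro u hu hfu
    refine (hu.prodMk_nhds hu).prodMk_nhds ?_
    change Tendsto (fun n => gg e (u n, u n)) atTop (𝓝 (gg e (x, x)))
    simpa only [gg_diag] using hfu
  refine hw ⟨x, ⟨?_, ?_⟩, funext hxw⟩
  · exact mem_closure_of_tendsto (hlim u hu hfu) (.of_forall fun n => mem_image_of_mem _ (huG n))
  · exact mem_closure_of_frequently_of_tendsto (hvG.mono fun n hn => mem_image_of_mem _ hn)
      (hlim v hv hfv)

theorem cechDim_prod (h : BernsteinData e S₁ S₂ z rk) : cechDim (ProdSpace S₁ S₂ z) = 1 :=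
  coverDim_eq_one h.coverDimLE_one
    (h.not_coverDimLE_zero (fun _ h => h) fun _ h => h.isOpen)

theorem katetovDim_prod (h : BernsteinData e S₁ S₂ z rk) : katetovDim (ProdSpace S₁ S₂ z) = 1 :=
  have := h.normalSpace_prod
  coverDim_eq_one (coverDimLE_cozero_of_open h.coverDimLE_one)
    (h.not_coverDimLE_zero (fun _ h => h.isOpen) fun _ h => h)

end BernsteinData

end ProductSpace

/-! ### Free topological groups -/

section FreeTopologicalGroups

open Filter

namespace FreeAbelianTopGroup

variable {X : Type*} [TopologicalSpace X]

/-- The generators of the free Abelian topological group. -/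
def gen (x : X) : FreeAbelianTopGroup X := FreeAbelianGroup.of x

/-- The underlying element of the free Abelian group. -/
def toFree (v : FreeAbelianTopGroup X) : FreeAbelianGroup X := v

theorem continuous_gen : Continuous (gen : X → FreeAbelianTopGroup X) :=
  AddGroupTopology.coinduced_continuous (FreeAbelianGroup.of : X → FreeAbelianGroup X)

theorem continuous_hom {G : Type*} [AddGroup G] [TopologicalSpace G] [IsTopologicalAddGroup G]
    (φ : FreeAbelianGroup X →+ G) (h : Continuous fun x => φ (.of x)) :
    Continuous (fun v : FreeAbelianTopGroup X => φ v.toFree) := by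
  let t : AddGroupTopology (FreeAbelianGroup X) :=
    { toTopologicalSpace := TopologicalSpace.induced φ inferInstance
      toIsTopologicalAddGroup := topologicalAddGroup_induced φ }
  have ht : AddGroupTopology.coinduced (FreeAbelianGroup.of : X → FreeAbelianGroup X) ≤ t :=
    sInf_le (continuous_iff_coinduced_le.1 (continuous_induced_rng.2 h))
  exact continuous_iff_le_induced.2 ht

end FreeAbelianTopGroup

namespace FreeTopGroup

variable {X : Type*} [TopologicalSpace X]

/-- The generators of the free topological group. -/
def gen (x : X) : FreeTopGroup X := FreeGroup.of x

/-- The underlying element of the free group. -/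
def toFree (v : FreeTopGroup X) : FreeGroup X := v

theorem continuous_gen : Continuous (gen : X → FreeTopGroup X) :=
  GroupTopology.coinduced_continuous (FreeGroup.of : X → FreeGroup X)

theorem continuous_hom {G : Type*} [Group G] [TopologicalSpace G] [IsTopologicalGroup G]
    (φ : FreeGroup X →* G) (h : Continuous fun x => φ (.of x)) :
    Continuous (fun v : FreeTopGroup X => φ v.toFree) := by
  let t : GroupTopology (FreeGroup X) :=
    { toTopologicalSpace := TopologicalSpace.induced φ inferInstance
      toIsTopologicalGroup := topologicalGroup_induced φ }
  have ht : GroupTopology.coinduced (FreeGroup.of : X → FreeGroup X) ≤ t :=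
    sInf_le (continuous_iff_coinduced_le.1 (continuous_induced_rng.2 h))
  exact continuous_iff_le_induced.2 ht

end FreeTopGroup

/-! ### Retracting a free Abelian group onto its generators -/

section Parity

variable {X : Type*}

/-- The parity of the number of letters of a word that lie in `U`. -/
noncomputable def parity (U : Set X) : FreeAbelianGroup X →+ ZMod 2 :=
  open Classical in FreeAbelianGroup.lift fun x => if x ∈ U then 1 else 0

theorem parity_of (U : Set X) (x : X) [Decidable (x ∈ U)] :
    parity U (.of x) = if x ∈ U then 1 else 0 := by
  unfold parity
  rw [FreeAbelianGroup.lift_apply_of]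
  congr

theorem parity_map {Q : Type*} (π : X → Q) (B : Set Q) (w : FreeAbelianGroup X) :
    parity B (FreeAbelianGroup.map π w) = parity (π ⁻¹' B) w := by
  have : (parity B).comp (FreeAbelianGroup.map π) = parity (π ⁻¹' B) := by
    classical
    ext x
    simp [parity_of]
  exact DFunLike.congr_fun this w

theorem parity_union {U V : Set X} (h : Disjoint U V) (w : FreeAbelianGroup X) :
    parity (U ∪ V) w = parity U w + parity V w := by
  have : parity (U ∪ V) = parity U + parity V := by
    classical
    ext x
    by_cases hU : x ∈ U
    · have hV : x ∉ V := disjoint_left.1 h hU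
      simp [parity_of, hU, hV]
    · simp [parity_of, hU]
  rw [this]; rfl

theorem exists_finite_support (w : FreeAbelianGroup X) :
    ∃ F : Set X, F.Finite ∧ ∀ U : Set X, Disjoint F U → parity U w = 0 := by
  classical
  induction w using FreeAbelianGroup.induction_on with
  | zero => exact ⟨∅, finite_empty, fun U _ => map_zero _⟩
  | of x => exact ⟨{x}, finite_singleton x, fun U hU => by
      rw [parity_of, if_neg (disjoint_singleton_left.1 hU)]⟩
  | neg x ih =>
    obtain ⟨F, hF, h⟩ := ih
    exact ⟨F, hF, fun U hU => by rw [map_neg, h U hU, neg_zero]⟩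
  | add x y ihx ihy =>
    obtain ⟨F, hF, h⟩ := ihx
    obtain ⟨F', hF', h'⟩ := ihy
    refine ⟨F ∪ F', hF.union hF', fun U hU => ?_⟩
    rw [disjoint_union_left] at hU
    rw [map_add, h U hU.1, h' U hU.2, add_zero]

variable {C : Type*} [TopologicalSpace C] (e : C ≃ₜ (ℕ → Bool)) (j : X ≃ C)

/-- Cylinders in a set in bijection with `C`. -/
def pcyl (x : X) (n : ℕ) : Set X := j ⁻¹' cyl e (j x) n

variable {e j}

theorem mem_pcyl_self (x : X) (n : ℕ) : x ∈ pcyl e j x n := mem_cyl_self _ _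

theorem pcyl_eq {x y : X} {n : ℕ} (h : y ∈ pcyl e j x n) : pcyl e j y n = pcyl e j x n :=
  congr_arg (preimage j) (cyl_eq h)

theorem pcyl_anti (x : X) {m n : ℕ} (h : m ≤ n) : pcyl e j x n ⊆ pcyl e j x m :=
  preimage_mono (cyl_anti _ h)

theorem pcyl_split {x y : X} {n : ℕ} (h : y ∈ pcyl e j x n) (hn : y ∉ pcyl e j x (n + 1)) :
    Disjoint (pcyl e j x (n + 1)) (pcyl e j y (n + 1)) ∧
      pcyl e j x (n + 1) ∪ pcyl e j y (n + 1) = pcyl e j x n := by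
  have hb : e (j y) n ≠ e (j x) n := fun h' => hn fun k hk => by
    rcases Nat.lt_succ_iff_lt_or_eq.1 hk with h1 | rfl
    exacts [h k h1, h']
  constructor
  · refine disjoint_left.2 fun z hz hz' => hn ?_
    rw [← pcyl_eq hz, pcyl_eq hz']; exact mem_pcyl_self y _
  · refine subset_antisymm (union_subset (pcyl_anti _ n.le_succ) ?_) fun z hz => ?_
    · rw [← pcyl_eq h]; exact pcyl_anti _ n.le_succ
    · by_cases hzn : e (j z) n = e (j x) n
      · refine .inl fun k hk => ?_
        rcases Nat.lt_succ_iff_lt_or_eq.1 hk with h1 | rfl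
        exacts [hz k h1, hzn]
      · refine .inr fun k hk => ?_
        rcases Nat.lt_succ_iff_lt_or_eq.1 hk with h1 | rfl
        · exact (hz k h1).trans (h k h1).symm
        · exact (Bool.eq_not_of_ne hzn).trans (Bool.eq_not_of_ne hb).symm

/-- The parities of the two halves of a cylinder add up to 1 modulo 2, so one of the halves is odd.
-/
theorem exists_odd_child {w : FreeAbelianGroup X} {x : X} {n : ℕ}
    (h : parity (pcyl e j x n) w = 1) :
    ∃ y ∈ pcyl e j x n, parity (pcyl e j y (n + 1)) w = 1 := by
  classical
  by_cases hx : parity (pcyl e j x (n + 1)) w = 1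
  · exact ⟨x, mem_pcyl_self _ _, hx⟩
  let y : X := j.symm (e.symm (Function.update (e (j x)) n (!(e (j x) n))))
  have hy : y ∈ pcyl e j x n := fun k hk => by simp [y, Function.update_of_ne hk.ne]
  have hy' : y ∉ pcyl e j x (n + 1) := fun h' => by
    have := h' n n.lt_succ_self
    simp [y] at this
  obtain ⟨h1, h2⟩ := pcyl_split hy hy'
  refine ⟨y, hy, ?_⟩
  rw [← h2, parity_union h1] at h
  generalize parity (pcyl e j x (n + 1)) w = a at *
  generalize parity (pcyl e j y (n + 1)) w = b at *
  revert a b; decide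

theorem exists_odd_branch {w : FreeAbelianGroup X} (h : parity univ w = 1) [Nonempty X] :
    ∃ x, ∀ n, parity (pcyl e j x n) w = 1 := by
  choose! f hf hfp using fun (n : ℕ) (x : X) (h : parity (pcyl e j x n) w = 1) =>
    exists_odd_child h
  let y : ℕ → X := fun n => Nat.rec (Classical.arbitrary X) (fun n x => f n x) n
  have hy : ∀ n, parity (pcyl e j (y n) n) w = 1 := by
    intro n
    induction n with
    | zero =>
      convert h
      exact eq_univ_of_forall fun z k hk => absurd hk (Nat.not_lt_zero k)
    | succ n ih => exact hfp n _ ih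
  have hys : ∀ n, y (n + 1) ∈ pcyl e j (y n) n := fun n => hf n _ (hy n)
  have hst : ∀ k m, k + 1 ≤ m → e (j (y m)) k = e (j (y (k + 1))) k := by
    intro k m hm
    induction m, hm using Nat.le_induction with
    | base => rfl
    | succ m hm ih => rw [← ih]; exact hys m k hm
  refine ⟨j.symm (e.symm fun k => e (j (y (k + 1))) k), fun n => ?_⟩
  rw [pcyl_eq (x := y n)]
  · exact hy n
  · intro k hk
    simpa using (hst k n hk).symm

/-- Two odd halves would have an even union, so odd cylinders never branch. -/
theorem odd_branch_unique {w : FreeAbelianGroup X} {x y : X} {n : ℕ}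
    (hx : ∀ k ≤ n, parity (pcyl e j x k) w = 1) (hy : ∀ k ≤ n, parity (pcyl e j y k) w = 1) :
    y ∈ pcyl e j x n := by
  induction n with
  | zero => exact fun k hk => absurd hk (Nat.not_lt_zero k)
  | succ n ih =>
    have h1 := ih (fun k hk => hx k (hk.trans n.le_succ)) fun k hk => hy k (hk.trans n.le_succ)
    by_contra h2
    obtain ⟨h3, h4⟩ := pcyl_split h1 h2
    have h5 := hx n n.le_succ
    rw [← h4, parity_union h3, hx _ le_rfl, hy _ le_rfl] at h5
    exact absurd h5 (by decide)

variable (e j)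

/-- The retraction of the free Abelian group onto its generators: the branch of the tree along
which all cylinders contain an odd number of letters. -/
noncomputable def oddBranch [Nonempty X] (w : FreeAbelianGroup X) : X :=
  open Classical in
  if h : parity univ w = 1 then (exists_odd_branch (e := e) (j := j) h).choose
  else Classical.arbitrary X

variable {e j}

theorem parity_oddBranch [Nonempty X] {w : FreeAbelianGroup X} (h : parity univ w = 1) (n : ℕ) :
    parity (pcyl e j (oddBranch e j w) n) w = 1 := by
  unfold oddBranch
  rw [dif_pos h]
  exact (exists_odd_branch (e := e) (j := j) h).choose_spec n

theorem oddBranch_of [Nonempty X] (x : X) : oddBranch e j (.of x) = x := by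
  classical
  by_contra hne
  have h1 : parity univ (.of x) = 1 := by simp [parity_of]
  obtain ⟨n, hn⟩ := exists_notMem_cyl (e := e) (j.injective.ne hne)
  have h2 := parity_oddBranch (e := e) (j := j) h1 n
  rw [parity_of, if_neg (show x ∉ pcyl e j _ n from hn)] at h2
  exact absurd h2 (by decide)

variable [TopologicalSpace X]

/-- The free Abelian group on `Q` with the discrete topology is a topological group, so the
homomorphism induced by a locally constant map is continuous and has open fibres. -/
theorem setOf_map_eq_mem_nhds {Q : Type*} {π : X → Q} (hπ : IsLocallyConstant π)
    (w : FreeAbelianTopGroup X) :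
    {v : FreeAbelianTopGroup X | FreeAbelianGroup.map π v.toFree =
      FreeAbelianGroup.map π w.toFree} ∈ 𝓝 w := by
  let _ : TopologicalSpace (FreeAbelianGroup Q) := ⊥
  have : DiscreteTopology (FreeAbelianGroup Q) := ⟨rfl⟩
  have hc := FreeAbelianTopGroup.continuous_hom (FreeAbelianGroup.map π) (by
    simp only [FreeAbelianGroup.map_of_apply]
    exact (hπ.comp FreeAbelianGroup.of).continuous)
  exact hc.continuousAt.preimage_mem_nhds (t := {FreeAbelianGroup.map π w.toFree})
    (mem_nhds_discrete.2 rfl)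

/-- The retraction is continuous if the space has a base of sets that are closed in the topology
of the Cantor set. -/
theorem continuous_oddBranch [Nonempty X] (hj : Continuous j)
    (hb : ∀ (x : X) (U : Set X), IsOpen U → x ∈ U →
      ∃ A : Set C, IsClosed A ∧ IsOpen (j ⁻¹' A) ∧ x ∈ j ⁻¹' A ∧ j ⁻¹' A ⊆ U) :
    Continuous (fun w : FreeAbelianTopGroup X => oddBranch e j w.toFree) := by
  classical
  refine continuous_iff_continuousAt.2 fun w => ?_
  by_cases hw : parity univ w.toFree = 1
  swap
  -- The parity of the coefficient sum is locally constant, so near `w` the retraction takes only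
  -- its default value.
  · have h1 := setOf_map_eq_mem_nhds (IsLocallyConstant.const (X := X) ()) w
    refine (continuousAt_const (y := Classical.arbitrary X)).congr ?_
    filter_upwards [h1] with v hv
    have h2 : parity univ v.toFree = parity univ w.toFree := by
      have := congr_arg (parity univ) hv
      rwa [parity_map, parity_map, preimage_univ] at this
    unfold oddBranch
    rw [dif_neg (by rwa [h2])]
  set x := oddBranch e j w.toFree with hx
  intro N hN
  obtain ⟨U, hUN, hU, hxU⟩ := mem_nhds_iff.1 hN
  obtain ⟨A₀, hA₀, hA₀o, hxA₀, hA₀U⟩ := hb x U hU hxU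
  obtain ⟨F, hF, hFw⟩ := exists_finite_support w.toFree
  obtain ⟨k, hk⟩ : ∃ k, Disjoint (F \ {x}) (pcyl e j x k) := by
    have : T1Space C := e.symm.t1Space
    have hcl : IsClosed (j '' (F \ {x})) := ((hF.sdiff).image j).isClosed
    obtain ⟨k, hk⟩ := exists_cyl_subset (e := e) (x := j x) (hcl.isOpen_compl.mem_nhds (by
      rintro ⟨y, hy, hyx⟩
      exact hy.2 (j.injective hyx)))
    exact ⟨k, disjoint_left.2 fun y hy hyk => hk hyk ⟨y, hy, rfl⟩⟩
  have hpo : ∀ (y : X) n, IsOpen (pcyl e j y n) := fun y n => (isClopen_cyl _ _).isOpen.preimage hj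
  -- `V` is open in `X` and closed in the Cantor topology. Thus every point outside `V` has a
  -- cylinder missing `V`, which is where the base of closed sets enters.
  set V : Set X := j ⁻¹' A₀ ∩ pcyl e j x k with hV
  have hVo : IsOpen V := hA₀o.inter (hpo x k)
  have hxV : x ∈ V := ⟨hxA₀, mem_pcyl_self _ _⟩
  have hex : ∀ y, y ∉ V → ∃ n, Disjoint (pcyl e j y n) V := by
    intro y hy
    obtain ⟨n, hn⟩ := exists_cyl_subset (e := e) (x := j y)
      ((hA₀.inter (isClopen_cyl (j x) k).isClosed).isOpen_compl.mem_nhds hy)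
    exact ⟨n, disjoint_left.2 fun z hz hzV => hn hz hzV⟩
  let ν : X → ℕ := fun y => if h : y ∉ V then Nat.find (hex y h) else 0
  have hν : ∀ y, y ∉ V → Disjoint (pcyl e j y (ν y)) V := fun y hy => by
    simp only [ν, dif_pos hy]; exact Nat.find_spec (hex y hy)
  have hνmin : ∀ y, y ∉ V → ∀ n < ν y, ¬ Disjoint (pcyl e j y n) V := fun y hy n hn => by
    simp only [ν, dif_pos hy] at hn; exact Nat.find_min (hex y hy) hn
  have hνeq : ∀ y, y ∉ V → ∀ z ∈ pcyl e j y (ν y), z ∉ V ∧ ν z = ν y := by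
    intro y hy z hz
    have hzV : z ∉ V := disjoint_left.1 (hν y hy) hz
    refine ⟨hzV, le_antisymm ?_ ?_⟩
    · by_contra! hlt
      exact hνmin z hzV _ hlt (by rw [pcyl_eq hz]; exact hν y hy)
    · by_contra! hlt
      exact hνmin y hy _ hlt (by rw [← pcyl_eq (pcyl_anti _ hlt.le hz)]; exact hν z hzV)
  -- The second component partitions `X` into `V` and the largest cylinders missing `V`; the first
  -- records the cylinder of length `k`. Words with the same image as `w` have the parities of `w`
  -- on all these pieces.
  let π : X → Set X × Set X := fun y => (pcyl e j y k, if y ∈ V then V else pcyl e j y (ν y))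
  have hπ : IsLocallyConstant π := by
    refine (IsLocallyConstant.iff_exists_open _).2 fun y => ?_
    by_cases hy : y ∈ V
    · refine ⟨V, hVo, hy, fun z hz => ?_⟩
      simp only [π, if_pos hz, if_pos hy]
      rw [pcyl_eq hz.2, pcyl_eq hy.2]
    · refine ⟨pcyl e j y k ∩ pcyl e j y (ν y), (hpo _ _).inter (hpo _ _),
        ⟨mem_pcyl_self _ _, mem_pcyl_self _ _⟩, fun z hz => ?_⟩
      obtain ⟨h1, h2⟩ := hνeq y hy z hz.2
      simp only [π, if_neg h1, if_neg hy]
      rw [h2, pcyl_eq hz.1, pcyl_eq hz.2]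
  rw [Filter.mem_map]
  filter_upwards [setOf_map_eq_mem_nhds hπ w] with v hv
  have hpar : ∀ B : Set (Set X × Set X), parity (π ⁻¹' B) v.toFree =
      parity (π ⁻¹' B) w.toFree := by
    intro B
    have := congr_arg (parity B) hv
    rwa [parity_map, parity_map] at this
  have hv1 : parity univ v.toFree = 1 := by
    have := hpar univ
    rw [preimage_univ] at this
    rw [this, hw]
  have hxodd : ∀ i ≤ k, parity (pcyl e j x i) v.toFree = 1 := by
    intro i hi
    have h1 : pcyl e j x i = π ⁻¹' {q | q.1 ⊆ pcyl e j x i} := by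
      ext y
      constructor
      · intro hy
        change pcyl e j y k ⊆ pcyl e j x i
        rw [← pcyl_eq hy]; exact pcyl_anti _ hi
      · exact fun hy => hy (mem_pcyl_self y k)
    rw [h1, hpar, ← h1]
    exact parity_oddBranch hw i
  apply hUN
  apply hA₀U
  set y := oddBranch e j v.toFree with hy
  have hyodd : ∀ n, parity (pcyl e j y n) v.toFree = 1 := parity_oddBranch hv1
  have hyx : y ∈ pcyl e j x k := odd_branch_unique hxodd fun i _ => hyodd i
  by_contra hyA
  have hyV : y ∉ V := fun h => hyA h.1
  have h2 : pcyl e j y (ν y) = π ⁻¹' {q | q.2 = pcyl e j y (ν y)} := by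
    ext z
    constructor
    · intro hz
      obtain ⟨h1, h2⟩ := hνeq y hyV z hz
      change (if z ∈ V then V else pcyl e j z (ν z)) = pcyl e j y (ν y)
      rw [if_neg h1, h2, pcyl_eq hz]
    · intro hz
      change (if z ∈ V then V else pcyl e j z (ν z)) = pcyl e j y (ν y) at hz
      split_ifs at hz with hzV
      · exact absurd hxV (disjoint_left.1 (hν y hyV) (hz ▸ hxV))
      · rw [← hz]; exact mem_pcyl_self _ _
  -- A shorter cylinder about `y` would contain `x` and so meet `V`. Hence the cell of `y` lies in
  -- the cylinder of `x` of length `k` and misses every letter of `w`, including `x`; its parity is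
  -- 0, not 1.
  have h3 : k ≤ ν y := by
    by_contra! hlt
    refine disjoint_left.1 (hν y hyV) ?_ hxV
    rw [pcyl_eq (pcyl_anti _ hlt.le hyx)]
    exact mem_pcyl_self _ _
  have h4 := hyodd (ν y)
  rw [h2, hpar, ← h2, hFw] at h4
  · exact absurd h4 (by decide)
  · refine disjoint_left.2 fun z hz hzy => ?_
    by_cases hzx : z = x
    · subst hzx
      exact disjoint_left.1 (hν y hyV) hzy hxV
    · refine disjoint_left.1 hk ⟨hz, hzx⟩ ?_
      rw [← pcyl_eq hyx]
      exact pcyl_anti _ h3 hzy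

end Parity

/-! ### Products as retracts of free groups of sums -/

section Retract

variable {X Y : Type*} [TopologicalSpace X] [TopologicalSpace Y]

/-- If `X` and `Y` are retracts of their free Abelian topological groups, then `X × Y` is a retract
of that of `X ⊕ Y`. -/
theorem exists_retraction_freeAbelian {r₁ : FreeAbelianTopGroup X → X}
    {r₂ : FreeAbelianTopGroup Y → Y} (h₁ : Continuous r₁) (h₂ : Continuous r₂)
    (hr₁ : ∀ x, r₁ (.gen x) = x) (hr₂ : ∀ y, r₂ (.gen y) = y) :
    ∃ r : FreeAbelianTopGroup (X ⊕ Y) → X × Y, Continuous r ∧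
      ∀ p : X × Y, r (.gen (Sum.inl p.1) + .gen (Sum.inr p.2)) = p := by
  let φ₁ : FreeAbelianGroup (X ⊕ Y) →+ FreeAbelianTopGroup X :=
    FreeAbelianGroup.lift (Sum.elim .gen fun _ => 0)
  let φ₂ : FreeAbelianGroup (X ⊕ Y) →+ FreeAbelianTopGroup Y :=
    FreeAbelianGroup.lift (Sum.elim (fun _ => 0) .gen)
  have hφ₁ := FreeAbelianTopGroup.continuous_hom φ₁ (by
    simp only [φ₁, FreeAbelianGroup.lift_apply_of]
    exact FreeAbelianTopGroup.continuous_gen.sumElim continuous_const)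
  have hφ₂ := FreeAbelianTopGroup.continuous_hom φ₂ (by
    simp only [φ₂, FreeAbelianGroup.lift_apply_of]
    exact continuous_const.sumElim FreeAbelianTopGroup.continuous_gen)
  refine ⟨fun v => (r₁ (φ₁ v.toFree), r₂ (φ₂ v.toFree)), (h₁.comp hφ₁).prodMk (h₂.comp hφ₂), ?_⟩
  rintro ⟨x, y⟩
  refine Prod.ext ?_ ?_
  · change r₁ (φ₁ (.of (Sum.inl x) + .of (Sum.inr y))) = x
    rw [map_add, FreeAbelianGroup.lift_apply_of, FreeAbelianGroup.lift_apply_of, Sum.elim_inl,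
      Sum.elim_inr, add_zero, hr₁]
  · change r₂ (φ₂ (.of (Sum.inl x) + .of (Sum.inr y))) = y
    rw [map_add, FreeAbelianGroup.lift_apply_of, FreeAbelianGroup.lift_apply_of, Sum.elim_inl,
      Sum.elim_inr, zero_add, hr₂]

theorem exists_section_freeAbelian {r₁ : FreeAbelianTopGroup X → X}
    {r₂ : FreeAbelianTopGroup Y → Y} (h₁ : Continuous r₁) (h₂ : Continuous r₂)
    (hr₁ : ∀ x, r₁ (.gen x) = x) (hr₂ : ∀ y, r₂ (.gen y) = y) :
    ∃ (s : X × Y → FreeAbelianTopGroup (X ⊕ Y)) (r : FreeAbelianTopGroup (X ⊕ Y) → X × Y),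
      Continuous s ∧ Continuous r ∧ ∀ p, r (s p) = p := by
  obtain ⟨r, hr, hrs⟩ := exists_retraction_freeAbelian h₁ h₂ hr₁ hr₂
  have h1 : Continuous fun p : X × Y =>
      (.gen (Sum.inl p.1) : FreeAbelianTopGroup (X ⊕ Y)) :=
    FreeAbelianTopGroup.continuous_gen.comp (continuous_inl.comp continuous_fst)
  have h2 : Continuous fun p : X × Y =>
      (.gen (Sum.inr p.2) : FreeAbelianTopGroup (X ⊕ Y)) :=
    FreeAbelianTopGroup.continuous_gen.comp (continuous_inr.comp continuous_snd)
  exact ⟨_, r, h1.add h2, hr, hrs⟩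

/-- Abelianization is continuous and carries the product of two generators to their sum, so the
retraction in the Abelian case can be composed with it. -/
theorem exists_section_free {r₁ : FreeAbelianTopGroup X → X}
    {r₂ : FreeAbelianTopGroup Y → Y} (h₁ : Continuous r₁) (h₂ : Continuous r₂)
    (hr₁ : ∀ x, r₁ (.gen x) = x) (hr₂ : ∀ y, r₂ (.gen y) = y) :
    ∃ (s : X × Y → FreeTopGroup (X ⊕ Y)) (r : FreeTopGroup (X ⊕ Y) → X × Y),
      Continuous s ∧ Continuous r ∧ ∀ p, r (s p) = p := by
  obtain ⟨r, hr, hrs⟩ := exists_retraction_freeAbelian h₁ h₂ hr₁ hr₂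
  let φ : FreeGroup (X ⊕ Y) →* Multiplicative (FreeAbelianTopGroup (X ⊕ Y)) :=
    FreeGroup.lift fun x => Multiplicative.ofAdd (.gen x)
  have hφ := FreeTopGroup.continuous_hom φ (by
    simp only [φ, FreeGroup.lift_apply_of]
    exact continuous_ofAdd.comp FreeAbelianTopGroup.continuous_gen)
  have h1 : Continuous fun p : X × Y => (.gen (Sum.inl p.1) : FreeTopGroup (X ⊕ Y)) :=
    FreeTopGroup.continuous_gen.comp (continuous_inl.comp continuous_fst)
  have h2 : Continuous fun p : X × Y => (.gen (Sum.inr p.2) : FreeTopGroup (X ⊕ Y)) :=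
    FreeTopGroup.continuous_gen.comp (continuous_inr.comp continuous_snd)
  refine ⟨_, fun v => r (φ v.toFree).toAdd, h1.mul h2, hr.comp (continuous_toAdd.comp hφ), fun p => ?_⟩
  change r (φ (.of (Sum.inl p.1) * .of (Sum.inr p.2))).toAdd = p
  rw [map_mul, FreeGroup.lift_apply_of, FreeGroup.lift_apply_of]
  exact hrs p

end Retract

end FreeTopologicalGroups

/-! ### Transfinite selection of Bernstein-type sets -/

section Selection

variable {C : Type}

/-- No set of fewer than `2^ω` points meets the coordinates of all members of `A`. -/
def IsBig {n : ℕ} (A : Set (Fin n → C)) : Prop :=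
  ∀ Y : Set C, #Y < 𝔠 → ∃ x ∈ A, ∀ i, x i ∉ Y

theorem NUncountable.exists_notMem {n : ℕ} {A : Set (Fin n → C)} (h : NUncountable A) {Y : Set C}
    (hY : Y.Countable) : ∃ x ∈ A, ∀ i, x i ∉ Y := by
  by_contra! hcon
  have hle : nCard A ≤ #Y := csInf_le' (show #Y ∈ {κ : Cardinal | ∃ Y : Set C, #Y = κ ∧
    ∀ x ∈ A, ∃ i, x i ∈ Y} from ⟨Y, rfl, hcon⟩)
  exact absurd (hle.trans (Cardinal.mk_le_aleph0_iff.2 hY)) (not_le.2 h)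

theorem NUncountable.pos {n : ℕ} {A : Set (Fin n → C)} (h : NUncountable A) : 1 ≤ n := by
  by_contra! hn
  obtain rfl : n = 0 := by lia
  obtain ⟨x, hx, -⟩ := h.exists_notMem countable_empty
  have : {κ : Cardinal | ∃ Y : Set C, #Y = κ ∧ ∀ x ∈ A, ∃ i, x i ∈ Y} = ∅ := by
    refine eq_empty_of_forall_notMem ?_
    rintro κ ⟨Y, -, hY⟩
    exact (hY x hx).choose.elim0
  unfold NUncountable nCard at h
  rw [this, Cardinal.sInf_empty] at h
  exact absurd h (not_lt.2 zero_le)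

theorem IsBig.le_nCard {n : ℕ} (hn : 1 ≤ n) {A : Set (Fin n → C)} (h : IsBig A) : 𝔠 ≤ nCard A := by
  refine le_csInf ⟨_, univ, rfl, fun x _ => ⟨⟨0, hn⟩, trivial⟩⟩ ?_
  rintro _ ⟨Y, rfl, hY⟩
  by_contra! hlt
  obtain ⟨x, hx, hxY⟩ := h Y hlt
  obtain ⟨i, hi⟩ := hY x hx
  exact hxY i hi

theorem IsBig.nCard_eq (hC : #C = 𝔠) {n : ℕ} (hn : 1 ≤ n) {A : Set (Fin n → C)} (h : IsBig A) :
    nCard A = 𝔠 := by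
  refine le_antisymm ?_ (h.le_nCard hn)
  rw [← hC, ← Cardinal.mk_univ]
  exact csInf_le' ⟨univ, rfl, fun x _ => ⟨⟨0, hn⟩, trivial⟩⟩

/-- A set meeting the coordinates of every `f a` must contain distinct points for distinct `a`. -/
theorem isBig_of_disjoint_family {n : ℕ} {A : Set (Fin n → C)} {ι : Type} (hι : 𝔠 ≤ #ι)
    (f : ι → Fin n → C) (hf : ∀ a, f a ∈ A) (hd : ∀ a b, a ≠ b → ∀ i k, f a i ≠ f b k) :
    IsBig A := by
  intro Y hY
  by_contra! hcon
  choose i hi using fun a => hcon (f a) (hf a)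
  have hinj : Function.Injective fun a => (⟨f a (i a), hi a⟩ : Y) := by
    intro a b hab
    by_contra hne
    exact hd a b hne _ _ (congr_arg Subtype.val hab)
  exact absurd (hι.trans (Cardinal.mk_le_of_injective hinj)) (not_le.2 hY)

/-- Transfinite selection of points with disjoint sets of coordinates. -/
theorem exists_disjoint_selection {ι : Type} (hι : #ι ≤ 𝔠) {P : ι → Type} (crd : ∀ α, P α → Set C)
    (hcrd : ∀ α p, (crd α p).Countable) (Q : ι → Set C) (hQ : ∀ α, (Q α).Countable)
    (h : ∀ α, ∀ Y : Set C, #Y < 𝔠 → ∃ p, Disjoint (crd α p) Y) :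
    ∃ (_ : LinearOrder ι) (_ : WellFoundedLT ι) (p : ∀ α, P α),
      (∀ α β, α ≠ β → Disjoint (crd α (p α)) (crd β (p β))) ∧
      ∀ α β, β ≤ α → Disjoint (crd α (p α)) (Q β) := by
  -- A well-order of least possible type, so that every proper initial segment has fewer than `𝔠`
  -- elements.
  obtain ⟨lo, wf, hr⟩ := Cardinal.exists_ord_eq_type_lt ι
  have hseg : ∀ α : ι, #(Iio α) < 𝔠 := fun α => by
    have := Cardinal.card_typein_lt (r := (· < ·)) α hr
    rw [Ordinal.card_typein] at this
    exact lt_of_lt_of_le this hι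
  have hseg' : ∀ α : ι, #(Iic α) < 𝔠 := fun α => by
    rw [← Iio_insert]
    refine (Cardinal.mk_insert_le).trans_lt (Cardinal.add_lt_of_lt Cardinal.aleph0_le_continuum
      (hseg α) ?_)
    exact Cardinal.nat_lt_continuum 1 |>.trans_eq' (by simp)
  have hun : ∀ (J : Set ι) (F : J → Set C), #J < 𝔠 → (∀ a, (F a).Countable) → #(⋃ a, F a) < 𝔠 := by
    intro J F hJ hF
    refine (Cardinal.mk_iUnion_le_sum_mk.trans ((Cardinal.sum_le_sum _ _ fun a =>
      Cardinal.mk_le_aleph0_iff.2 (hF a)).trans_eq (Cardinal.sum_const' _ _))).trans_lt ?_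
    exact Cardinal.mul_lt_of_lt Cardinal.aleph0_le_continuum hJ Cardinal.aleph0_lt_continuum
  have hY : ∀ (α : ι) (p : ∀ β, β < α → P β),
      ∃ q : P α, Disjoint (crd α q) ((⋃ β : Iio α, crd β (p β β.2)) ∪ ⋃ β : Iic α, Q β) := by
    intro α p
    refine h α _ ((Cardinal.mk_union_le _ _).trans_lt ?_)
    exact Cardinal.add_lt_of_lt Cardinal.aleph0_le_continuum
      (hun _ _ (hseg α) fun β => hcrd _ _) (hun _ _ (hseg' α) fun β => hQ _)
  choose q hq using hY
  let p : ∀ α, P α := wf.wf.fix (C := P) fun α p => q α p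
  have hp : ∀ α, p α = q α fun β _ => p β := fun α => wf.wf.fix_eq (C := P) _ α
  have key : ∀ α, Disjoint (crd α (p α)) ((⋃ β : Iio α, crd β (p β)) ∪ ⋃ β : Iic α, Q β) := by
    intro α
    rw [hp α]
    exact hq α fun β _ => p β
  have hlt : ∀ α β, β < α → Disjoint (crd α (p α)) (crd β (p β)) := fun α β hβ =>
    (key α).mono_right ((subset_iUnion (fun β : Iio α => crd β (p β)) ⟨β, hβ⟩).trans
      subset_union_left)
  refine ⟨lo, wf, p, fun α β hne => ?_, fun α β hβ => ?_⟩
  · rcases lt_or_gt_of_ne hne with h' | h'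
    · exact (hlt _ _ h').symm
    · exact hlt _ _ h'
  · exact (key α).mono_right ((subset_iUnion (fun β : Iic α => Q β) ⟨β, hβ⟩).trans
      subset_union_right)

/-- Simultaneous selection of three disjoint sets of Bernstein type and of points of prescribed
sets that avoid the countable sets attached to earlier points. -/
theorem exists_bernstein_sets (hC : #C = 𝔠) (𝓕 : ∀ n, Set (Set (Fin n → C)))
    (h𝓕 : ∀ n, #(𝓕 n) ≤ 𝔠) {κ : Type} (hκ : #κ ≤ 𝔠) (B : κ → Set C)
    (hB : ∀ α, ∀ Y : Set C, #Y < 𝔠 → ∃ x ∈ B α, x ∉ Y) (Q : κ → Set C)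
    (hQ : ∀ α, (Q α).Countable) :
    ∃ (S : Fin 3 → Set C) (x : κ → C) (ρ : C → Ordinal.{0}),
      Pairwise (Function.onFun Disjoint S) ∧ Function.Injective x ∧
      (∀ n, ∀ A ∈ 𝓕 n, IsBig A → ∀ l : Fin n → Fin 3,
        (∀ p ∈ A, ∀ i k, p i = p k → l i = l k) → IsBig (A ∩ {p | ∀ i, p i ∈ S (l i)})) ∧
      (∀ α, x α ∈ B α ∧ x α ∈ S 0) ∧ ∀ α, ∀ y ∈ Q α, ρ y < ρ (x α) := by
  classical
  -- A task is a big set together with a labelling of the coordinates. Equal coordinates must carry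
  -- equal labels, or the labelled sets could not be disjoint.
  let T : Type := Σ n, {q : Set (Fin n → C) × (Fin n → Fin 3) // q.1 ∈ 𝓕 n ∧ IsBig q.1 ∧
    ∀ p ∈ q.1, ∀ i k, p i = p k → q.2 i = q.2 k}
  have hT : #T ≤ 𝔠 := by
    rw [Cardinal.mk_sigma]
    refine (Cardinal.sum_le_sum _ (fun _ => 𝔠) fun n => ?_).trans ?_
    · let g : {q : Set (Fin n → C) × (Fin n → Fin 3) // q.1 ∈ 𝓕 n ∧ IsBig q.1 ∧
          ∀ p ∈ q.1, ∀ i k, p i = p k → q.2 i = q.2 k} → 𝓕 n × (Fin n → Fin 3) :=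
        fun q => (⟨q.1.1, q.2.1⟩, q.1.2)
      have hg : Function.Injective g := by
        rintro ⟨⟨a, b⟩, h1⟩ ⟨⟨c, d⟩, h2⟩ h
        simp only [g, Prod.mk.injEq, Subtype.mk.injEq] at h
        simp [h.1, h.2]
      refine (Cardinal.mk_le_of_injective hg).trans ?_
      rw [Cardinal.mk_prod, Cardinal.lift_id, Cardinal.lift_id]
      refine (mul_le_mul' (h𝓕 n) ((Cardinal.mk_le_aleph0).trans
        Cardinal.aleph0_le_continuum)).trans ?_
      rw [Cardinal.continuum_mul_self]
    · rw [Cardinal.sum_const', Cardinal.mk_nat, Cardinal.aleph0_mul_continuum]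
  -- Each task is repeated once for every point of `C`, so that it yields `𝔠` points with disjoint
  -- coordinates and the trace is again big.
  let ι : Type := (T × C) ⊕ κ
  have hι : #ι ≤ 𝔠 := by
    rw [Cardinal.mk_sum, Cardinal.lift_id, Cardinal.lift_id, Cardinal.mk_prod, Cardinal.lift_id,
      Cardinal.lift_id, hC]
    refine (add_le_add (mul_le_mul' hT le_rfl) hκ).trans ?_
    rw [Cardinal.continuum_mul_self, Cardinal.continuum_add_self]
  let P : ι → Type := Sum.elim (fun t => {p : Fin t.1.1 → C // p ∈ t.1.2.1.1}) fun α => B α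
  let crd : ∀ α, P α → Set C := fun α => match α with
    | .inl t => fun p : {p : Fin t.1.1 → C // p ∈ t.1.2.1.1} => range p.1
    | .inr α => fun x : B α => {x.1}
  let Q' : ι → Set C := Sum.elim (fun _ => ∅) Q
  obtain ⟨_, _, p, hp1, hp2⟩ := exists_disjoint_selection hι crd
    (by
      rintro (t | α) p
      · exact countable_range _
      · exact countable_singleton _) Q'
    (by
      rintro (t | α)
      · exact countable_empty
      · exact hQ α)
    (by
      rintro (t | α) Y hY
      · obtain ⟨q, hq, hqY⟩ := t.1.2.2.2.1 Y hY
        refine ⟨(⟨q, hq⟩ : {p : Fin t.1.1 → C // p ∈ t.1.2.1.1}), disjoint_left.2 ?_⟩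
        rintro _ ⟨i, rfl⟩
        exact hqY i
      · obtain ⟨x, hx, hxY⟩ := hB α Y hY
        exact ⟨(⟨x, hx⟩ : B α), disjoint_singleton_left.2 hxY⟩)
  let pt : ∀ t : T × C, {p : Fin t.1.1 → C // p ∈ t.1.2.1.1} := fun t => p (.inl t)
  let x : κ → C := fun α => (p (.inr α) : B α).1
  have hpt : ∀ t t', t ≠ t' → ∀ i k, (pt t).1 i ≠ (pt t').1 k := by
    intro t t' hne i k heq
    exact disjoint_left.1 (hp1 (.inl t) (.inl t') fun h' => hne (Sum.inl.inj h'))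
      ⟨i, rfl⟩ ⟨k, heq.symm⟩
  have hpx : ∀ t α, ∀ i, (pt t).1 i ≠ x α := by
    intro t α i heq
    exact disjoint_left.1 (hp1 (.inl t) (.inr α) (by simp)) ⟨i, rfl⟩ heq
  have hxinj : Function.Injective x := by
    intro α β hαβ
    by_contra hne
    exact disjoint_left.1 (hp1 (.inr α) (.inr β) fun h' => hne (Sum.inr.inj h')) rfl hαβ
  let S : Fin 3 → Set C := fun s =>
    {y | (∃ t i, (pt t).1 i = y ∧ t.1.2.1.2 i = s) ∨ (s = 0 ∧ y ∈ range x)}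
  -- The successor separates the points `x α` from all others, which get rank 0. A point of `Q α` of
  -- the form `x β` must have β < α, since `x β` was chosen outside `Q α` whenever α ≤ β.
  let ρ : C → Ordinal.{0} := fun y =>
    if h : ∃ α, x α = y then Order.succ (Ordinal.typein (α := ι) (· < ·) (.inr h.choose)) else 0
  have hρ : ∀ α, ρ (x α) = Order.succ (Ordinal.typein (α := ι) (· < ·) (.inr α)) := by
    intro α
    have h : ∃ β, x β = x α := ⟨α, rfl⟩
    simp only [ρ, dif_pos h]
    rw [hxinj h.choose_spec]
  refine ⟨S, x, ρ, ?_, hxinj, ?_, fun α => ⟨(p (.inr α) : B α).2, .inr ⟨rfl, α, rfl⟩⟩, ?_⟩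
  · intro s s' hne
    refine disjoint_left.2 ?_
    rintro y (⟨t, i, rfl, rfl⟩ | ⟨rfl, α, rfl⟩) (⟨t', k, hk, rfl⟩ | ⟨rfl, β, hβ⟩)
    · by_cases htt : t' = t
      · subst htt
        exact hne (t'.1.2.2.2.2 _ (pt t').2 _ _ hk.symm)
      · exact hpt _ _ htt _ _ hk
    · exact hpx _ _ _ hβ.symm
    · exact hpx _ _ _ hk
    · exact hne rfl
  · intro n A hA hbig l hl
    let t : T := ⟨n, (A, l), hA, hbig, hl⟩
    refine isBig_of_disjoint_family (ι := C) hC.ge (fun c => (pt (t, c)).1)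
      (fun c => ⟨(pt (t, c)).2, fun i => .inl ⟨(t, c), i, rfl, rfl⟩⟩) fun a b hab i k => ?_
    exact hpt _ _ (by simpa using hab) _ _
  · intro α y hy
    rw [hρ, Order.lt_succ_iff]
    by_cases h : ∃ β, x β = y
    · obtain ⟨β, rfl⟩ := h
      rw [hρ, Order.succ_le_iff, Ordinal.typein_lt_typein]
      by_contra! hle
      exact disjoint_left.1 (hp2 (.inr β) (.inr α) hle) rfl hy
    · simp only [ρ, dif_neg h]
      exact zero_le

end Selection

/-! ### Perfect-set arguments for closed sets in powers -/

section NUncountableClosed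

variable {C : Type}

/-- A Cantor scheme: if no relatively open part of a closed set lies in finitely many sections of
the complement of an open relation, there is a copy of `2^ω` of pairwise related points. -/
theorem exists_pairwise_of_open_relation {X : Type*} [TopologicalSpace X] [CompactSpace X]
    [T2Space X] {A : Set X} (hA : IsClosed A) (hne : A.Nonempty) {R : Set (X × X)} (hR : IsOpen R)
    (h : ∀ x ∈ A, ∀ U, IsOpen U → (U ∩ A).Nonempty → ∃ y ∈ U ∩ A, (x, y) ∈ R) :
    ∃ f : (ℕ → Bool) → X, (∀ a, f a ∈ A) ∧
      ∀ a b, a ≠ b → (f a, f b) ∈ R ∨ (f b, f a) ∈ R := by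
  have split : ∀ U : {U : Set X // IsOpen U ∧ (U ∩ A).Nonempty},
      ∃ V : Bool → {U : Set X // IsOpen U ∧ (U ∩ A).Nonempty},
        (∀ b, closure (V b).1 ⊆ U.1) ∧
        ∀ u ∈ closure (V true).1, ∀ v ∈ closure (V false).1, (u, v) ∈ R := by
    rintro ⟨U, hU, x, hxU, hxA⟩
    obtain ⟨y, ⟨hyU, hyA⟩, hxy⟩ := h x hxA U hU ⟨x, hxU, hxA⟩
    obtain ⟨V, W, hV, hW, hxV, hyW, hVW⟩ := isOpen_prod_iff.1 hR x y hxy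
    have hreg : ∀ (z : X) (O : Set X), IsOpen O → z ∈ O → ∃ N, IsOpen N ∧ z ∈ N ∧ closure N ⊆ O := by
      intro z O hO hz
      obtain ⟨s, hs, hsc, hss⟩ := exists_mem_nhds_isClosed_subset (hO.mem_nhds hz)
      exact ⟨interior s, isOpen_interior, mem_interior_iff_mem_nhds.2 hs,
        (closure_minimal interior_subset hsc).trans hss⟩
    obtain ⟨N, hN, hxN, hNs⟩ := hreg x (V ∩ U) (hV.inter hU) ⟨hxV, hxU⟩
    obtain ⟨M, hM, hyM, hMs⟩ := hreg y (W ∩ U) (hW.inter hU) ⟨hyW, hyU⟩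
    refine ⟨fun b => if b then ⟨N, hN, x, hxN, hxA⟩ else ⟨M, hM, y, hyM, hyA⟩, ?_, ?_⟩
    · rintro (_ | _)
      · exact hMs.trans inter_subset_right
      · exact hNs.trans inter_subset_right
    · exact fun u hu v hv => hVW ⟨(hNs hu).1, (hMs hv).1⟩
  choose V hVU hVR using split
  let D : List Bool → {U : Set X // IsOpen U ∧ (U ∩ A).Nonempty} := fun l =>
    List.rec ⟨univ, isOpen_univ, by simpa using hne⟩ (fun b _ U => V U b) l
  have hD : ∀ b l, D (b :: l) = V (D l) b := fun _ _ => rfl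
  have hf : ∀ a : ℕ → Bool, (⋂ n, closure (D (PiNat.res a n)).1 ∩ A).Nonempty := by
    intro a
    refine IsCompact.nonempty_iInter_of_sequence_nonempty_isCompact_isClosed _ (fun n => ?_)
      (fun n => ?_) ((isClosed_closure.inter hA).isCompact) fun n => isClosed_closure.inter hA
    · refine inter_subset_inter_left _ ?_
      rw [PiNat.res_succ, hD]
      exact (hVU _ _).trans subset_closure
    · exact (D _).2.2.mono (inter_subset_inter_left _ subset_closure)
  choose f hf using hf
  have hfm : ∀ a n, f a ∈ closure (D (PiNat.res a n)).1 := fun a n => (mem_iInter.1 (hf a) n).1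
  refine ⟨f, fun a => (mem_iInter.1 (hf a) 0).2, fun a b hab => ?_⟩
  set n := PiNat.firstDiff a b with hn
  have h1 : PiNat.res a n = PiNat.res b n := PiNat.res_eq_res.2 fun k hk =>
    PiNat.apply_eq_of_lt_firstDiff hk
  have h2 := PiNat.apply_firstDiff_ne hab
  have ha := hfm a (n + 1)
  have hb := hfm b (n + 1)
  rw [PiNat.res_succ, hD] at ha hb
  rw [← h1] at hb
  cases ha1 : a n
  · have hb1 : b n = true := by
      rw [← hn, ha1] at h2; simpa using h2.symm
    rw [ha1] at ha; rw [hb1] at hb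
    exact .inr (hVR _ _ hb _ ha)
  · have hb1 : b n = false := by
      rw [← hn, ha1] at h2; simpa using h2.symm
    rw [ha1] at ha; rw [hb1] at hb
    exact .inl (hVR _ _ ha _ hb)

/-- Closed `n`-uncountable sets in powers of a compact metrizable space have `n`-cardinality at
least `2^ω`. -/
theorem isBig_of_isClosed [TopologicalSpace C] [CompactSpace C] [T2Space C]
    [SecondCountableTopology C] {n : ℕ} {A : Set (Fin n → C)} (hA : IsClosed A)
    (h : ∀ Y : Set C, Y.Countable → ∃ x ∈ A, ∀ i, x i ∉ Y) : IsBig A := by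
  let small : Set (Fin n → C) → Prop := fun D => ∃ Y : Set C, Y.Countable ∧ ∀ x ∈ D, ∃ i, x i ∈ Y
  -- As in the Cantor–Bendixson argument, discard the basic open sets on which `A` is met by
  -- countably many coordinates. In the kernel `A'`, no nonempty relatively open part is met in this
  -- way.
  let 𝓑 : Set (Set (Fin n → C)) := {U ∈ countableBasis (Fin n → C) | small (A ∩ U)}
  have h𝓑c : 𝓑.Countable := (countable_countableBasis _).mono (sep_subset _ _)
  choose! Y hY hYA using fun U (hU : U ∈ 𝓑) => hU.2
  let Y₀ : Set C := ⋃ U ∈ 𝓑, Y U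
  have hY₀ : Y₀.Countable := h𝓑c.biUnion fun U hU => hY U hU
  let A' : Set (Fin n → C) := A \ ⋃₀ 𝓑
  have hA' : IsClosed A' :=
    hA.sdiff (isOpen_sUnion fun U hU => isOpen_of_mem_countableBasis hU.1)
  have hsmall : ∀ x ∈ A, x ∉ A' → ∃ i, x i ∈ Y₀ := by
    intro x hx hx'
    obtain ⟨U, hU, hxU⟩ : x ∈ ⋃₀ 𝓑 := by
      by_contra hcon
      exact hx' ⟨hx, hcon⟩
    obtain ⟨i, hi⟩ := hYA U hU x ⟨hx, hxU⟩
    exact ⟨i, mem_biUnion hU hi⟩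
  have hfat : ∀ U, IsOpen U → (U ∩ A').Nonempty → ∀ Z : Set C, Z.Countable →
      ∃ y ∈ U ∩ A', ∀ i, y i ∉ Z := by
    rintro U hU ⟨x, hxU, hxA⟩ Z hZ
    by_contra! hcon
    obtain ⟨W, hW, hxW, hWU⟩ := (isBasis_countableBasis (Fin n → C)).exists_subset_of_mem_open hxU hU
    refine hxA.2 ⟨W, ⟨hW, Y₀ ∪ Z, hY₀.union hZ, fun y hy => ?_⟩, hxW⟩
    by_cases hyA : y ∈ A'
    · obtain ⟨i, hi⟩ := hcon y ⟨hWU hy.2, hyA⟩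
      exact ⟨i, .inr hi⟩
    · obtain ⟨i, hi⟩ := hsmall y hy.1 hyA
      exact ⟨i, .inl hi⟩
  have hne : A'.Nonempty := by
    obtain ⟨x, hx, hxY⟩ := h Y₀ hY₀
    refine ⟨x, ?_⟩
    by_contra hx'
    obtain ⟨i, hi⟩ := hsmall x hx hx'
    exact hxY i hi
  -- Two points are related if they share no coordinate value in any positions; a Cantor scheme then
  -- gives `𝔠` points with disjoint coordinate sets.
  let R : Set ((Fin n → C) × (Fin n → C)) := {q | ∀ i k, q.1 i ≠ q.2 k}
  have hR : IsOpen R := by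
    have : R = ⋂ i, ⋂ k, {q | q.1 i ≠ q.2 k} := by ext; simp [R]
    rw [this]
    exact isOpen_iInter_of_finite fun i => isOpen_iInter_of_finite fun k =>
      isOpen_ne_fun (by fun_prop) (by fun_prop)
  obtain ⟨f, hfA, hfR⟩ := exists_pairwise_of_open_relation hA' hne hR fun x _ U hU hUA => by
    obtain ⟨y, hy, hyx⟩ := hfat U hU hUA (range x) (countable_range x)
    exact ⟨y, hy, fun i k hik => hyx k ⟨i, hik⟩⟩
  refine isBig_of_disjoint_family (ι := ℕ → Bool) (by simp) f
    (fun a => (hfA a).1) fun a b hab i k => ?_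
  rcases hfR a b hab with h1 | h1
  · exact h1 i k
  · exact (h1 k i).symm

end NUncountableClosed

/-! ### The topology of the graph and the construction of the data -/

section Existence

open Filter

variable {C : Type}

theorem IsBig.mono {n : ℕ} {A B : Set (Fin n → C)} (h : IsBig A) (hAB : A ⊆ B) : IsBig B :=
  fun Y hY => (h Y hY).imp fun _ hx => ⟨hAB hx.1, hx.2⟩

theorem IsBig.nonempty {n : ℕ} {A : Set (Fin n → C)} (h : IsBig A) : A.Nonempty :=
  (h ∅ (by simp [Cardinal.continuum_pos])).imp fun _ hx => hx.1

theorem mk_setOf_isClosed_le {X : Type} [TopologicalSpace X] [SecondCountableTopology X] :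
    #{A : Set X | IsClosed A} ≤ 𝔠 := by
  let f : {A : Set X | IsClosed A} → Set (countableBasis X) := fun A => {U | Disjoint U.1 A.1}
  have key : ∀ (A B : {A : Set X | IsClosed A}), f A = f B → A.1 ⊆ B.1 := by
    intro A B hAB x hx
    by_contra hxB
    obtain ⟨U, hU, hxU, hUB⟩ := (isBasis_countableBasis X).exists_subset_of_mem_open
      (show x ∈ B.1ᶜ from hxB) B.2.isOpen_compl
    have h1 : (⟨U, hU⟩ : countableBasis X) ∈ f B := disjoint_left.2 fun y hy => hUB hy
    rw [← hAB] at h1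
    exact disjoint_left.1 h1 hxU hx
  have hf : Function.Injective f := fun A B hAB =>
    Subtype.ext ((key A B hAB).antisymm (key B A hAB.symm))
  refine (Cardinal.mk_le_of_injective hf).trans ?_
  rw [Cardinal.mk_set, ← Cardinal.two_power_aleph0]
  exact Cardinal.power_le_power_left two_ne_zero
    (Cardinal.mk_le_aleph0_iff.2 (countable_countableBasis X).to_subtype)

variable [TopologicalSpace C]

theorem mk_eq_continuum_of_homeomorph (e : C ≃ₜ (ℕ → Bool)) : #C = 𝔠 := by
  rw [Cardinal.mk_congr e.toEquiv]; simp

variable (e : C ≃ₜ (ℕ → Bool))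

/-- The topology of the square induced by `graphMap`. -/
noncomputable abbrev squareTopology : TopologicalSpace (Fin 2 → C) :=
  .induced (fun p => graphMap e (p 0, p 1)) inferInstance

theorem squareTopology_le : squareTopology e ≤ powTopology ‹TopologicalSpace C› 2 := by
  rw [← continuous_id_iff_le]
  have h : @Continuous _ _ (squareTopology e) _ fun p : Fin 2 → C => graphMap e (p 0, p 1) :=
    continuous_induced_dom
  refine @continuous_pi _ _ _ (squareTopology e) _ _ fun i => ?_
  fin_cases i
  · exact @Continuous.comp _ _ _ (squareTopology e) _ _ _ _
      (continuous_fst.comp continuous_fst) h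
  · exact @Continuous.comp _ _ _ (squareTopology e) _ _ _ _
      (continuous_snd.comp continuous_fst) h

variable {e}

theorem isClosed_squareTopology {A : Set (Fin 2 → C)} : IsClosed[squareTopology e] A ↔
    ∃ F, IsClosed F ∧ (fun p : Fin 2 → C => graphMap e (p 0, p 1)) ⁻¹' F = A :=
  isClosed_induced_iff

theorem isClosed_preimage_graphMap_inter {F : Set ((C × C) × ℝ)} (hF : IsClosed F) (n : ℕ) :
    IsClosed (graphMap e ⁻¹' F ∩ {p | p.2 ∉ cyl e p.1 n}) := by
  have hR := BernsteinData.isClopen_differ e n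
  rw [← isOpen_compl_iff, isOpen_iff_mem_nhds]
  intro p hp
  by_cases hpR : p ∈ {p : C × C | p.2 ∉ cyl e p.1 n}
  · have hne : p.1 ≠ p.2 := fun heq => hpR (heq ▸ mem_cyl_self _ _)
    have hc : ContinuousAt (graphMap e) p := continuousAt_id.prodMk (continuousAt_gg hne)
    refine mem_of_superset (hc.preimage_mem_nhds (hF.isOpen_compl.mem_nhds fun h => hp ⟨h, hpR⟩)) ?_
    exact compl_subset_compl.2 inter_subset_left
  · exact mem_of_superset (hR.compl.isOpen.mem_nhds hpR) (compl_subset_compl.2 inter_subset_right)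

theorem continuous_gam (n : ℕ) : Continuous (gam e n) :=
  continuous_iff_continuousAt.2 fun x => by
    have h : gam e n =ᶠ[𝓝 x] fun _ => gam e n x := by
      filter_upwards [cyl_mem_nhds (e := e) x n] with y hy
      exact gam_congr hy
    exact continuousAt_const.congr h.symm

/-- Closed sets contain countably many or `2^ω` points of the graph of `ff`. -/
theorem exists_notMem_of_not_countable {F : Set ((C × C) × ℝ)} (hF : IsClosed F)
    (h : ¬ {x | graphMap e (x, x) ∈ F}.Countable) {Y : Set C} (hY : #Y < 𝔠) :
    ∃ x, graphMap e (x, x) ∈ F ∧ x ∉ Y := by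
  let _ : MeasurableSpace C := borel C
  have : BorelSpace C := ⟨rfl⟩
  have : PolishSpace Bool := inferInstance
  have : PolishSpace C := e.isClosedEmbedding.polishSpace
  -- As a limit of continuous functions `ff` is Borel, so the set in question is Borel; being
  -- uncountable, it has `𝔠` points.
  have hff : Measurable (ff e) :=
    measurable_of_tendsto_metrizable (fun n => (continuous_gam (e := e) n).measurable)
      (tendsto_pi_nhds.2 tendsto_gam)
  have hm : Measurable fun x => graphMap e (x, x) := by
    unfold graphMap
    simp only [gg_diag]
    exact (measurable_id.prodMk measurable_id).prodMk hff
  have hS : MeasurableSet {x | graphMap e (x, x) ∈ F} := hm hF.measurableSet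
  have := hS.standardBorel
  have hcard : #{x | graphMap e (x, x) ∈ F} = 𝔠 := by
    rw [Cardinal.mk_congr (PolishSpace.measurableEquivNatBoolOfNotCountable h).toEquiv]
    simp
  by_contra! hcon
  exact absurd ((Cardinal.mk_le_mk_of_subset fun x hx => hcon x hx).trans_lt hY) hcard.not_lt

/-- If the diagonal trace is uncountable, it already has `𝔠` points. Otherwise some slab off the
diagonal, where the topology is the usual one, is met by no countable set of coordinates; if there
were none, countably many coordinates would meet all of `A`. -/
theorem isBig_of_isClosed_squareTopology {A : Set (Fin 2 → C)} (hA : IsClosed[squareTopology e] A)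
    (h : NUncountable A) : IsBig A := by
  obtain ⟨F, hF, rfl⟩ := isClosed_squareTopology.1 hA
  by_cases hd : {x | graphMap e (x, x) ∈ F}.Countable
  swap
  · intro Y hY
    obtain ⟨x, hx, hxY⟩ := exists_notMem_of_not_countable hF hd hY
    exact ⟨fun _ => x, hx, fun _ => hxY⟩
  have := BernsteinData.secondCountable e
  have : T2Space C := e.symm.t2Space
  have : CompactSpace C := e.symm.compactSpace
  let G : ℕ → Set (Fin 2 → C) := fun n =>
    (fun p => (p 0, p 1)) ⁻¹' (graphMap e ⁻¹' F ∩ {p | p.2 ∉ cyl e p.1 n})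
  have hG : ∀ n, IsClosed (G n) := fun n =>
    (isClosed_preimage_graphMap_inter hF n).preimage (by fun_prop)
  by_cases hn : ∃ n, ∀ Y : Set C, Y.Countable → ∃ x ∈ G n, ∀ i, x i ∉ Y
  · obtain ⟨n, hn⟩ := hn
    exact (isBig_of_isClosed (hG n) hn).mono fun p hp => hp.1
  push Not at hn
  choose Y hY hYG using hn
  obtain ⟨p, hp, hpY⟩ := h.exists_notMem (hd.union (countable_iUnion hY))
  by_cases hp01 : p 0 = p 1
  · refine absurd (.inl ?_) (hpY 0)
    change graphMap e (p 0, p 1) ∈ F at hp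
    rwa [← hp01] at hp
  · obtain ⟨n, hn⟩ := exists_notMem_cyl (e := e) hp01
    obtain ⟨i, hi⟩ := hYG n p ⟨hp, hn⟩
    exact absurd (.inr (mem_iUnion.2 ⟨n, hi⟩)) (hpY i)

theorem isAdmissibleSquareTopology (e : C ≃ₜ (ℕ → Bool)) :
    IsAdmissibleSquareTopology ‹TopologicalSpace C› (squareTopology e) where
  le_product := squareTopology_le e
  card_closed_le := by
    have := BernsteinData.secondCountable e
    refine (Cardinal.mk_le_mk_of_subset fun A hA => ?_).trans ((Cardinal.mk_image_le (s :=
      {F : Set ((C × C) × ℝ) | IsClosed F})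
      (f := fun F => (fun p : Fin 2 → C => graphMap e (p 0, p 1)) ⁻¹' F)).trans
      mk_setOf_isClosed_le)
    exact isClosed_squareTopology.1 hA.1
  le_nCard _ hA h := (isBig_of_isClosed_squareTopology hA h).le_nCard h.pos

/-- The points of the diagonal in both closures of the images of two sets in the graph of `gg`. -/
def diagOverlap (e : C ≃ₜ (ℕ → Bool)) (D E : Set (C × C)) : Set C :=
  {x | graphMap e (x, x) ∈ closure (graphMap e '' D) ∩ closure (graphMap e '' E)}

/-- Approximate the graph point over `(x, x)` from `D` and `E` in turn, each time deeper in the tree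
than the previous pair. As no chosen coordinate equals `x`, its level of departure is finite and can
be passed. -/
theorem exists_alternating_sequence {x : C} {D E : Set (C × C)} (hx : x ∈ diagOverlap e D E)
    (hne : ∀ p ∈ D ∪ E, p.1 ≠ x ∧ p.2 ≠ x) :
    ∃ w : ℕ → C × C, (∀ n, w n ∈ D ∪ E) ∧ (∃ᶠ n in atTop, w n ∈ D) ∧ (∃ᶠ n in atTop, w n ∈ E) ∧
      Tendsto w atTop (𝓝 (x, x)) ∧ Tendsto (fun n => gg e (w n)) atTop (𝓝 (ff e x)) ∧
      ∀ n m, n ≠ m → fd e (w n).1 x ≠ fd e (w m).2 x := by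
  have step : ∀ n K : ℕ, ∃ p ∈ (if Even n then D else E), p.1 ∈ cyl e x K ∧ p.2 ∈ cyl e x K ∧
      |gg e p - ff e x| < 1 / (n + 1 : ℝ) := by
    intro n K
    have h1 : graphMap e (x, x) ∈ closure (graphMap e '' if Even n then D else E) := by
      split_ifs
      exacts [hx.1, hx.2]
    have hpos : (0 : ℝ) < 1 / (n + 1 : ℝ) := by positivity
    obtain ⟨_, ⟨⟨hp1, hp2⟩, hp3⟩, p, hp, rfl⟩ := mem_closure_iff_nhds.1 h1
      ((cyl e x K ×ˢ cyl e x K) ×ˢ Metric.ball (gg e (x, x)) (1 / (n + 1 : ℝ)))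
      (prod_mem_nhds (prod_mem_nhds (cyl_mem_nhds _ _) (cyl_mem_nhds _ _))
        (Metric.ball_mem_nhds _ hpos))
    refine ⟨p, hp, hp1, hp2, ?_⟩
    rw [gg_diag] at hp3
    exact hp3
  choose pt hpt hpt1 hpt2 hpt3 using step
  -- The next depth exceeds the levels at which both previous coordinates leave `x`, so cross levels
  -- can never coincide.
  let K : ℕ → ℕ := fun n =>
    Nat.rec 0 (fun n K => fd e (pt n K).1 x + fd e (pt n K).2 x + K + 1) n
  have hK : ∀ n, K (n + 1) = fd e (pt n (K n)).1 x + fd e (pt n (K n)).2 x + K n + 1 :=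
    fun _ => rfl
  have hKm : StrictMono K := strictMono_nat_of_lt_succ fun n => by rw [hK]; lia
  have hmem : ∀ n, pt n (K n) ∈ D ∪ E := fun n => by
    have := hpt n (K n)
    split_ifs at this
    exacts [.inl this, .inr this]
  have hfd1 : ∀ n, K n ≤ fd e (pt n (K n)).1 x := fun n => by
    rw [fd_comm]; exact (mem_cyl_iff (hne _ (hmem n)).1.symm).1 (hpt1 _ _)
  have hfd2 : ∀ n, K n ≤ fd e (pt n (K n)).2 x := fun n => by
    rw [fd_comm]; exact (mem_cyl_iff (hne _ (hmem n)).2.symm).1 (hpt2 _ _)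
  have htend : ∀ u : ℕ → C, (∀ n, u n ∈ cyl e x (K n)) → Tendsto u atTop (𝓝 x) := by
    intro u hu
    refine (hasBasis_cyl (e := e) x).tendsto_right_iff.2 fun k _ => ?_
    filter_upwards [eventually_ge_atTop k] with n hn
    exact cyl_anti x (hn.trans (hKm.id_le n)) (hu n)
  refine ⟨fun n => pt n (K n), hmem, ?_, ?_,
    (htend _ fun n => hpt1 _ _).prodMk_nhds (htend _ fun n => hpt2 _ _), ?_, ?_⟩
  · refine frequently_atTop.2 fun n => ⟨2 * n, by lia, ?_⟩
    have := hpt (2 * n) (K (2 * n))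
    rwa [if_pos (even_two_mul n)] at this
  · refine frequently_atTop.2 fun n => ⟨2 * n + 1, by lia, ?_⟩
    have := hpt (2 * n + 1) (K (2 * n + 1))
    rwa [if_neg (Nat.not_even_two_mul_add_one n)] at this
  · refine tendsto_iff_dist_tendsto_zero.2 (squeeze_zero (fun _ => dist_nonneg) (fun n => ?_)
      tendsto_one_div_add_atTop_nhds_zero_nat)
    exact (hpt3 n (K n)).le
  · intro n m hnm
    rcases lt_or_gt_of_ne hnm with h | h
    · have h1 := hKm.monotone (Nat.succ_le_of_lt h)
      have h2 := hfd2 m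
      rw [Nat.succ_eq_add_one, hK] at h1
      lia
    · have h1 := hKm.monotone (Nat.succ_le_of_lt h)
      have h2 := hfd1 n
      rw [Nat.succ_eq_add_one, hK] at h1
      lia

/-- Replaces arbitrary subsets of the square by sequences, of which there are only `𝔠`, so that all
pairs can be listed in the selection. -/
theorem exists_dense_sequence (e : C ≃ₜ (ℕ → Bool)) {D : Set (C × C)} (hD : D.Nonempty) :
    ∃ d : ℕ → C × C, range d ⊆ D ∧ closure (graphMap e '' D) ⊆ closure (graphMap e '' range d) := by
  have := BernsteinData.secondCountable e
  have : MetrizableSpace C := e.isEmbedding.metrizableSpace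
  obtain ⟨t, htD, htc, hDt⟩ :=
    (IsSeparable.of_separableSpace (graphMap e '' D)).exists_countable_dense_subset
  have hinj : Function.Injective (graphMap e) := fun p q h => congr_arg Prod.fst h
  have himg : graphMap e '' (graphMap e ⁻¹' t) = t :=
    image_preimage_eq_of_subset (htD.trans (image_subset_range _ _))
  have hne : (graphMap e ⁻¹' t).Nonempty := by
    rw [← image_nonempty (f := graphMap e), himg, ← closure_nonempty_iff]
    exact (hD.image _).mono hDt
  obtain ⟨d, hd⟩ := (htc.preimage hinj).exists_eq_range hne
  refine ⟨d, ?_, ?_⟩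
  · rw [← hd]
    intro p hp
    obtain ⟨q, hq, hqp⟩ := htD hp
    exact hinj hqp ▸ hq
  · rw [← hd, himg]
    exact closure_minimal hDt isClosed_closure

/-- Existence of the sets and sequences defining the two refinements. -/
theorem exists_bernsteinData (e : C ≃ₜ (ℕ → Bool)) :
    ∃ (S : Fin 3 → Set C) (z : C → ℕ → C × C) (rk : C → Ordinal.{0}),
      Pairwise (Function.onFun Disjoint S) ∧ BernsteinData e (S 1) (S 2) z rk ∧
      (∀ n, ∀ A : Set (Fin n → C), IsClosed A → NUncountable A → ∀ s,
        IsBig (A ∩ {p | ∀ i, p i ∈ S s})) ∧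
      ∀ A : Set (Fin 2 → C), IsClosed[squareTopology e] A → NUncountable A → ∀ s,
        IsBig (A ∩ {p | ∀ i, p i ∈ S s}) := by
  classical
  have := BernsteinData.secondCountable e
  have : T2Space C := e.symm.t2Space
  have : CompactSpace C := e.symm.compactSpace
  have hC : #C = 𝔠 := mk_eq_continuum_of_homeomorph e
  -- For `n = 2` the second family consists of the closed sets of the graph topology; it is written
  -- so as to make sense for every `n`.
  let 𝓕 : ∀ n, Set (Set (Fin n → C)) := fun n => {A | IsClosed A} ∪
    (fun F => {p | ∀ i j : Fin n, i.val = 0 → j.val = 1 → graphMap e (p i, p j) ∈ F}) ''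
      {F : Set ((C × C) × ℝ) | IsClosed F}
  have h𝓕 : ∀ n, #(𝓕 n) ≤ 𝔠 := fun n => by
    refine (Cardinal.mk_union_le _ _).trans ((add_le_add mk_setOf_isClosed_le
      (Cardinal.mk_image_le.trans mk_setOf_isClosed_le)).trans ?_)
    rw [Cardinal.continuum_add_self]
  -- One index for each pair of sequences with uncountable diagonal overlap. Its point is chosen in
  -- this overlap and after all coordinates of the sequences, so the sequences have smaller rank.
  let κ : Type := {q : (ℕ → C × C) × (ℕ → C × C) //
    ¬ (diagOverlap e (range q.1) (range q.2)).Countable}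
  have hκ : #κ ≤ 𝔠 := by
    refine (Cardinal.mk_subtype_le _).trans ?_
    simp [hC]
  let B : κ → Set C := fun α => diagOverlap e (range α.1.1) (range α.1.2)
  have hB : ∀ α, ∀ Y : Set C, #Y < 𝔠 → ∃ x ∈ B α, x ∉ Y := fun α Y hY =>
    exists_notMem_of_not_countable (isClosed_closure.inter isClosed_closure) α.2 hY
  let R : κ → Set (C × C) := fun α => range α.1.1 ∪ range α.1.2
  have hR : ∀ α, (R α).Countable := fun α => (countable_range _).union (countable_range _)
  obtain ⟨S, x, ρ, hS, hx, hbig, hxB, hρ⟩ := exists_bernstein_sets hC 𝓕 h𝓕 hκ B hB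
    (fun α => Prod.fst '' R α ∪ Prod.snd '' R α)
    fun α => ((hR α).image _).union ((hR α).image _)
  have hρ1 : ∀ α, ∀ p ∈ R α, ρ p.1 < ρ (x α) := fun α p hp => hρ α _ (.inl ⟨p, hp, rfl⟩)
  have hρ2 : ∀ α, ∀ p ∈ R α, ρ p.2 < ρ (x α) := fun α p hp => hρ α _ (.inr ⟨p, hp, rfl⟩)
  choose w hwR hwD hwE hwt hwg hwfd using fun α => exists_alternating_sequence (hxB α).1
    fun p hp => ⟨fun h => (hρ1 α p hp).ne (by rw [h]), fun h => (hρ2 α p hp).ne (by rw [h])⟩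
  let z : C → ℕ → C × C := fun y => if h : ∃ α, x α = y then w h.choose else fun _ => (y, y)
  have hz : ∀ y, (∃ α, x α = y ∧ z y = w α) ∨ z y = fun _ => (y, y) := by
    intro y
    by_cases h : ∃ α, x α = y
    · exact .inl ⟨h.choose, h.choose_spec, dif_pos h⟩
    · exact .inr (dif_neg h)
  have hzx : ∀ α, z (x α) = w α := by
    intro α
    have h : ∃ β, x β = x α := ⟨α, rfl⟩
    simp only [z, dif_pos h]
    rw [hx h.choose_spec]
  have hclosed : ∀ n, ∀ A : Set (Fin n → C), IsClosed A →
      (∀ Y : Set C, Y.Countable → ∃ x ∈ A, ∀ i, x i ∉ Y) → ∀ l : Fin n → Fin 3,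
      (∀ p ∈ A, ∀ i k, p i = p k → l i = l k) → IsBig (A ∩ {p | ∀ i, p i ∈ S (l i)}) :=
    fun n A hA h => hbig n A (.inl hA) (isBig_of_isClosed hA h)
  have hcount : ∀ s, ∀ A : Set C, IsClosed A → Disjoint A (S s) → A.Countable := by
    intro s A hA hAS
    by_contra hcon
    obtain ⟨p, hp, hps⟩ := (hclosed 1 ((fun p => p 0) ⁻¹' A) (hA.preimage (by fun_prop))
      (fun Y hY => by
        by_contra! h
        refine hcon (hY.mono fun y hy => ?_)
        obtain ⟨i, hi⟩ := h (fun _ => y) hy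
        exact hi) (fun _ => s) fun _ _ _ _ _ => rfl).nonempty
    exact disjoint_left.1 hAS hp (hps 0)
  refine ⟨S, z, ρ, hS, ?_, fun n A hA h s => hclosed n A hA (fun Y hY => h.exists_notMem hY)
    (fun _ => s) fun _ _ _ _ _ => rfl, fun A hA h s => ?_⟩
  · refine ⟨hS (by decide), fun y => ?_, fun y => ?_, fun y => ?_, hcount 1, hcount 2, ?_, ?_⟩
    · rcases hz y with ⟨α, rfl, h⟩ | h
      · rw [h]
        exact .inr ⟨disjoint_left.1 (hS (by decide)) (hxB α).2,
          disjoint_left.1 (hS (by decide)) (hxB α).2,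
          fun n => ⟨hρ1 α _ (hwR α n), hρ2 α _ (hwR α n)⟩, hwfd α⟩
      · exact .inl fun n => by rw [h]
    · rcases hz y with ⟨α, rfl, h⟩ | h
      · rw [h]; exact hwt α
      · rw [h]; exact tendsto_const_nhds
    · rcases hz y with ⟨α, rfl, h⟩ | h
      · rw [h]; exact hwg α
      · simp only [h, gg_diag]; exact tendsto_const_nhds
    · intro A hA hne hAS
      by_contra! hcon
      -- The mixed labels 1 and 2 are admissible because the two coordinates differ throughout `A`;
      -- they yield a point of `A` in `S 1 ×ˢ S 2`.
      obtain ⟨p, hp, hps⟩ := (hclosed 2 ((fun p => (p 0, p 1)) ⁻¹' A) (hA.preimage (by fun_prop))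
        (fun Y hY => by
          obtain ⟨p, hp, hp1, hp2⟩ := hcon Y hY
          exact ⟨![p.1, p.2], hp, by simp [Fin.forall_fin_two, hp1, hp2]⟩) ![1, 2]
        (fun p hp => by
          have := hne _ hp
          simp only at this
          simp [Fin.forall_fin_two, this, this.symm])).nonempty
      exact disjoint_left.1 hAS hp ⟨hps 0, hps 1⟩
    · intro D E hDE
      obtain ⟨y, hyD, hyE⟩ : (diagOverlap e D E).Nonempty := by
        by_contra hcon
        rw [not_nonempty_iff_eq_empty] at hcon
        exact hDE (by rw [← diagOverlap, hcon]; exact countable_empty)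
      obtain ⟨d, hdD, hd⟩ := exists_dense_sequence e
        (image_nonempty.1 (closure_nonempty_iff.1 (nonempty_of_mem hyD)))
      obtain ⟨d', hdE, hd'⟩ := exists_dense_sequence e
        (image_nonempty.1 (closure_nonempty_iff.1 (nonempty_of_mem hyE)))
      have hov : diagOverlap e D E ⊆ diagOverlap e (range d) (range d') :=
        fun x hx => ⟨hd hx.1, hd' hx.2⟩
      let α : κ := ⟨(d, d'), fun hc => hDE (hc.mono hov)⟩
      refine ⟨x α, ?_, ?_⟩
      · rw [hzx]; exact (hwD α).mono fun n hn => hdD hn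
      · rw [hzx]; exact (hwE α).mono fun n hn => hdE hn
  · obtain ⟨F, hF, hFA⟩ := isClosed_squareTopology.1 hA
    refine hbig 2 A (.inr ⟨F, hF, ?_⟩) (isBig_of_isClosed_squareTopology hA h) (fun _ => s)
      fun _ _ _ _ _ => rfl
    rw [← hFA]
    ext p
    simp [Fin.forall_fin_two]

end Existence

/-! ### Closed bases and retractions for the refinements -/

section Refinements

variable {C : Type*} {σ : TopologicalSpace C} [τ : TopologicalSpace C]

theorem exists_isTopologicalBasis_of_isClosed
    (h : ∀ x U, IsOpen[σ] U → x ∈ U → ∃ W, IsOpen[σ] W ∧ IsClosed[τ] W ∧ x ∈ W ∧ W ⊆ U) :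
    ∃ 𝓑 : Set (Set C), @IsTopologicalBasis C σ 𝓑 ∧ ∀ B ∈ 𝓑, IsClosed[τ] B := by
  refine ⟨{W | IsOpen[σ] W ∧ IsClosed[τ] W}, ?_, fun W hW => hW.2⟩
  refine @isTopologicalBasis_of_isOpen_of_nhds C σ _ (fun W hW => hW.1) fun x U hx hU => ?_
  obtain ⟨W, h1, h2, h3, h4⟩ := h x U hU hx
  exact ⟨W, ⟨h1, h2⟩, h3, h4⟩

/-- A refinement with a base of closed sets is a retract of its free Abelian topological group. -/
theorem exists_retraction_of_closed_base [Nonempty C] (e : C ≃ₜ (ℕ → Bool))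
    (hσ : σ ≤ τ)
    (h : ∀ x U, IsOpen[σ] U → x ∈ U → ∃ W, IsOpen[σ] W ∧ IsClosed[τ] W ∧ x ∈ W ∧ W ⊆ U) :
    ∃ r : FreeAbelianTopGroup (Retop σ) → Retop σ, Continuous r ∧ ∀ x, r (.gen x) = x := by
  let j : Retop σ ≃ C := Equiv.refl C
  have : Nonempty (Retop σ) := ‹Nonempty C›
  refine ⟨fun w => oddBranch e j w.toFree, continuous_oddBranch (continuous_toBase hσ) ?_,
    fun x => oddBranch_of x⟩
  intro x U hU hx
  obtain ⟨W, h1, h2, h3, h4⟩ := h x U hU hx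
  exact ⟨W, h2, h1, h3, h4⟩

end Refinements

/-! ### The main theorem -/

theorem theorem3 :
    ∃ (μ : TopologicalSpace (Fin 2 → cantorSet)) (S₁ S₂ : Set cantorSet)
      (τ₁ τ₂ : TopologicalSpace cantorSet),
      -- the construction of the two spaces `C₁ = Retop τ₁` and `C₂ = Retop τ₂`
      IsAdmissibleSquareTopology cantorTopology μ ∧
      Disjoint S₁ S₂ ∧
      WeaklyBernstein μ S₁ ∧ WeaklyBernstein μ S₂ ∧ WeaklyBernstein μ (S₁ ∪ S₂)ᶜ ∧
      IsBernsteinRefinement cantorTopology S₁ τ₁ ∧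
      IsBernsteinRefinement cantorTopology S₂ τ₂ ∧
      T4Space (Retop τ₁ × Retop τ₂) ∧
      cechDim (Retop τ₁ × Retop τ₂) = 1 ∧ katetovDim (Retop τ₁ × Retop τ₂) = 1 ∧
      -- the space `X = C₁ ⊕ C₂` is a Lindelöf Tychonoff space
      T35Space (Retop τ₁ ⊕ Retop τ₂) ∧ LindelofSpace (Retop τ₁ ⊕ Retop τ₂) ∧
      -- (i)
      cechDim (Retop τ₁ ⊕ Retop τ₂) = 0 ∧ katetovDim (Retop τ₁ ⊕ Retop τ₂) = 0 ∧
      -- (ii)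
      0 < cechDim (FreeAbelianTopGroup (Retop τ₁ ⊕ Retop τ₂)) ∧
      0 < katetovDim (FreeAbelianTopGroup (Retop τ₁ ⊕ Retop τ₂)) ∧
      -- (iii)
      0 < cechDim (FreeTopGroup (Retop τ₁ ⊕ Retop τ₂)) ∧
      0 < katetovDim (FreeTopGroup (Retop τ₁ ⊕ Retop τ₂)) := by
  let e := cantorSetHomeomorphNatToBool
  obtain ⟨S, z, rk, hS, h, hbig, hbig'⟩ := exists_bernsteinData e
  have : Nonempty cantorSet := ⟨e.symm fun _ => false⟩
  have : Nonempty (Retop (topFst (S 1) z)) := ‹Nonempty cantorSet›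
  have : Nonempty (Retop (topSnd (S 2) z)) := ‹Nonempty cantorSet›
  have := h.lindelofSpace_fst
  have := h.lindelofSpace_snd
  have := h.t2Space_fst
  have := h.t2Space_snd
  have hC : #cantorSet = 𝔠 := mk_eq_continuum_of_homeomorph e
  have hbase₁ := fun x U => exists_isClosed_isOpen_subset e h.tend_fst h.dich_fst x (U := U)
  have hbase₂ := fun x U => exists_isClosed_isOpen_subset e h.tend_snd h.dich_snd x (U := U)
  have hpow : ∀ s n, 1 ≤ n → WeaklyBernstein (powTopology cantorTopology n) (S s) :=
    fun s n hn A hA hu => (hbig n A hA hu s).nCard_eq hC hn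
  have hsq : ∀ s, WeaklyBernstein (squareTopology e) (S s) :=
    fun s A hA hu => (hbig' A hA hu s).nCard_eq hC one_le_two
  have hsum := h.hasClopenBase_fst.sum h.hasClopenBase_snd
  have := hsum.regularSpace
  obtain ⟨r₁, hr₁, hrg₁⟩ := exists_retraction_of_closed_base e h.topFst_le hbase₁
  obtain ⟨r₂, hr₂, hrg₂⟩ := exists_retraction_of_closed_base e h.topSnd_le hbase₂
  obtain ⟨s, r, hs, hr, hrs⟩ := exists_section_freeAbelian hr₁ hr₂ hrg₁ hrg₂
  obtain ⟨s', r', hs', hr', hrs'⟩ := exists_section_free hr₁ hr₂ hrg₁ hrg₂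
  have hopen := h.not_coverDimLE_zero (fun _ h => h) fun _ h => h.isOpen
  have hcozero := h.not_coverDimLE_zero (fun _ h => h.isOpen) fun _ h => h
  refine ⟨squareTopology e, S 1, S 2, topFst (S 1) z, topSnd (S 2) z,
    isAdmissibleSquareTopology e, h.disj, hsq 1, hsq 2, fun A hA hu => ?_,
    ⟨hpow 1, h.topFst_le, fun _ hx _ hU => mem_nhds_of_mem_seqTopology hx hU,
      exists_isTopologicalBasis_of_isClosed hbase₁, cechDim_eq_zero h.hasClopenBase_fst,
      katetovDim_eq_zero h.hasClopenBase_fst⟩,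
    ⟨hpow 2, h.topSnd_le, fun _ hx _ hU => mem_nhds_of_mem_seqTopology hx hU,
      exists_isTopologicalBasis_of_isClosed hbase₂, cechDim_eq_zero h.hasClopenBase_snd,
      katetovDim_eq_zero h.hasClopenBase_snd⟩,
    h.t4Space_prod, h.cechDim_prod, h.katetovDim_prod, ?_, inferInstance,
    cechDim_eq_zero hsum, katetovDim_eq_zero hsum,
    cechDim_retract hs hr hrs hopen, katetovDim_retract hs hr hrs hcozero,
    cechDim_retract hs' hr' hrs' hopen, katetovDim_retract hs' hr' hrs' hcozero⟩
  -- The third Bernstein set `S 0` lies in the complement of the other two and makes that complement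
  -- weakly Bernstein.
  · have hsub : A ∩ {p | ∀ i, p i ∈ S 0} ⊆ A ∩ {p | ∀ i, p i ∈ (S 1 ∪ S 2)ᶜ} := by
      refine inter_subset_inter_right _ fun p hp i => ?_
      rintro (hi | hi)
      · exact disjoint_left.1 (hS (by decide)) (hp i) hi
      · exact disjoint_left.1 (hS (by decide)) (hp i) hi
    exact ((hbig' A hA hu 0).mono hsub).nCard_eq hC one_le_two
  · have : NormalSpace (Retop (topFst (S 1) z) ⊕ Retop (topSnd (S 2) z)) := inferInstance
    infer_instance
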